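/- Let $r\ge 1$ and $n$ be integers, $\zeta=e^{2\pi i/r}$, and let $W=G(r,1,n)$ be the group of $n\times n$ monomial matrices whose nonzero entries are $r$-th roots of unity, with $\zeta_i=\mathrm{diag}(1,\dots,\zeta,\dots,1)$ ($\zeta$ in position $i$) and $s_{ij}=(i\,j)$. Let $F\supseteq\mathbb{C}$ be a field, $\kappa,c_0,d_1,\dots,d_{r-1}\in F$, and define $d_i$ for all $i\in\mathbb{Z}$ by $d_0+\cdots+d_{r-1}=0$ and $d_i=d_j$ if $i\equiv j \bmod r$. Let $\mathbb{H}$ be the rational Cherednik algebra: the $F$-algebra generated by $F[x_1,\dots,x_n]$, $F[y_1,\dots,y_n]$ and the group algebra $FW$ (spanned by $t_w$, $w\in W$), with relations $t_wx=(wx)t_w$, $t_wy=(wy)t_w$, $$y_ix_j=x_jy_i+c_0\sum_{l=0}^{r-1}\zeta^{-l}t_{\zeta_i^ls_{ij}\zeta_i^{-l}}\quad(i\ne j),$$ $$y_ix_i=x_iy_i+\kappa-\sum_{j=0}^{r-1}(d_j-d_{j-1})e_{ij}-c_0\sum_{j\neq i}\sum_{l=0}^{r-1}t_{\zeta_i^ls_{ij}\zeta_i^{-l}},\qquad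 e_{ij}=\frac1r\sum_{l=0}^{r-1}\zeta^{-lj}t_{\zeta_i^l},$$ where $y_1,\dots,y_n$ is the standard basis of the reflection representation of $W$ and $x_1,\dots,x_n$ is the dual basis. Put $$z_i=y_ix_i+c_0\sum_{1\le j<i}\sum_{l=0}^{r-1}t_{\zeta_i^ls_{ij}\zeta_i^{-l}}\qquad(1\le i\le n),$$ and let $\mathfrak{t}\subseteq\mathbb{H}$ be the subalgebra generated by $z_1,\dots,z_n,t_{\zeta_1},\dots,t_{\zeta_n}$. Let $\lambda=(\lambda^0,\dots,\lambda^{r-1})$ be an $r$-partition of $n$, and let $\mathrm{SYT}(\lambda)$ be the set of standard Young tableaux on $\lambda$, where $T(i)$ is the box of $T$ containing $i$. For a box $b$ in row $p$ and column $q$ of $\lambda^k$ write $\beta(b)=k$ and $\mathrm{ct}(b)=q-p$. Let $S^\lambda$ be the irreducible $FW$-module with basis $v_T$, $T\in\mathrm{SYT}(\lambda)$, given by Young's orthonormal form: $t_{\zeta_i}v_T=\zeta^{\beta(T(i))}v_T$ and $t_{s_{i,i+1}}v_T=a\,v_T+\sqrt{1-a^2}\,v_{s_iT}$, where $s_iT$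 is $T$ with $i$ and $i+1$ interchanged, $v_{s_iT}=0$ if $s_iT$ is not standard, $a=1/(\mathrm{ct}(T(i+1))-\mathrm{ct}(T(i)))$ if $\beta(T(i))=\beta(T(i+1))$, and $a=0$ otherwise. Let $M(\lambda)=\mathrm{Ind}_{FW\otimes F[y_1,\dots,y_n]}^{\mathbb{H}}S^\lambda$, with the $y_i$ acting on $S^\lambda$ by $0$. For $\mu\in\mathbb{Z}_{\ge0}^n$ let $\mu_+$ be its non-increasing rearrangement, let $w_\mu\in S_n$ be the longest permutation such that $w_\mu.\mu$ is non-decreasing, where $(w.\mu)_i=\mu_{w^{-1}(i)}$, and put $v_T^\mu=t_{w_\mu}^{-1}v_T$. Define $\mu<\nu$ if $\mu_+<\nu_+$ in dominance order, or $\mu_+=\nu_+$ and $w_\mu<w_\nu$ in Bruhat order. Set $(\mu,T)<(\nu,S)$ if and only if $\mu<\nu$. **Theorem.** The elements $x^\mu v_T^\mu$, for $\mu\in\mathbb{Z}_{\ge0}^n$ and $T\in\mathrm{SYT}(\lambda)$, form an $F$-basis of $M(\lambda)$, and the following hold for all $\mu\in\mathbb{Z}_{\ge 0}^n$ and $T\in\mathrm{SYT}(\lambda)$.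 (a) For $1\le i\le n$, with $b_i=\beta(T(w_\mu(i)))$, $$t_{\zeta_i}.x^\mu v_T^\mu=\zeta^{b_i-\mu_i}x^\mu v_T^\mu,$$ $$z_i.x^\mu v_T^\mu=\bigl(\kappa(\mu_i+1)-(d_{b_i}-d_{b_i-\mu_i-1})-c_0\,r\,\mathrm{ct}(T(w_\mu(i)))\bigr)x^\mu v_T^\mu+\sum_{(\nu,S)<(\mu,T)}c_{\nu,S}\,x^\nu v_S^\nu$$ for some $c_{\nu,S}\in F$. (b) If the parameters are generic, that is, $\kappa,c_0,d_1,\dots,d_{r-1}$ are algebraically independent over $\mathbb{C}$ (for example $F=\mathbb{C}(\kappa,c_0,d_1,\dots,d_{r-1})$), then there is a unique $\mathfrak{t}$-eigenvector $f_{\mu,T}\in M(\lambda)$ of the form $$f_{\mu,T}=x^\mu v_T^\mu+\sum_{(\nu,S)<(\mu,T)}c_{\nu,S}\,x^\nu v_S^\nu,$$ and its $\mathfrak{t}$-eigenvalue is given by (a): for all $i$, $$t_{\zeta_i}.f_{\mu,T}=\zeta^{b_i-\mu_i}f_{\mu,T},\qquad z_i.f_{\mu,T}=\bigl(\kappa(\mu_i+1)-(d_{b_i}-d_{b_i-\mu_i-1})-c_0\,r\,\mathrm{ct}(T(w_\mu(i)))\bigr)f_{\mu,T}.$$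 -/

import Mathlib

open scoped TensorProduct

noncomputable section

namespace Dunkl

/-! ### The group `G(r,1,n)` -/

/-- `G(r,1,n) = (ℤ/r)ⁿ ⋊ Sₙ`. The pair `(a, σ)` stands for the monomial matrix sending the
standard basis vector `y_j` to `ζ ^ a_{σ j} y_{σ j}`, that is `diag(ζ ^ a) * P_σ`. -/
abbrev W (r n : ℕ) : Type :=
  (Fin n → Multiplicative (ZMod r)) ⋊[mulAutArrow] (Equiv.Perm (Fin n))

/-- The permutation matrix of `σ`, as an element of `G(r,1,n)`. -/
def W.perm (r : ℕ) {n : ℕ} (σ : Equiv.Perm (Fin n)) : W r n := SemidirectProduct.inr σ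

/-- The diagonal matrix `ζ_i ^ l`, with `ζ ^ l` in position `i` and `1` elsewhere. -/
def W.zeta {r n : ℕ} (i : Fin n) (l : ZMod r) : W r n :=
  SemidirectProduct.inl (Pi.mulSingle i (Multiplicative.ofAdd l))

/-- The reflection `ζ_i ^ l s_{ij} ζ_i ^ (-l)`. -/
def W.refl {r n : ℕ} (i j : Fin n) (l : ZMod r) : W r n :=
  W.zeta i l * W.perm r (Equiv.swap i j) * (W.zeta i l)⁻¹

/-- `ζ ^ k` in `F ⊇ ℂ`, where `ζ = exp (2 π i / r)`, for `k` an integer modulo `r`. -/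
def zetaPow (F : Type*) [Field F] [Algebra ℂ F] {r : ℕ} [NeZero r] (k : ZMod r) : F :=
  algebraMap ℂ F (ZMod.stdAddChar k)

/-! ### Multipartitions and standard tableaux -/

/-- An `r`-partition `(λ⁰, …, λ^{r-1})` of `n`; the components are indexed by residues mod `r`. -/
structure RPartition (r n : ℕ) [NeZero r] where
  /-- the components -/
  part : ZMod r → YoungDiagram
  card_eq : ∑ k, (part k).card = n

section Tableaux

variable {r n : ℕ} [NeZero r]

/-- The boxes of an `r`-partition: a component together with a cell (row, column) of it. -/
abbrev Box (lam : RPartition r n) : Type := Σ k : ZMod r, {c : ℕ × ℕ // c ∈ lam.part k}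

/-- `β(b)`: the index of the component that contains the box `b`. -/
def Box.beta {lam : RPartition r n} (b : Box lam) : ZMod r := b.1

/-- The content (column minus row) of a box. -/
def Box.ct {lam : RPartition r n} (b : Box lam) : ℤ := (b.2.1.2 : ℤ) - (b.2.1.1 : ℤ)

/-- A filling of the boxes by `1, …, n` (seen as a bijection from entries to boxes) is standard if,
within each component, entries increase strictly from left to right and from top to bottom. -/
def IsStandard {lam : RPartition r n} (T : Fin n ≃ Box lam) : Prop :=
  ∀ b b' : Box lam, b.beta = b'.beta →
    ((b.2.1.1 = b'.2.1.1 ∧ b.2.1.2 < b'.2.1.2) ∨ (b.2.1.2 = b'.2.1.2 ∧ b.2.1.1 < b'.2.1.1)) →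
    T.symm b < T.symm b'

/-- Standard Young tableaux on an `r`-partition. -/
abbrev SYT (lam : RPartition r n) : Type := {T : Fin n ≃ Box lam // IsStandard T}

/-- The diagonal coefficient `1 / (ct T(j) - ct T(i))` of Young's orthonormal form (used for
`j = i + 1`); it is `0` if `i` and `j` lie in different components of `T`. -/
def youngCoeff {lam : RPartition r n} (T : SYT lam) (i j : Fin n) : ℝ :=
  if (T.1 i).beta = (T.1 j).beta then 1 / (((T.1 j).ct : ℝ) - ((T.1 i).ct : ℝ)) else 0

end Tableaux

/-! ### The `F G(r,1,n)`-modules `S^λ` -/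

section Specht

variable (F : Type*) [Field F] [Algebra ℂ F] {r n : ℕ} [NeZero r] (lam : RPartition r n)

/-- The group algebra `F W`. -/
abbrev GroupAlg (r n : ℕ) : Type _ := MonoidAlgebra F (W r n)

/-- The free `F W`-module on the symbols `v_T`. -/
abbrev FreeSpecht : Type _ := SYT lam →₀ GroupAlg F r n

open Classical in
/-- The symbol `v_Q` of a filling `Q`, with the convention `v_Q = 0` if `Q` is not standard. -/
def freeVec (Q : Fin n ≃ Box lam) : FreeSpecht F lam :=
  if h : IsStandard Q then Finsupp.single ⟨Q, h⟩ 1 else 0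

/-- Young's orthonormal form for `G(r,1,n)`: the action of the generators `ζ_i` and
`s_i = (i, i+1)` on the vectors `v_T`. Here `s_i.T` is `T` with `i` and `i+1` interchanged. -/
inductive SpechtRel : FreeSpecht F lam → Prop
  | zeta (T : SYT lam) (i : Fin n) :
      SpechtRel (MonoidAlgebra.of F (W r n) (W.zeta i 1) • freeVec F lam T.1 -
        (zetaPow F (T.1 i).beta : F) • freeVec F lam T.1)
  | simple (T : SYT lam) (i j : Fin n) (hij : (i : ℕ) + 1 = (j : ℕ)) :
      SpechtRel (MonoidAlgebra.of F (W r n) (W.perm r (Equiv.swap i j)) • freeVec F lam T.1 -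
        (algebraMap ℂ F ((youngCoeff T i j : ℝ) : ℂ) • freeVec F lam T.1 +
          algebraMap ℂ F ((Real.sqrt (1 - youngCoeff T i j ^ 2) : ℝ) : ℂ) •
            freeVec F lam ((Equiv.swap i j).trans T.1)))

/-- The irreducible `F W`-module `S^λ`: the `F W`-module generated by the vectors `v_T`,
`T ∈ SYT(λ)`, on which `W` acts through Young's orthonormal form. -/
abbrev Specht : Type _ :=
  FreeSpecht F lam ⧸ Submodule.span (GroupAlg F r n) {p | SpechtRel F lam p}

/-- The vector `v_T` of `S^λ`. -/
def spechtVec (T : SYT lam) : Specht F lam := Submodule.Quotient.mk (freeVec F lam T.1)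

end Specht

/-! ### The rational Cherednik algebra -/

/-- Generators of the rational Cherednik algebra. -/
inductive Gen (r n : ℕ) : Type
  | x (i : Fin n)
  | y (i : Fin n)
  | t (w : W r n)

section Cherednik

variable {F : Type*} [Field F] [Algebra ℂ F] {r n : ℕ} [NeZero r]

/-- The word `x_i`. -/
abbrev X (F : Type*) [Field F] (r : ℕ) {n : ℕ} (i : Fin n) : FreeAlgebra F (Gen r n) :=
  FreeAlgebra.ι F (Gen.x i)

/-- The word `y_i`. -/
abbrev Y (F : Type*) [Field F] (r : ℕ) {n : ℕ} (i : Fin n) : FreeAlgebra F (Gen r n) :=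
  FreeAlgebra.ι F (Gen.y i)

/-- The word `t_w`. -/
abbrev G (F : Type*) [Field F] {r n : ℕ} (w : W r n) : FreeAlgebra F (Gen r n) :=
  FreeAlgebra.ι F (Gen.t w)

/-- The idempotent `e_{ij} = (1/r) ∑_l ζ ^ (-l j) t_{ζ_i ^ l}`. -/
def idem (F : Type*) [Field F] [Algebra ℂ F] {r n : ℕ} [NeZero r] (i : Fin n) (j : ZMod r) :
    FreeAlgebra F (Gen r n) :=
  ((r : F)⁻¹) • ∑ l : ZMod r, zetaPow F (-(l * j)) • G F (W.zeta i l)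

/-- The defining relations of the rational Cherednik algebra of type `G(r,1,n)`, with parameters
`κ`, `c₀` and `d`. -/
inductive CherednikRel (κ c₀ : F) (d : ZMod r → F) :
    FreeAlgebra F (Gen r n) → FreeAlgebra F (Gen r n) → Prop
  | x_comm (i j : Fin n) : CherednikRel κ c₀ d (X F r i * X F r j) (X F r j * X F r i)
  | y_comm (i j : Fin n) : CherednikRel κ c₀ d (Y F r i * Y F r j) (Y F r j * Y F r i)
  | t_one : CherednikRel κ c₀ d (G F 1) 1
  | t_mul (v w : W r n) : CherednikRel κ c₀ d (G F (v * w)) (G F v * G F w)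
  | t_x (w : W r n) (j : Fin n) : CherednikRel κ c₀ d (G F w * X F r j)
      (zetaPow F (-(w.left (w.right j)).toAdd) • (X F r (w.right j) * G F w))
  | t_y (w : W r n) (j : Fin n) : CherednikRel κ c₀ d (G F w * Y F r j)
      (zetaPow F (w.left (w.right j)).toAdd • (Y F r (w.right j) * G F w))
  | y_x_ne (i j : Fin n) (hij : i ≠ j) : CherednikRel κ c₀ d (Y F r i * X F r j)
      (X F r j * Y F r i + c₀ • ∑ l : ZMod r, zetaPow F (-l) • G F (W.refl i j l))
  | y_x_self (i : Fin n) : CherednikRel κ c₀ d (Y F r i * X F r i)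
      (X F r i * Y F r i + algebraMap F _ κ - ∑ j : ZMod r, (d j - d (j - 1)) • idem F i j -
        c₀ • ∑ j ∈ Finset.univ.filter (fun j => j ≠ i), ∑ l : ZMod r, G F (W.refl i j l))

/-- The rational Cherednik algebra `ℍ` of type `G(r,1,n)`. -/
def Cherednik (n : ℕ) (κ c₀ : F) (d : ZMod r → F) : Type _ :=
  RingQuot (CherednikRel (n := n) κ c₀ d)

instance (κ c₀ : F) (d : ZMod r → F) : Ring (Cherednik n κ c₀ d) :=
  inferInstanceAs (Ring (RingQuot (CherednikRel (n := n) κ c₀ d)))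

instance (κ c₀ : F) (d : ZMod r → F) : Algebra F (Cherednik n κ c₀ d) :=
  inferInstanceAs (Algebra F (RingQuot (CherednikRel (n := n) κ c₀ d)))

/-- The quotient map from the free algebra to `ℍ`. -/
def hmk (κ c₀ : F) (d : ZMod r → F) : FreeAlgebra F (Gen r n) →ₐ[F] Cherednik n κ c₀ d :=
  RingQuot.mkAlgHom F (CherednikRel (n := n) κ c₀ d)

variable (κ c₀ : F) (d : ZMod r → F)

/-- `x_i` in `ℍ`. -/
def hx (i : Fin n) : Cherednik n κ c₀ d := hmk κ c₀ d (X F r i)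

/-- `y_i` in `ℍ`. -/
def hy (i : Fin n) : Cherednik n κ c₀ d := hmk κ c₀ d (Y F r i)

/-- `t_w` in `ℍ`. -/
def ht (w : W r n) : Cherednik n κ c₀ d := hmk κ c₀ d (G F w)

/-- The monomial `x ^ μ` in `ℍ`. -/
def xMonomial (μ : Fin n → ℕ) : Cherednik n κ c₀ d :=
  (List.ofFn fun i => hx κ c₀ d i ^ μ i).prod

/-- The Jucys–Murphy element `φ_i = ∑_{j < i} ∑_l t_{ζ_i ^ l s_{ij} ζ_i ^ (-l)}`. -/
def jucysMurphy (i : Fin n) : Cherednik n κ c₀ d :=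
  ∑ j ∈ Finset.univ.filter (fun j => j < i), ∑ l : ZMod r, ht κ c₀ d (W.refl i j l)

/-- The Dunkl–Opdam element `z_i = y_i x_i + c₀ φ_i`. -/
def dunklOpdam (i : Fin n) : Cherednik n κ c₀ d :=
  hy κ c₀ d i * hx κ c₀ d i + c₀ • jucysMurphy κ c₀ d i

/-- The subalgebra `𝔱` of `ℍ` generated by the `z_i` and the `t_{ζ_i}`. -/
def tSubalgebra (n : ℕ) (κ c₀ : F) (d : ZMod r → F) : Subalgebra F (Cherednik n κ c₀ d) :=
  Algebra.adjoin F (Set.range (dunklOpdam κ c₀ d) ∪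
    Set.range (fun i : Fin n => ht κ c₀ d (W.zeta i 1)))

/-! ### Standard (Verma) modules -/

variable (lam : RPartition r n)

/-- Relations imposed on `ℍ ⊗_F S^λ` to make it balanced over `F W ⊗ F[y_1, …, y_n]`, where the
`y_i` act on `S^λ` by zero. -/
inductive VermaRel : Cherednik n κ c₀ d ⊗[F] Specht F lam → Prop
  | t (h : Cherednik n κ c₀ d) (w : W r n) (v : Specht F lam) :
      VermaRel ((h * ht κ c₀ d w) ⊗ₜ[F] v - h ⊗ₜ[F] (MonoidAlgebra.of F (W r n) w • v))
  | y (h : Cherednik n κ c₀ d) (i : Fin n) (v : Specht F lam) :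
      VermaRel ((h * hy κ c₀ d i) ⊗ₜ[F] v)

/-- The standard module `M(λ)`, induced from `S^λ`. -/
abbrev Verma : Type _ :=
  (Cherednik n κ c₀ d ⊗[F] Specht F lam) ⧸
    Submodule.span (Cherednik n κ c₀ d) {p | VermaRel κ c₀ d lam p}

end Cherednik

/-! ### Combinatorics of compositions -/

section Compositions

variable {n : ℕ}

/-- The value (counted from zero) of `w_μ` at `i`. -/
def wCount (μ : Fin n → ℕ) (i : Fin n) : ℕ :=
  (Finset.univ.filter fun j => (j < i ∧ μ j < μ i) ∨ (i < j ∧ μ j ≤ μ i)).card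

theorem wCount_lt (μ : Fin n → ℕ) (i : Fin n) : wCount μ i < n := by
  have h : (Finset.univ.filter fun j => (j < i ∧ μ j < μ i) ∨ (i < j ∧ μ j ≤ μ i)) ⊂
      (Finset.univ : Finset (Fin n)) := by
    refine Finset.ssubset_univ_iff.2 fun h => ?_
    have := h ▸ Finset.mem_univ i
    simp at this
  simpa [wCount] using Finset.card_lt_card h

theorem wCount_lt_wCount (μ : Fin n → ℕ) {i j : Fin n}
    (h : μ i < μ j ∨ (μ i = μ j ∧ j < i)) : wCount μ i < wCount μ j := by
  apply Finset.card_lt_card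
  refine Finset.ssubset_iff_of_subset (fun k hk => ?_) |>.2 ⟨i, ?_, ?_⟩
  · simp only [Finset.mem_filter, Finset.mem_univ, true_and] at hk ⊢
    rcases lt_trichotomy k j with h1 | h1 | h1
    · left; refine ⟨h1, ?_⟩; omega
    · subst h1; omega
    · right; refine ⟨h1, ?_⟩; omega
  · simp only [Finset.mem_filter, Finset.mem_univ, true_and]
    rcases lt_trichotomy i j with h1 | h1 | h1
    · left; refine ⟨h1, ?_⟩; omega
    · subst h1; omega
    · right; refine ⟨h1, ?_⟩; omega
  · simp

theorem wCount_injective (μ : Fin n → ℕ) :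
    Function.Injective fun i => (⟨wCount μ i, wCount_lt μ i⟩ : Fin n) := by
  intro i j hij
  have hij' : wCount μ i = wCount μ j := congrArg Fin.val hij
  by_contra hne
  have h : (μ i < μ j ∨ (μ i = μ j ∧ j < i)) ∨ (μ j < μ i ∨ (μ j = μ i ∧ i < j)) := by omega
  rcases h with h | h
  · have := wCount_lt_wCount μ h; omega
  · have := wCount_lt_wCount μ h; omega

/-- The longest permutation `w_μ` such that `w_μ.μ` is non-decreasing:
`w_μ(i) = #{j < i | μ_j < μ_i} + #{j ≥ i | μ_j ≤ μ_i}` (counting from one). -/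
def wPerm (μ : Fin n → ℕ) : Equiv.Perm (Fin n) :=
  Equiv.ofBijective _ (Finite.injective_iff_bijective.1 (wCount_injective μ))

/-- The non-increasing rearrangement `μ_+`. -/
def sortDesc (μ : Fin n → ℕ) : Fin n → ℕ := fun i => (μ ∘ Tuple.sort μ) (Fin.rev i)

/-- Strict dominance order. -/
def DomLT (μ ν : Fin n → ℕ) : Prop :=
  μ ≠ ν ∧ ∑ i, μ i = ∑ i, ν i ∧
    ∀ m : Fin n, ∑ i ∈ Finset.univ.filter (fun i => i ≤ m), μ i ≤
      ∑ i ∈ Finset.univ.filter (fun i => i ≤ m), ν i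

/-- The length of a permutation: its number of inversions. -/
def permLength (w : Equiv.Perm (Fin n)) : ℕ :=
  (Finset.univ.filter fun p : Fin n × Fin n => p.1 < p.2 ∧ w p.2 < w p.1).card

/-- Strict Bruhat order on `Sₙ`: generated by `u < u (i j)` whenever this multiplication
increases the length. -/
def BruhatLT : Equiv.Perm (Fin n) → Equiv.Perm (Fin n) → Prop :=
  Relation.TransGen fun u v =>
    ∃ i j : Fin n, i ≠ j ∧ v = u * Equiv.swap i j ∧ permLength u < permLength v

/-- The partial order on `ℤ_{≥ 0}ⁿ`: dominance order on `μ_+`, then Bruhat order on `w_μ`. -/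
def CompLT (μ ν : Fin n → ℕ) : Prop :=
  DomLT (sortDesc μ) (sortDesc ν) ∨
    (sortDesc μ = sortDesc ν ∧ BruhatLT (wPerm μ) (wPerm ν))

end Compositions

/-! ### The basis `x^μ v_T^μ`, lower terms, eigenvectors -/

section Main

variable {F : Type*} [Field F] [Algebra ℂ F] {r n : ℕ} [NeZero r]
  (κ c₀ : F) (d : ZMod r → F) (lam : RPartition r n)

/-- The element `x^μ v_T^μ` of `M(λ)`, where `v_T^μ = t_{w_μ}⁻¹ v_T`. -/
def vermaVec (μ : Fin n → ℕ) (T : SYT lam) : Verma κ c₀ d lam :=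
  Submodule.Quotient.mk (xMonomial κ c₀ d μ ⊗ₜ[F]
    (MonoidAlgebra.of F (W r n) (W.perm r (wPerm μ)⁻¹) • spechtVec F lam T))

/-- The span of the `x^ν v_S^ν` with `(ν, S) < (μ, T)`, which means `ν < μ`. -/
def lowerSpan (μ : Fin n → ℕ) : Submodule F (Verma κ c₀ d lam) :=
  Submodule.span F {m | ∃ (ν : Fin n → ℕ) (S : SYT lam), CompLT ν μ ∧ m = vermaVec κ c₀ d lam ν S}

/-- The diagonal entry of `z_i` at `(μ, T)`. -/
def zEigenvalue {lam : RPartition r n} (μ : Fin n → ℕ) (T : SYT lam) (i : Fin n) : F :=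
  let b := T.1 (wPerm μ i)
  κ * ((μ i : F) + 1) - (d b.beta - d (b.beta - (μ i : ZMod r) - 1)) - c₀ * (r : F) * (b.ct : F)

/-- The diagonal entry of `t_{ζ_i}` at `(μ, T)`. -/
def zetaEigenvalue (F : Type*) [Field F] [Algebra ℂ F] {lam : RPartition r n}
    (μ : Fin n → ℕ) (T : SYT lam) (i : Fin n) : F :=
  zetaPow F ((T.1 (wPerm μ i)).beta - (μ i : ZMod r))

/-- A (nonzero, simultaneous) eigenvector of `𝔱` in `M(λ)`. -/
def IsTEigenvector (f : Verma κ c₀ d lam) : Prop :=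
  f ≠ 0 ∧ ∀ a ∈ tSubalgebra n κ c₀ d, ∃ c : F, a • f = c • f

/-- The parameters are generic: `κ, c₀, d_1, …, d_{r-1}` are algebraically independent over `ℂ`. -/
def IsGeneric : Prop :=
  AlgebraicIndependent ℂ
    (Sum.elim ![κ, c₀] (fun j : {j : ZMod r // j ≠ 0} => d j) :
      Fin 2 ⊕ {j : ZMod r // j ≠ 0} → F)

end Main

end Dunkl

end

noncomputable section

namespace Dunkl

/-! ### Homomorphisms out of the symmetric group -/

section Coxeter

/-! The module M(λ) is F[x] ⊗ S^λ with y_i acting by a Dunkl operator, and everything is read off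
from that formula. The operators are written down on F[x] ⊗ V for any representation V of W and
shown to satisfy the relations of ℍ (`isCherednik_ops`). The relations between t_w and y_i and among
the y_i come without computation: the defect of each intertwines the multiplications by the x_k and
kills 1 ⊗ V, so it vanishes (`eq_zero_of_intertwines`). Hence M(λ) maps to F[x] ⊗ S^λ, with inverse
p ⊗ v ↦ p v (`vermaToPoly_polyVec`, `polyToVerma_vermaToPoly`), and the basis claim reduces to the
v_T being a basis of S^λ. Since S^λ is given by generators and relations, this needs an actual
model: Young's formulas do define a representation (`youngRep`), the braid relation being a
partial-fraction identity (`boxCoeff_mul`).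

For (a), the Dunkl operator is applied to x_i x^μ. The q-derivatives only rescale x^μ and give the κ
and d terms, the latter by telescoping (`sum_diagCoeff_mul_sum_zetaPow`). Modulo lower monomials,
the divided difference for the pair i, j gives the reflected monomial when j < i, which c₀ φ_i
cancels, and x^μ itself exactly when w_μ(j) < w_μ(i) (`divDiff_monomial_mem`). The surviving
reflections act on t_{w_μ}⁻¹ v_T as a conjugate of the Jucys–Murphy element of w_μ(i), whose
eigenvalue is r times the content (`jmSum_smul_spechtVec`).

For (b), the z_i and t_{ζ_i} commute (`IsCherednik.dunklOpdam_comm`) and are triangular. Generically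
the eigenvalues of z_i for μ and ν differ as soon as μ_i ≠ ν_i, because κ occurs with coefficient
μ_i + 1 (`zEigenvalue_ne_of_isGeneric`). A polynomial in the operators then projects x^μ v_T^μ to
the required eigenvector, and the same projector proves uniqueness (`exists_unique_eigenvector`). -/

/-- The elements `g_0, …, g_{n-2}` of a monoid satisfy the Coxeter relations of `Sₙ`. -/
structure CoxeterFamily {M : Type*} [Monoid M] (n : ℕ) (g : ℕ → M) : Prop where
  sq : ∀ i, i + 1 < n → g i * g i = 1
  braid : ∀ i, i + 2 < n → g i * g (i + 1) * g i = g (i + 1) * g i * g (i + 1)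
  comm : ∀ i j, i + 1 < j → j + 1 < n → g i * g j = g j * g i

variable {M : Type*} [Monoid M]

/-- The product `g_p g_{p+1} ⋯ g_{p+k-1}`. -/
def cycleWord (g : ℕ → M) : ℕ → ℕ → M
  | _, 0 => 1
  | p, k + 1 => g p * cycleWord g (p + 1) k

theorem CoxeterFamily.mono {g : ℕ → M} {m n : ℕ} (h : CoxeterFamily n g) (hmn : m ≤ n) :
    CoxeterFamily m g where
  sq i hi := h.sq i (by omega)
  braid i hi := h.braid i (by omega)
  comm i j hij hj := h.comm i j hij (by omega)

theorem CoxeterFamily.mul_cycleWord_of_lt {n : ℕ} {g : ℕ → M} (h : CoxeterFamily n g) (i : ℕ) :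
    ∀ k p, i + 1 < p → p + k < n → g i * cycleWord g p k = cycleWord g p k * g i
  | 0, p, _, _ => by simp [cycleWord]
  | k + 1, p, hp, hk => by
    rw [cycleWord, ← mul_assoc, h.comm i p hp (by omega), mul_assoc,
      h.mul_cycleWord_of_lt i k (p + 1) (by omega) (by omega), mul_assoc]

/-- The generator commutes past the letters of the word until it meets g_i g_{i+1}, where the braid
relation lowers its index by one; it then commutes past the rest. -/
theorem CoxeterFamily.mul_cycleWord_of_gt {n : ℕ} {g : ℕ → M} (h : CoxeterFamily n g) (i : ℕ) :
    ∀ k p, p < i + 1 → i + 1 < p + k → p + k < n →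
      g (i + 1) * cycleWord g p k = cycleWord g p k * g i
  | 0, p, h1, h2, _ => by omega
  | k + 1, p, h1, h2, h3 => by
    rcases Nat.lt_succ_iff_lt_or_eq.1 h1 with hp | rfl
    · rw [cycleWord, ← mul_assoc, ← h.comm p (i + 1) (by omega) (by omega), mul_assoc,
        h.mul_cycleWord_of_gt i k (p + 1) (by omega) (by omega) (by omega), mul_assoc]
    · obtain ⟨k, rfl⟩ : ∃ m, k = m + 1 := ⟨k - 1, by omega⟩
      rw [cycleWord, cycleWord, mul_assoc, mul_assoc,
        ← h.mul_cycleWord_of_lt p k (p + 1 + 1) (by omega) (by omega)]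
      simp only [← mul_assoc]
      rw [h.braid p (by omega)]

/-- The adjacent transpositions of `ℕ`. -/
def natSwap (i : ℕ) : Equiv.Perm ℕ := Equiv.swap i (i + 1)

theorem coxeterFamily_natSwap (n : ℕ) : CoxeterFamily n natSwap where
  sq i _ := Equiv.swap_mul_self _ _
  braid i _ := by
    ext k
    simp only [natSwap, Equiv.Perm.mul_apply, Equiv.swap_apply_def]
    split_ifs <;> omega
  comm i j hij _ := by
    ext k
    simp only [natSwap, Equiv.Perm.mul_apply, Equiv.swap_apply_def]
    split_ifs <;> omega

theorem cycleWord_natSwap_apply : ∀ k p, cycleWord natSwap p k (p + k) = p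
  | 0, p => by simp [cycleWord]
  | k + 1, p => by
    have := cycleWord_natSwap_apply k (p + 1)
    rw [cycleWord, Equiv.Perm.mul_apply, show p + (k + 1) = p + 1 + k by ring, this]
    simp [natSwap]

theorem cycleWord_natSwap_apply_of_lt : ∀ k p m, p + k < m → cycleWord natSwap p k m = m
  | 0, p, m, _ => by simp [cycleWord]
  | k + 1, p, m, h => by
    rw [cycleWord, Equiv.Perm.mul_apply, cycleWord_natSwap_apply_of_lt k (p + 1) m (by omega)]
    exact Equiv.swap_apply_of_ne_of_ne (by omega) (by omega)

/-- The value at `σ` of the map `S_n → M` determined by the family `g`, through the factorization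
of `σ` along the chain `S_1 ⊂ S_2 ⊂ ⋯`. -/
def coxeterValue (g : ℕ → M) : ℕ → Equiv.Perm ℕ → M
  | 0, _ => 1
  | n + 1, σ => cycleWord g (σ n) (n - σ n) *
      coxeterValue g n ((cycleWord natSwap (σ n) (n - σ n))⁻¹ * σ)

theorem coxeterValue_one (g : ℕ → M) : ∀ n, coxeterValue g n 1 = 1
  | 0 => rfl
  | n + 1 => by simp [coxeterValue, cycleWord, coxeterValue_one g n]

/-- The value is defined through coset representatives s_p ⋯ s_{n-1} of S_n in S_{n+1}, where p =
σ(n). Compatibility with left multiplication by generators is all that is needed for a homomorphism,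
so no presentation theorem for S_n enters. -/
theorem CoxeterFamily.coxeterValue_mul {g : ℕ → M} :
    ∀ {n : ℕ}, CoxeterFamily n g → ∀ (i : ℕ) (σ : Equiv.Perm ℕ), i + 1 < n →
      (∀ k, n ≤ k → σ k = k) → coxeterValue g n (natSwap i * σ) = g i * coxeterValue g n σ
  | 0, _, i, σ, hi, _ => by omega
  | n + 1, h, i, σ, hi, hσ => by
    have ih := CoxeterFamily.coxeterValue_mul (h.mono n.le_succ)
    have hpn : σ n ≤ n := by
      by_contra! hlt
      have := σ.injective (hσ (σ n) (by omega))
      omega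
    have hN := coxeterFamily_natSwap (n + 1)
    simp only [coxeterValue, Equiv.Perm.mul_apply]
    obtain ⟨k, hk⟩ : ∃ k, n = σ n + k := ⟨n - σ n, by omega⟩
    set p := σ n with hp
    -- The representative sends n to p, so dividing by it leaves a permutation supported below n, to
    -- which the induction applies.
    have hfix : ∀ m, n ≤ m → ((cycleWord natSwap p (n - p))⁻¹ * σ) m = m := by
      intro m hm
      rw [Equiv.Perm.mul_apply, Equiv.Perm.inv_eq_iff_eq]
      rcases hm.lt_or_eq with hm | rfl
      · rw [hσ m hm, cycleWord_natSwap_apply_of_lt _ _ _ (by omega)]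
      · rw [← hp]
        conv_rhs => rw [show n = p + (n - p) by omega]
        rw [show p + (n - p) - p = n - p by omega, cycleWord_natSwap_apply]
    -- Multiplication by s_i passes through the representative, lengthens it, shortens it (using
    -- s_i² = 1), or passes through with index lowered to i - 1.
    have hcase : i + 1 < p ∨ i + 1 = p ∨ i = p ∨ p < i := by omega
    rcases hcase with hc | hc | hc | hc
    · have hs : natSwap i p = p := Equiv.swap_apply_of_ne_of_ne (by omega) (by omega)
      rw [hs, ← mul_assoc (g i), h.mul_cycleWord_of_lt i _ _ hc (by omega), mul_assoc,
        ← ih i _ (by omega) hfix, ← mul_assoc, ← mul_assoc]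
      congr 3
      rw [inv_mul_eq_iff_eq_mul, ← mul_assoc, eq_mul_inv_iff_mul_eq,
        hN.mul_cycleWord_of_lt i _ _ hc (by omega)]
    · have hs : natSwap i p = i := by rw [natSwap, hc, Equiv.swap_apply_right]
      have hni : n - i = (n - p) + 1 := by omega
      rw [hs, hni, cycleWord, cycleWord, hc, mul_inv_rev, mul_assoc, mul_assoc]
      congr 3
      rw [inv_mul_cancel_left]
    · have hs : natSwap i p = p + 1 := by rw [natSwap, hc, Equiv.swap_apply_left]
      have hni : n - p = (n - (p + 1)) + 1 := by omega
      rw [hs, hni, cycleWord, cycleWord, ← mul_assoc (g i), ← mul_assoc (g i), hc,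
        h.sq p (by omega), one_mul, mul_inv_rev]
      rw [show (natSwap p)⁻¹ = natSwap p from Equiv.swap_inv _ _, mul_assoc]
    · have hs : natSwap i p = p := Equiv.swap_apply_of_ne_of_ne (by omega) (by omega)
      obtain ⟨i, rfl⟩ : ∃ m, i = m + 1 := ⟨i - 1, by omega⟩
      rw [hs, ← mul_assoc (g _), h.mul_cycleWord_of_gt i _ _ hc (by omega) (by omega), mul_assoc,
        ← ih i _ (by omega) hfix, ← mul_assoc, ← mul_assoc]
      congr 3
      rw [inv_mul_eq_iff_eq_mul, ← mul_assoc, eq_mul_inv_iff_mul_eq,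
        hN.mul_cycleWord_of_gt i _ _ hc (by omega) (by omega)]

/-- The adjacent transposition of `Fin n` exchanging `i` and `i + 1`. -/
def adjSwap {n : ℕ} (i : ℕ) (hi : i + 1 < n) : Equiv.Perm (Fin n) :=
  Equiv.swap ⟨i, by omega⟩ ⟨i + 1, hi⟩

theorem perm_induction_adjSwap {n : ℕ} {P : Equiv.Perm (Fin n) → Prop} (one : P 1)
    (mul : ∀ i hi σ, P σ → P (adjSwap i hi * σ)) (σ : Equiv.Perm (Fin n)) : P σ := by
  rcases n with _ | n
  · rwa [Subsingleton.elim σ 1]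
  have hσ : σ ∈ Submonoid.closure (Set.range fun i : Fin n => Equiv.swap i.castSucc i.succ) := by
    rw [Equiv.Perm.mclosure_swap_castSucc_succ]; trivial
  induction hσ using Submonoid.closure_induction_left with
  | one => exact one
  | mul_left x hx y _ hy =>
    obtain ⟨i, rfl⟩ := hx
    exact mul i (by omega) y hy

/-- A family satisfying the Coxeter relations of `Sₙ` extends to a homomorphism from `Sₙ`. -/
theorem CoxeterFamily.exists_hom {n : ℕ} {g : ℕ → M} (h : CoxeterFamily n g) :
    ∃ f : Equiv.Perm (Fin n) →* M, ∀ i hi, f (adjSwap i hi) = g i := by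
  -- All the symmetric groups sit inside the permutations of ℕ, so that the recursion on n stays in
  -- one group.
  let emb : Equiv.Perm (Fin n) →* Equiv.Perm ℕ :=
    Equiv.Perm.viaEmbeddingHom (Fin.valEmbedding : Fin n ↪ ℕ)
  have hemb (σ : Equiv.Perm (Fin n)) (i : Fin n) : emb σ i = σ i :=
    Equiv.Perm.viaEmbedding_apply σ Fin.valEmbedding i
  have hemb' (σ : Equiv.Perm (Fin n)) (k : ℕ) (hk : n ≤ k) : emb σ k = k :=
    Equiv.Perm.viaEmbedding_apply_of_notMem σ Fin.valEmbedding k (by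
      rintro ⟨i, rfl⟩
      exact absurd i.2 (not_lt.2 hk))
  have hswap (i : ℕ) (hi : i + 1 < n) : emb (adjSwap i hi) = natSwap i := by
    ext k
    rcases lt_or_ge k n with hk | hk
    · have := hemb (adjSwap i hi) ⟨k, hk⟩
      rw [show ((⟨k, hk⟩ : Fin n) : ℕ) = k from rfl] at this
      rw [this]
      simp only [adjSwap, natSwap, Equiv.swap_apply_def, Fin.ext_iff]
      split_ifs <;> rfl
    · rw [hemb' _ _ hk]
      exact (Equiv.swap_apply_of_ne_of_ne (by omega) (by omega)).symm
  have hone : coxeterValue g n (emb 1) = 1 := by rw [map_one, coxeterValue_one]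
  have hstep (i : ℕ) (hi : i + 1 < n) (σ : Equiv.Perm (Fin n)) :
      coxeterValue g n (emb (adjSwap i hi * σ)) = g i * coxeterValue g n (emb σ) := by
    rw [map_mul, hswap, h.coxeterValue_mul i _ hi (hemb' σ)]
  refine ⟨⟨⟨fun σ => coxeterValue g n (emb σ), hone⟩, fun σ τ => ?_⟩, fun i hi => ?_⟩
  · induction σ using perm_induction_adjSwap with
    | one => simp only [one_mul, hone]
    | mul i hi σ ih =>
      simp only at ih ⊢
      rw [mul_assoc, hstep, ih, hstep, mul_assoc]
  · have := hstep i hi 1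
    rwa [mul_one, hone, mul_one] at this

end Coxeter

/-! ### Contents in standard tableaux -/

section Contents

variable {r n : ℕ} [NeZero r] {lam : RPartition r n}

theorem IsStandard.symm_lt_symm {T : Fin n ≃ Box lam} (hT : IsStandard T) {b b' : Box lam}
    (hb : b.beta = b'.beta) (h1 : b.2.1.1 ≤ b'.2.1.1) (h2 : b.2.1.2 ≤ b'.2.1.2) (hne : b ≠ b') :
    T.symm b < T.symm b' := by
  obtain ⟨k, ⟨p, q⟩, hc⟩ := b
  obtain ⟨k', ⟨p', q'⟩, hc'⟩ := b'
  obtain rfl : k = k' := hb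
  simp only at h1 h2
  have hm : (p, q') ∈ lam.part k := (lam.part k).up_left_mem h1 le_rfl hc'
  rcases h1.lt_or_eq with h1 | rfl
  · refine lt_of_le_of_lt ?_ (hT ⟨k, (p, q'), hm⟩ ⟨k, (p', q'), hc'⟩ rfl (Or.inr ⟨rfl, h1⟩))
    rcases h2.lt_or_eq with h2 | rfl
    · exact (hT ⟨k, (p, q), hc⟩ ⟨k, (p, q'), hm⟩ rfl (Or.inl ⟨rfl, h2⟩)).le
    · exact le_rfl
  · rcases h2.lt_or_eq with h2 | rfl
    · exact hT _ _ rfl (Or.inl ⟨rfl, h2⟩)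
    · exact absurd rfl hne

theorem Box.eq_of_eq {b b' : Box lam} (hb : b.beta = b'.beta) (h1 : b.2.1.1 = b'.2.1.1)
    (h2 : b.2.1.2 = b'.2.1.2) : b = b' := by
  obtain ⟨k, ⟨p, q⟩, hc⟩ := b
  obtain ⟨k', ⟨p', q'⟩, hc'⟩ := b'
  obtain rfl : k = k' := hb
  obtain rfl : p = p' := h1
  obtain rfl : q = q' := h2
  rfl

/-- Of two boxes on one diagonal, one is strictly south-east of the other; the right and lower
neighbours of the first are two further boxes whose entries lie strictly in between. So entries at
distance 1 or 2 in one component have different contents, and Young's denominators do not vanish. -/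
theorem IsStandard.add_three_le {T : Fin n ≃ Box lam} (hT : IsStandard T) {i j : Fin n}
    (hij : i < j) (hb : (T i).beta = (T j).beta) (hc : (T i).ct = (T j).ct) :
    (i : ℕ) + 3 ≤ j := by
  have key : ∀ b b' : Box lam, b.beta = b'.beta → b.ct = b'.ct → b.2.1.1 < b'.2.1.1 →
      (T.symm b : ℕ) + 3 ≤ T.symm b' := by
    intro b b' hb hc hlt
    obtain ⟨k, ⟨p, q⟩, hbc⟩ := b
    obtain ⟨k', ⟨p', q'⟩, hbc'⟩ := b'
    obtain rfl : k = k' := hb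
    simp only [Box.ct] at hc hlt
    have m1 : (p, q + 1) ∈ lam.part k := (lam.part k).up_left_mem (by omega) (by omega) hbc'
    have m2 : (p + 1, q) ∈ lam.part k := (lam.part k).up_left_mem (by omega) (by omega) hbc'
    have l1 := hT ⟨k, (p, q), hbc⟩ ⟨k, (p, q + 1), m1⟩ rfl (Or.inl ⟨rfl, Nat.lt_succ_self q⟩)
    have l2 := hT ⟨k, (p, q), hbc⟩ ⟨k, (p + 1, q), m2⟩ rfl (Or.inr ⟨rfl, Nat.lt_succ_self p⟩)
    have l3 : T.symm ⟨k, (p, q + 1), m1⟩ < T.symm ⟨k, (p', q'), hbc'⟩ := by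
      refine hT.symm_lt_symm rfl (by simp only; omega) (by simp only; omega) fun h => ?_
      simp at h
      omega
    have l4 : T.symm ⟨k, (p + 1, q), m2⟩ < T.symm ⟨k, (p', q'), hbc'⟩ := by
      refine hT.symm_lt_symm rfl (by simp only; omega) (by simp only; omega) fun h => ?_
      simp at h
      omega
    have l5 : T.symm ⟨k, (p, q + 1), m1⟩ ≠ T.symm ⟨k, (p + 1, q), m2⟩ := by
      intro h
      simpa using T.symm.injective h
    have l6 := Fin.val_ne_of_ne l5
    rw [Fin.lt_def] at l1 l2 l3 l4
    omega
  rcases lt_trichotomy (T i).2.1.1 (T j).2.1.1 with h | h | h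
  · simpa using key _ _ hb hc h
  · have h2 : (T i).2.1.2 = (T j).2.1.2 := by simp only [Box.ct] at hc; omega
    exact absurd (T.injective (Box.eq_of_eq hb h h2)) hij.ne
  · have := key _ _ hb.symm hc.symm h
    simp only [Equiv.symm_apply_apply] at this
    rw [Fin.lt_def] at hij
    omega

/-- The exchange can only violate an inequality between the boxes of i and i + 1. No entry lies
between these two, so the boxes are neighbours in a row or a column. The coefficient √(1 - a²) is
then 0, in agreement with the convention for non-standard fillings. -/
theorem IsStandard.ct_sub_of_not_isStandard {T : Fin n ≃ Box lam} (hT : IsStandard T) {i j : Fin n}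
    (hij : (i : ℕ) + 1 = j) (h : ¬ IsStandard ((Equiv.swap i j).trans T)) :
    (T i).beta = (T j).beta ∧ ((T j).ct - (T i).ct = 1 ∨ (T j).ct - (T i).ct = -1) := by
  have hne : i ≠ j := fun h => by rw [h] at hij; omega
  unfold IsStandard at h
  push Not at h
  obtain ⟨b, b', hb, hbb, hle⟩ := h
  have hlt := hT b b' hb hbb
  simp only [Equiv.symm_trans_apply, Equiv.symm_swap] at hle
  have hi : T.symm b = i ∧ T.symm b' = j := by
    simp only [Equiv.swap_apply_def, Fin.lt_def, Fin.le_def, Fin.ext_iff] at hle hlt ⊢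
    split_ifs at hle <;> omega
  have hbi : T i = b := by rw [← hi.1, Equiv.apply_symm_apply]
  have hbj : T j = b' := by rw [← hi.2, Equiv.apply_symm_apply]
  rw [hbi, hbj]
  refine ⟨hb, ?_⟩
  obtain ⟨k, ⟨p, q⟩, hbc⟩ := b
  obtain ⟨k', ⟨p', q'⟩, hbc'⟩ := b'
  obtain rfl : k = k' := hb
  have between : ∀ c : Box lam, ¬ (T.symm ⟨k, (p, q), hbc⟩ < T.symm c ∧
      T.symm c < T.symm ⟨k, (p', q'), hbc'⟩) := by
    rintro c ⟨h1, h2⟩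
    rw [hi.1, Fin.lt_def] at h1
    rw [hi.2, Fin.lt_def] at h2
    omega
  simp only [Box.ct] at hbb ⊢
  rcases hbb with ⟨rfl, h2⟩ | ⟨rfl, h2⟩
  · left
    by_contra hcon
    have m1 : (p, q + 1) ∈ lam.part k := (lam.part k).up_left_mem le_rfl (by omega) hbc'
    exact between ⟨k, (p, q + 1), m1⟩ ⟨hT _ _ rfl (Or.inl ⟨rfl, Nat.lt_succ_self q⟩),
      hT _ _ rfl (Or.inl ⟨rfl, by simp only; omega⟩)⟩
  · right
    by_contra hcon
    have m1 : (p + 1, q) ∈ lam.part k := (lam.part k).up_left_mem (by omega) le_rfl hbc'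
    exact between ⟨k, (p + 1, q), m1⟩ ⟨hT _ _ rfl (Or.inr ⟨rfl, Nat.lt_succ_self p⟩),
      hT _ _ rfl (Or.inr ⟨rfl, by simp only; omega⟩)⟩

theorem IsStandard.ct_zero {T : Fin n ≃ Box lam} (hT : IsStandard T) {i : Fin n}
    (hi : (i : ℕ) = 0) : (T i).ct = 0 := by
  have hmin : ∀ c : Box lam, ¬ T.symm c < i := fun c hc => by
    rw [Fin.lt_def] at hc; omega
  have hs : T.symm (T i) = i := T.symm_apply_apply i
  generalize T i = b at hs
  obtain ⟨k, ⟨p, q⟩, hbc⟩ := b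
  have m : (0, 0) ∈ lam.part k := (lam.part k).up_left_mem (Nat.zero_le _) (Nat.zero_le _) hbc
  by_contra hct
  refine hmin ⟨k, (0, 0), m⟩ ?_
  rw [← hs]
  refine hT.symm_lt_symm rfl (Nat.zero_le _) (Nat.zero_le _) fun h => hct ?_
  rw [← h]
  simp [Box.ct]

/-- The diagonal coefficient of Young's orthonormal form for two boxes. -/
def boxCoeff (b b' : Box lam) : ℝ :=
  if b.beta = b'.beta then 1 / ((b'.ct : ℝ) - (b.ct : ℝ)) else 0

theorem boxCoeff_comm (b b' : Box lam) : boxCoeff b b' = -boxCoeff b' b := by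
  unfold boxCoeff
  simp only [eq_comm (a := b.beta)]
  split_ifs
  · rw [← neg_sub (b.ct : ℝ), one_div, one_div, inv_neg]
  · simp

theorem boxCoeff_sq_le (b b' : Box lam) : boxCoeff b b' ^ 2 ≤ 1 := by
  unfold boxCoeff
  split_ifs
  -- Equal contents give 1 / 0 = 0; otherwise the denominator is a nonzero integer.
  · by_cases h : b'.ct - b.ct = 0
    · have : (b'.ct : ℝ) - b.ct = 0 := by exact_mod_cast h
      simp [this]
    · have h1 : (1 : ℤ) ≤ (b'.ct - b.ct) ^ 2 := by
        have := sq_pos_of_ne_zero h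
        omega
      have h2 : (1 : ℝ) ≤ ((b'.ct : ℝ) - b.ct) ^ 2 := by exact_mod_cast h1
      rw [div_pow, one_pow]
      exact div_le_one_of_le₀ h2 (by positivity)
  · norm_num

/-- With u, v the two successive content differences this is 1/(uv) = (1/(u+v)) (1/u + 1/v), the
identity behind the braid relation. If some components differ, both sides are 0. -/
theorem boxCoeff_mul {x y z : Box lam} (hxy : x.beta = y.beta → x.ct ≠ y.ct)
    (hxz : x.beta = z.beta → x.ct ≠ z.ct) (hyz : y.beta = z.beta → y.ct ≠ z.ct) :
    boxCoeff x y * boxCoeff y z = boxCoeff x z * (boxCoeff x y + boxCoeff y z) := by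
  unfold boxCoeff
  by_cases h1 : x.beta = y.beta <;> by_cases h2 : y.beta = z.beta
  · have h3 := h1.trans h2
    have e1 : (y.ct : ℝ) - x.ct ≠ 0 := sub_ne_zero.2 fun h => hxy h1 (by exact_mod_cast h.symm)
    have e2 : (z.ct : ℝ) - y.ct ≠ 0 := sub_ne_zero.2 fun h => hyz h2 (by exact_mod_cast h.symm)
    have e3 : (z.ct : ℝ) - x.ct ≠ 0 := sub_ne_zero.2 fun h => hxz h3 (by exact_mod_cast h.symm)
    rw [if_pos h1, if_pos h2, if_pos h3]
    field_simp
    ring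
  · have h3 : x.beta ≠ z.beta := fun h => h2 (h1.symm.trans h)
    simp [h2, h3]
  · have h3 : x.beta ≠ z.beta := fun h => h1 (h.trans h2.symm)
    simp [h1, h3]
  · simp [h1, h2]

end Contents

/-! ### Young's orthonormal form as a representation -/

section YoungForm

variable (F : Type*) [Field F] [Algebra ℂ F] {r n : ℕ} [NeZero r] {lam : RPartition r n}

/-- The coefficient `1 / (ct b' - ct b)` in `F`. -/
def coeffA (b b' : Box lam) : F := algebraMap ℂ F ((boxCoeff b b' : ℝ) : ℂ)

/-- The coefficient `√(1 - a²)` in `F`. -/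
def coeffB (b b' : Box lam) : F :=
  algebraMap ℂ F ((Real.sqrt (1 - boxCoeff b b' ^ 2) : ℝ) : ℂ)

theorem coeffA_comm (b b' : Box lam) : coeffA F b b' = -coeffA F b' b := by
  simp [coeffA, boxCoeff_comm b b']

theorem coeffB_comm (b b' : Box lam) : coeffB F b b' = coeffB F b' b := by
  simp [coeffB, boxCoeff_comm b b']

theorem coeffB_sq (b b' : Box lam) : coeffB F b b' ^ 2 = 1 - coeffA F b b' ^ 2 := by
  unfold coeffB coeffA
  rw [← map_pow, ← map_pow, ← map_one (algebraMap ℂ F), ← map_sub]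
  congr 1
  rw [← Complex.ofReal_pow, Real.sq_sqrt (sub_nonneg.2 (boxCoeff_sq_le b b'))]
  push_cast
  rfl

theorem coeffA_mul {x y z : Box lam} (hxy : x.beta = y.beta → x.ct ≠ y.ct)
    (hxz : x.beta = z.beta → x.ct ≠ z.ct) (hyz : y.beta = z.beta → y.ct ≠ z.ct) :
    coeffA F x y * coeffA F y z = coeffA F x z * (coeffA F x y + coeffA F y z) := by
  simp only [coeffA, ← map_mul, ← map_add, ← Complex.ofReal_mul, ← Complex.ofReal_add,
    boxCoeff_mul hxy hxz hyz]

theorem coeffB_eq_zero {b b' : Box lam} (hb : b.beta = b'.beta)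
    (h : b'.ct - b.ct = 1 ∨ b'.ct - b.ct = -1) : coeffB F b b' = 0 := by
  have h1 : ((b'.ct : ℝ) - b.ct) = 1 ∨ ((b'.ct : ℝ) - b.ct) = -1 :=
    h.imp (fun h => by exact_mod_cast h) (fun h => by exact_mod_cast h)
  have : boxCoeff b b' ^ 2 = 1 := by
    rw [boxCoeff, if_pos hb]
    rcases h1 with h1 | h1 <;> rw [h1] <;> norm_num
  simp [coeffB, this]

theorem coeffA_mul_sub {b b' : Box lam} (hb : b.beta = b'.beta) (h : b.ct ≠ b'.ct) :
    coeffA F b b' * ((b'.ct : F) - b.ct) = 1 := by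
  have e1 : (b'.ct : ℝ) - b.ct ≠ 0 := sub_ne_zero.2 fun h' => h (by exact_mod_cast h'.symm)
  have h2 : boxCoeff b b' * ((b'.ct : ℝ) - b.ct) = 1 := by
    rw [boxCoeff, if_pos hb, one_div, inv_mul_cancel₀ e1]
  have h3 : ((boxCoeff b b' : ℝ) : ℂ) * ((b'.ct : ℂ) - b.ct) = 1 := by
    rw [← Complex.ofReal_one, ← h2]
    push_cast
    rfl
  have h4 := congrArg (algebraMap ℂ F) h3
  rwa [map_mul, map_sub, map_intCast, map_intCast, map_one] at h4

theorem coeffA_of_ne {b b' : Box lam} (hb : b.beta ≠ b'.beta) : coeffA F b b' = 0 := by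
  simp [coeffA, boxCoeff, hb]

theorem IsStandard.coeffB_eq_zero {T : Fin n ≃ Box lam} (hT : IsStandard T) {i j : Fin n}
    (hij : (i : ℕ) + 1 = j) (h : ¬ IsStandard ((Equiv.swap i j).trans T)) :
    coeffB F (T i) (T j) = 0 :=
  let h' := hT.ct_sub_of_not_isStandard hij h
  Dunkl.coeffB_eq_zero F h'.1 h'.2

open Classical in
/-- The basis vector of a filling, with value `0` if the filling is not standard. -/
def fillVec (Q : Fin n ≃ Box lam) : SYT lam →₀ F :=
  if h : IsStandard Q then Finsupp.single ⟨Q, h⟩ 1 else 0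

omit [Algebra ℂ F] in
theorem fillVec_coe (T : SYT lam) : fillVec F T.1 = Finsupp.single T 1 := by
  rw [fillVec, dif_pos T.2]

/-- A vector-valued function on fillings that vanishes on non-standard fillings and transforms
under an adjacent transposition by Young's rule on standard fillings does so on all fillings. -/
theorem young_rule_of_isStandard {V : Type*} [AddCommGroup V] [Module F V]
    (e : (Fin n ≃ Box lam) → V) (s : V → V) (hs : s 0 = 0) (he : ∀ Q, ¬ IsStandard Q → e Q = 0)
    {i j : Fin n} (hij : (i : ℕ) + 1 = j)
    (h : ∀ Q, IsStandard Q → s (e Q) =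
      coeffA F (Q i) (Q j) • e Q + coeffB F (Q i) (Q j) • e ((Equiv.swap i j).trans Q))
    (Q : Fin n ≃ Box lam) : s (e Q) =
      coeffA F (Q i) (Q j) • e Q + coeffB F (Q i) (Q j) • e ((Equiv.swap i j).trans Q) := by
  by_cases hQ : IsStandard Q
  · exact h Q hQ
  by_cases hQ' : IsStandard ((Equiv.swap i j).trans Q)
  · have hss : (Equiv.swap i j).trans (Equiv.swap i j) = Equiv.refl _ := by ext; simp
    have := hQ'.coeffB_eq_zero F hij (by rwa [← Equiv.trans_assoc, hss, Equiv.refl_trans])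
    simp only [Equiv.trans_apply, Equiv.swap_apply_left, Equiv.swap_apply_right] at this
    rw [he Q hQ, hs, coeffB_comm, this, smul_zero, zero_smul, add_zero]
  · rw [he Q hQ, he _ hQ', hs, smul_zero, smul_zero, add_zero]

/-- The operator of Young's orthonormal form attached to the transposition `(i j)`, `j = i + 1`. -/
def youngSwap (lam : RPartition r n) (i j : Fin n) : Module.End F (SYT lam →₀ F) :=
  Finsupp.linearCombination F fun T : SYT lam =>
    coeffA F (T.1 i) (T.1 j) • fillVec F T.1 +
      coeffB F (T.1 i) (T.1 j) • fillVec F ((Equiv.swap i j).trans T.1)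

theorem youngSwap_fillVec {i j : Fin n} (hij : (i : ℕ) + 1 = j) (Q : Fin n ≃ Box lam) :
    youngSwap F lam i j (fillVec F Q) = coeffA F (Q i) (Q j) • fillVec F Q +
      coeffB F (Q i) (Q j) • fillVec F ((Equiv.swap i j).trans Q) := by
  refine young_rule_of_isStandard F (fillVec F) _ (map_zero _) (fun Q hQ => ?_) hij
    (fun Q hQ => ?_) Q
  · rw [fillVec, dif_neg hQ]
  · have := fillVec_coe F (⟨Q, hQ⟩ : SYT lam)
    simp only at this
    rw [this, youngSwap, Finsupp.linearCombination_single, one_smul, ← this]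

end YoungForm

/-! ### Young's operators satisfy the relations of G(r,1,n) -/

section YoungRep

variable (F : Type*) [Field F] [Algebra ℂ F] {r n : ℕ} [NeZero r] {lam : RPartition r n}

theorem zetaPow_zero : zetaPow F (0 : ZMod r) = 1 := by simp [zetaPow]

theorem zetaPow_add (k l : ZMod r) : zetaPow F (k + l) = zetaPow F k * zetaPow F l := by
  simp [zetaPow, AddChar.map_add_eq_mul]

theorem zetaPow_neg_mul (k : ZMod r) : zetaPow F (-k) * zetaPow F k = 1 := by
  rw [← zetaPow_add, neg_add_cancel, zetaPow_zero]

theorem youngSwap_sq {i j : Fin n} (hij : (i : ℕ) + 1 = j) :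
    youngSwap F lam i j * youngSwap F lam i j = 1 := by
  refine Finsupp.lhom_ext' fun T => LinearMap.ext_ring ?_
  simp only [LinearMap.comp_apply, Finsupp.lsingle_apply, Module.End.mul_apply,
    Module.End.one_apply]
  have hss : (Equiv.swap i j).trans (Equiv.swap i j) = Equiv.refl _ := by ext; simp
  rw [← fillVec_coe, youngSwap_fillVec F hij, map_add, map_smul, map_smul,
    youngSwap_fillVec F hij, youngSwap_fillVec F hij, ← Equiv.trans_assoc, hss, Equiv.refl_trans]
  simp only [Equiv.trans_apply, Equiv.swap_apply_left, Equiv.swap_apply_right]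
  have hb := coeffB_sq F (T.1 i) (T.1 j)
  rw [coeffA_comm F (T.1 j), coeffB_comm F (T.1 j)]
  match_scalars
  · linear_combination hb
  · ring

/-- Both sides expand over the six rearrangements of i, j, k in T. Three coefficients need the
partial-fraction identity `hA` (that of T itself also uses b² = 1 - a²); the other three agree
identically. -/
theorem youngSwap_braid {i j k : Fin n} (hij : (i : ℕ) + 1 = j) (hjk : (j : ℕ) + 1 = k) :
    youngSwap F lam i j * youngSwap F lam j k * youngSwap F lam i j =
      youngSwap F lam j k * youngSwap F lam i j * youngSwap F lam j k := by
  refine Finsupp.lhom_ext' fun T => LinearMap.ext_ring ?_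
  have nij : i ≠ j := fun h => by rw [h] at hij; omega
  have njk : j ≠ k := fun h => by rw [h] at hjk; omega
  have nik : i ≠ k := fun h => by rw [← hij, h] at hjk; omega
  simp only [LinearMap.comp_apply, Finsupp.lsingle_apply, Module.End.mul_apply]
  rw [← fillVec_coe]
  have hne : ∀ {a b : Fin n}, a < b → (b : ℕ) < a + 3 → (T.1 a).beta = (T.1 b).beta →
      (T.1 a).ct ≠ (T.1 b).ct := fun hab hlt hb hc => by
    have := T.2.add_three_le hab hb hc
    omega
  have hA := coeffA_mul F (hne (a := i) (b := j) (by rw [Fin.lt_def]; omega) (by omega))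
    (hne (a := i) (b := k) (by rw [Fin.lt_def]; omega) (by omega))
    (hne (a := j) (b := k) (by rw [Fin.lt_def]; omega) (by omega))
  have hbr : (Equiv.swap i j).trans ((Equiv.swap j k).trans ((Equiv.swap i j).trans T.1)) =
      (Equiv.swap j k).trans ((Equiv.swap i j).trans ((Equiv.swap j k).trans T.1)) := by
    ext x : 1
    simp only [Equiv.trans_apply]
    congr 1
    have h1 := Equiv.swap_mul_swap_mul_swap (x := i) (y := j) (z := k) nij nik
    have h2 := Equiv.swap_mul_swap_mul_swap (x := k) (y := j) (z := i) njk.symm nik.symm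
    rw [Equiv.swap_comm k j, Equiv.swap_comm j i, Equiv.swap_comm i k, ← h1] at h2
    exact Equiv.congr_fun h2 x
  have hs1 (Q : Fin n ≃ Box lam) : (Equiv.swap i j).trans ((Equiv.swap i j).trans Q) = Q := by
    ext x : 1; simp
  have hs2 (Q : Fin n ≃ Box lam) : (Equiv.swap j k).trans ((Equiv.swap j k).trans Q) = Q := by
    ext x : 1; simp
  simp only [youngSwap_fillVec F hij, youngSwap_fillVec F hjk, map_add, map_smul, hs1, hs2, hbr,
    Equiv.trans_apply, Equiv.swap_apply_left, Equiv.swap_apply_right,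
    Equiv.swap_apply_of_ne_of_ne nik.symm njk.symm, Equiv.swap_apply_of_ne_of_ne nij nik]
  have hb1 := coeffB_sq F (T.1 i) (T.1 j)
  have hb2 := coeffB_sq F (T.1 j) (T.1 k)
  rw [coeffA_comm F (T.1 j) (T.1 i), coeffB_comm F (T.1 j) (T.1 i),
    coeffA_comm F (T.1 k) (T.1 j), coeffB_comm F (T.1 k) (T.1 j)]
  generalize coeffA F (T.1 i) (T.1 j) = a at *
  generalize coeffA F (T.1 i) (T.1 k) = b at *
  generalize coeffA F (T.1 j) (T.1 k) = c at *
  generalize coeffB F (T.1 i) (T.1 j) = p at *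
  generalize coeffB F (T.1 i) (T.1 k) = q at *
  generalize coeffB F (T.1 j) (T.1 k) = s at *
  clear hs1 hs2 hbr hne
  match_scalars
  · linear_combination a * hA + b * hb1 - c * hA - b * hb2
  · linear_combination p * hA
  · linear_combination -s * hA
  all_goals ring

theorem youngSwap_comm {i j k l : Fin n} (hij : (i : ℕ) + 1 = j) (hjk : (j : ℕ) < k)
    (hkl : (k : ℕ) + 1 = l) :
    youngSwap F lam i j * youngSwap F lam k l = youngSwap F lam k l * youngSwap F lam i j := by
  refine Finsupp.lhom_ext' fun T => LinearMap.ext_ring ?_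
  have nik : i ≠ k := Fin.ne_of_val_ne (by omega)
  have nil : i ≠ l := Fin.ne_of_val_ne (by omega)
  have njk : j ≠ k := Fin.ne_of_val_ne (by omega)
  have njl : j ≠ l := Fin.ne_of_val_ne (by omega)
  simp only [LinearMap.comp_apply, Finsupp.lsingle_apply, Module.End.mul_apply]
  rw [← fillVec_coe]
  have hbr : (Equiv.swap i j).trans ((Equiv.swap k l).trans T.1) =
      (Equiv.swap k l).trans ((Equiv.swap i j).trans T.1) := by
    ext x : 1
    simp only [Equiv.trans_apply]
    congr 1
    exact Equiv.congr_fun (Equiv.Perm.disjoint_swap_swap (by simp [nik, nil, njk, njl,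
      Fin.ne_of_val_ne (show (i : ℕ) ≠ j by omega),
      Fin.ne_of_val_ne (show (k : ℕ) ≠ l by omega)])).commute.symm x
  simp only [youngSwap_fillVec F hij, youngSwap_fillVec F hkl, map_add, map_smul, hbr,
    Equiv.trans_apply, Equiv.swap_apply_of_ne_of_ne nik nil, Equiv.swap_apply_of_ne_of_ne njk njl,
    Equiv.swap_apply_of_ne_of_ne nik.symm njk.symm, Equiv.swap_apply_of_ne_of_ne nil.symm njl.symm]
  module

variable (lam) in
/-- The family of operators attached to the adjacent transpositions. -/
def youngFamily (k : ℕ) : Module.End F (SYT lam →₀ F) :=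
  if h : k + 1 < n then youngSwap F lam ⟨k, by omega⟩ ⟨k + 1, h⟩ else 1

theorem coxeterFamily_youngFamily : CoxeterFamily n (youngFamily F lam) where
  sq i hi := by
    rw [youngFamily, dif_pos hi]
    exact youngSwap_sq F rfl
  braid i hi := by
    rw [youngFamily, youngFamily, dif_pos (by omega), dif_pos (by omega)]
    exact youngSwap_braid F rfl rfl
  comm i j hij hj := by
    rw [youngFamily, youngFamily, dif_pos (by omega), dif_pos (by omega)]
    exact youngSwap_comm F rfl hij rfl

variable (lam) in
/-- The action of the symmetric group in Young's orthonormal form. -/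
def youngPerm : Equiv.Perm (Fin n) →* Module.End F (SYT lam →₀ F) :=
  (coxeterFamily_youngFamily F (lam := lam)).exists_hom.choose

theorem youngPerm_adjSwap (i : ℕ) (hi : i + 1 < n) :
    youngPerm F lam (adjSwap i hi) = youngSwap F lam ⟨i, by omega⟩ ⟨i + 1, hi⟩ := by
  rw [youngPerm, (coxeterFamily_youngFamily F (lam := lam)).exists_hom.choose_spec i hi,
    youngFamily, dif_pos hi]

/-- The weight by which the diagonal matrix `ζ ^ a` acts on the vector of the filling `Q`. -/
def diagWeight (a : Fin n → Multiplicative (ZMod r)) (Q : Fin n ≃ Box lam) : F :=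
  zetaPow F (∑ i, (a i).toAdd * (Q i).beta)

variable (lam) in
/-- The action of the diagonal matrices in Young's orthonormal form. -/
def youngDiag (a : Fin n → Multiplicative (ZMod r)) : Module.End F (SYT lam →₀ F) :=
  Finsupp.linearCombination F fun T : SYT lam => diagWeight F a T.1 • fillVec F T.1

theorem youngDiag_fillVec (a : Fin n → Multiplicative (ZMod r)) (Q : Fin n ≃ Box lam) :
    youngDiag F lam a (fillVec F Q) = diagWeight F a Q • fillVec F Q := by
  by_cases hQ : IsStandard Q
  · have := fillVec_coe F (⟨Q, hQ⟩ : SYT lam)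
    simp only at this
    rw [this, youngDiag, Finsupp.linearCombination_single, one_smul, ← this]
  · rw [fillVec, dif_neg hQ, map_zero, smul_zero]

theorem youngDiag_one : youngDiag F lam 1 = 1 := by
  refine Finsupp.lhom_ext' fun T => LinearMap.ext_ring ?_
  simp only [LinearMap.comp_apply, Finsupp.lsingle_apply, Module.End.one_apply]
  rw [← fillVec_coe, youngDiag_fillVec]
  simp [diagWeight, zetaPow_zero]

theorem youngDiag_mul (a b : Fin n → Multiplicative (ZMod r)) :
    youngDiag F lam (a * b) = youngDiag F lam a * youngDiag F lam b := by
  refine Finsupp.lhom_ext' fun T => LinearMap.ext_ring ?_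
  simp only [LinearMap.comp_apply, Finsupp.lsingle_apply, Module.End.mul_apply]
  rw [← fillVec_coe, youngDiag_fillVec, youngDiag_fillVec, map_smul, youngDiag_fillVec, smul_smul,
    diagWeight, diagWeight, diagWeight, ← zetaPow_add, ← Finset.sum_add_distrib]
  simp only [Pi.mul_apply, toAdd_mul, add_mul]
  simp only [add_comm]

/-- If i and j lie in the same component, exchanging them does not change the weight; if they do
not, the diagonal coefficient a vanishes and only the exchanged filling survives. -/
theorem youngSwap_mul_youngDiag {i j : Fin n} (hij : (i : ℕ) + 1 = j)
    (a : Fin n → Multiplicative (ZMod r)) :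
    youngSwap F lam i j * youngDiag F lam a =
      youngDiag F lam (a ∘ Equiv.swap i j) * youngSwap F lam i j := by
  refine Finsupp.lhom_ext' fun T => LinearMap.ext_ring ?_
  simp only [LinearMap.comp_apply, Finsupp.lsingle_apply, Module.End.mul_apply]
  rw [← fillVec_coe, youngDiag_fillVec, map_smul, youngSwap_fillVec F hij, map_add, map_smul,
    map_smul, youngDiag_fillVec, youngDiag_fillVec]
  have h1 : diagWeight F (a ∘ Equiv.swap i j) ((Equiv.swap i j).trans T.1) = diagWeight F a T.1 := by
    unfold diagWeight
    congr 1
    exact Equiv.sum_comp (Equiv.swap i j) fun x => (a x).toAdd * (T.1 x).beta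
  rw [h1]
  by_cases hb : (T.1 i).beta = (T.1 j).beta
  · have h2 : diagWeight F (a ∘ Equiv.swap i j) T.1 = diagWeight F a T.1 := by
      rw [← h1]
      unfold diagWeight
      congr 1
      refine Finset.sum_congr rfl fun x _ => ?_
      congr 1
      rw [Equiv.trans_apply]
      rcases eq_or_ne x i with rfl | hxi
      · rw [Equiv.swap_apply_left, hb]
      rcases eq_or_ne x j with rfl | hxj
      · rw [Equiv.swap_apply_right, hb]
      · rw [Equiv.swap_apply_of_ne_of_ne hxi hxj]
    rw [h2]
    module
  · rw [coeffA_of_ne F hb]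
    module

theorem youngPerm_mul_youngDiag (σ : Equiv.Perm (Fin n)) (a : Fin n → Multiplicative (ZMod r)) :
    youngPerm F lam σ * youngDiag F lam a =
      youngDiag F lam (mulAutArrow σ a) * youngPerm F lam σ := by
  induction σ using perm_induction_adjSwap with
  | one => simp
  | mul i hi σ ih =>
    rw [map_mul, mul_assoc, ih, ← mul_assoc, youngPerm_adjSwap, youngSwap_mul_youngDiag F rfl,
      mul_assoc, map_mul]
    rfl

variable (lam) in
/-- Young's orthonormal form as a representation of `G(r,1,n)`. -/
def youngRep : Representation F (W r n) (SYT lam →₀ F) where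
  toFun w := youngDiag F lam w.left * youngPerm F lam w.right
  map_one' := by
    rw [SemidirectProduct.one_left, SemidirectProduct.one_right, youngDiag_one, map_one, mul_one]
  map_mul' v w := by
    rw [SemidirectProduct.mul_left, SemidirectProduct.mul_right, youngDiag_mul, map_mul,
      mul_assoc, mul_assoc, ← mul_assoc _ (youngPerm F lam v.right), ← youngPerm_mul_youngDiag,
      mul_assoc]

theorem youngRep_swap {i j : Fin n} (hij : (i : ℕ) + 1 = j) (Q : Fin n ≃ Box lam) :
    youngRep F lam (W.perm r (Equiv.swap i j)) (fillVec F Q) =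
      coeffA F (Q i) (Q j) • fillVec F Q +
        coeffB F (Q i) (Q j) • fillVec F ((Equiv.swap i j).trans Q) := by
  have hj : (i : ℕ) + 1 < n := hij ▸ j.2
  obtain rfl : j = ⟨i + 1, hj⟩ := Fin.ext hij.symm
  change (youngDiag F lam 1 * youngPerm F lam (adjSwap i hj)) (fillVec F Q) = _
  rw [youngDiag_one, one_mul, youngPerm_adjSwap, youngSwap_fillVec F rfl]

theorem youngRep_zeta (i : Fin n) (Q : Fin n ≃ Box lam) :
    youngRep F lam (W.zeta i 1) (fillVec F Q) = zetaPow F (Q i).beta • fillVec F Q := by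
  change (youngDiag F lam (Pi.mulSingle i (Multiplicative.ofAdd 1)) * youngPerm F lam 1)
    (fillVec F Q) = _
  rw [map_one (youngPerm F lam), mul_one, youngDiag_fillVec, diagWeight, Finset.sum_eq_single i]
  · rw [Pi.mulSingle_eq_same, toAdd_ofAdd, one_mul]
  · intro j _ hj
    rw [Pi.mulSingle_eq_of_ne hj, toAdd_one, zero_mul]
  · simp

end YoungRep

/-! ### The group `G(r,1,n)` -/

section Group

variable {r n : ℕ}

theorem W.ext {v w : W r n} (h1 : ∀ i, (v.left i).toAdd = (w.left i).toAdd)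
    (h2 : ∀ i, v.right i = w.right i) : v = w :=
  SemidirectProduct.ext (funext h1) (Equiv.ext h2)

theorem W.mul_left_apply (v w : W r n) (i : Fin n) :
    ((v * w).left i).toAdd = (v.left i).toAdd + (w.left (v.right⁻¹ i)).toAdd := rfl

@[simp] theorem W.zeta_right (i : Fin n) (l : ZMod r) : (W.zeta i l).right = 1 := rfl

theorem W.zeta_left (i : Fin n) (l : ZMod r) (k : Fin n) :
    ((W.zeta i l).left k).toAdd = if k = i then l else 0 := by
  rw [W.zeta, SemidirectProduct.left_inl, Pi.mulSingle_apply]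
  split_ifs <;> rfl

@[simp] theorem W.perm_right (σ : Equiv.Perm (Fin n)) : (W.perm r σ).right = σ := rfl

@[simp] theorem W.perm_left (σ : Equiv.Perm (Fin n)) (k : Fin n) :
    ((W.perm r σ).left k).toAdd = 0 := rfl

theorem W.zeta_add (i : Fin n) (k l : ZMod r) : W.zeta i (k + l) = W.zeta i k * W.zeta i l := by
  rw [W.zeta, ofAdd_add, Pi.mulSingle_mul, map_mul]
  rfl

@[simp] theorem W.zeta_zero (i : Fin n) : W.zeta i (0 : ZMod r) = 1 := by
  simp [W.zeta]

theorem W.zeta_inv (i : Fin n) (l : ZMod r) : (W.zeta i l)⁻¹ = W.zeta i (-l) := by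
  rw [inv_eq_iff_mul_eq_one, ← W.zeta_add, add_neg_cancel, W.zeta_zero]

theorem W.perm_mul (σ τ : Equiv.Perm (Fin n)) : W.perm r (σ * τ) = W.perm r σ * W.perm r τ :=
  map_mul SemidirectProduct.inr _ _

@[simp] theorem W.refl_right (i j : Fin n) (l : ZMod r) : (W.refl i j l).right = Equiv.swap i j := by
  simp [W.refl, SemidirectProduct.mul_right, W.zeta_inv]

theorem W.refl_left {i j : Fin n} (hij : i ≠ j) (l : ZMod r) (k : Fin n) :
    ((W.refl i j l).left k).toAdd = if k = i then l else if k = j then -l else 0 := by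
  simp only [W.refl, W.zeta_inv, W.mul_left_apply, W.zeta_left, SemidirectProduct.mul_right,
    W.zeta_right, W.perm_right, W.perm_left, one_mul, inv_one, Equiv.Perm.one_apply,
    Equiv.swap_inv, add_zero]
  rcases eq_or_ne k i with rfl | hki
  · simp [hij.symm]
  rcases eq_or_ne k j with rfl | hkj
  · simp [hki]
  · simp [hki, hkj, Equiv.swap_apply_of_ne_of_ne hki hkj]

theorem W.mul_zeta (w : W r n) (i : Fin n) (l : ZMod r) :
    w * W.zeta i l = W.zeta (w.right i) l * w := by
  refine W.ext (fun k => ?_) (fun k => ?_)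
  · simp only [W.mul_left_apply, W.zeta_left, W.zeta_right, inv_one, Equiv.Perm.one_apply,
      Equiv.Perm.inv_eq_iff_eq]
    exact add_comm _ _
  · simp [SemidirectProduct.mul_right]

/-- Conjugation only translates the parameter l, so sums over all l are carried to each other. -/
theorem W.mul_refl (w : W r n) {i j : Fin n} (hij : i ≠ j) (l : ZMod r) :
    w * W.refl i j l = W.refl (w.right i) (w.right j)
      (l + (w.left (w.right i)).toAdd - (w.left (w.right j)).toAdd) * w := by
  have hij' : w.right i ≠ w.right j := fun h => hij (w.right.injective h)
  refine W.ext (fun k => ?_) (fun k => ?_)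
  · simp only [W.mul_left_apply, W.refl_left hij, W.refl_left hij', W.refl_right,
      Equiv.Perm.inv_eq_iff_eq, Equiv.swap_inv]
    split_ifs with h1 h2
    · subst h1; rw [Equiv.swap_apply_left]; ring
    · subst h2; rw [Equiv.swap_apply_right]; ring
    · rw [Equiv.swap_apply_of_ne_of_ne h1 h2, add_comm]
  · simp only [SemidirectProduct.mul_right, W.refl_right, Equiv.Perm.mul_apply]
    exact Equiv.congr_fun (Equiv.mul_swap_eq_swap_mul w.right i j) k

theorem W.refl_swap {i j : Fin n} (hij : i ≠ j) (l : ZMod r) : W.refl j i l = W.refl i j (-l) := by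
  refine W.ext (fun k => ?_) (fun k => ?_)
  · simp only [W.refl_left hij, W.refl_left hij.symm, neg_neg]
    split_ifs with h1 h2
    · exact absurd (h2.symm.trans h1) hij
    all_goals rfl
  · simp [Equiv.swap_comm]

/-- `G(r,1,n)` is generated by the `ζ_i ^ l` and the adjacent transpositions. -/
theorem W.induction {P : W r n → Prop} (one : P 1) (mul : ∀ v w, P v → P w → P (v * w))
    (zeta : ∀ i l, P (W.zeta i l)) (swap : ∀ i hi, P (W.perm r (adjSwap i hi))) (w : W r n) :
    P w := by
  rw [← SemidirectProduct.inl_left_mul_inr_right w]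
  refine mul _ _ ?_ ?_
  · rw [← Finset.univ_prod_mulSingle w.left]
    refine Finset.prod_induction _ (fun a => P (SemidirectProduct.inl a)) (fun a b ha hb => ?_) ?_
      fun i _ => zeta i (w.left i).toAdd
    · rw [map_mul]; exact mul _ _ ha hb
    · rwa [map_one]
  · generalize w.right = σ
    induction σ using perm_induction_adjSwap with
    | one => rwa [map_one]
    | mul i hi σ ih =>
      rw [map_mul]
      exact mul _ _ (swap i hi) ih

end Group

/-! ### The module `S^λ` -/

section SpechtModule

variable (F : Type*) [Field F] [Algebra ℂ F] {r n : ℕ} [NeZero r] (lam : RPartition r n)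

/-- The image in `S^λ` of the symbol of a filling; it vanishes for non-standard fillings. -/
def spechtFill (Q : Fin n ≃ Box lam) : Specht F lam := Submodule.Quotient.mk (freeVec F lam Q)

variable {lam}

theorem spechtFill_coe (T : SYT lam) : spechtFill F lam T.1 = spechtVec F lam T := rfl

theorem spechtFill_of_not_isStandard {Q : Fin n ≃ Box lam} (hQ : ¬ IsStandard Q) :
    spechtFill F lam Q = 0 := by
  rw [spechtFill, freeVec, dif_neg hQ]
  rfl

theorem swap_smul_spechtFill {i j : Fin n} (hij : (i : ℕ) + 1 = j) (Q : Fin n ≃ Box lam) :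
    MonoidAlgebra.of F (W r n) (W.perm r (Equiv.swap i j)) • spechtFill F lam Q =
      coeffA F (Q i) (Q j) • spechtFill F lam Q +
        coeffB F (Q i) (Q j) • spechtFill F lam ((Equiv.swap i j).trans Q) := by
  refine young_rule_of_isStandard F (spechtFill F lam) _ (smul_zero _)
    (fun Q hQ => spechtFill_of_not_isStandard F hQ) hij (fun Q hQ => ?_) Q
  have := Submodule.subset_span (R := GroupAlg F r n)
    (show _ ∈ {p | SpechtRel F lam p} from SpechtRel.simple ⟨Q, hQ⟩ i j hij)
  rw [SetLike.mem_coe, ← Submodule.Quotient.mk_eq_zero, Submodule.Quotient.mk_sub,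
    sub_eq_zero] at this
  exact this

theorem zeta_one_smul_spechtFill (i : Fin n) (Q : Fin n ≃ Box lam) :
    MonoidAlgebra.of F (W r n) (W.zeta i 1) • spechtFill F lam Q =
      zetaPow F (Q i).beta • spechtFill F lam Q := by
  by_cases hQ : IsStandard Q
  · have := Submodule.subset_span (R := GroupAlg F r n)
      (show _ ∈ {p | SpechtRel F lam p} from SpechtRel.zeta ⟨Q, hQ⟩ i)
    rw [SetLike.mem_coe, ← Submodule.Quotient.mk_eq_zero, Submodule.Quotient.mk_sub,
      sub_eq_zero] at this
    exact this
  · rw [spechtFill_of_not_isStandard F hQ, smul_zero, smul_zero]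

theorem zeta_smul_spechtFill (i : Fin n) (l : ZMod r) (Q : Fin n ≃ Box lam) :
    MonoidAlgebra.of F (W r n) (W.zeta i l) • spechtFill F lam Q =
      zetaPow F (l * (Q i).beta) • spechtFill F lam Q := by
  rw [← ZMod.natCast_zmod_val l]
  induction l.val with
  | zero => simp [zetaPow_zero, ← MonoidAlgebra.one_def]
  | succ m ih =>
    rw [Nat.cast_succ, W.zeta_add, map_mul, mul_smul, zeta_one_smul_spechtFill, smul_comm, ih,
      smul_smul, ← zetaPow_add]
    congr 2
    ring

/-- The F-span is stable under the generators ζ_i^l and s_i by Young's formulas, hence under W, and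
it contains the generators of the module. -/
theorem span_spechtVec : Submodule.span F (Set.range (spechtVec F lam)) = ⊤ := by
  set N := Submodule.span F (Set.range (spechtVec F lam)) with hN
  have hfill (Q : Fin n ≃ Box lam) : spechtFill F lam Q ∈ N := by
    by_cases hQ : IsStandard Q
    · exact Submodule.subset_span ⟨⟨Q, hQ⟩, rfl⟩
    · rw [spechtFill_of_not_isStandard F hQ]
      exact N.zero_mem
  have hW (w : W r n) : ∀ v ∈ N, MonoidAlgebra.of F (W r n) w • v ∈ N := by
    have hgen (w : W r n) (h : ∀ T : SYT lam,
        MonoidAlgebra.of F (W r n) w • spechtVec F lam T ∈ N) :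
        ∀ v ∈ N, MonoidAlgebra.of F (W r n) w • v ∈ N := by
      intro v hv
      induction hv using Submodule.span_induction with
      | mem x hx =>
        obtain ⟨T, rfl⟩ := hx
        exact h T
      | zero => rw [smul_zero]; exact N.zero_mem
      | add x y _ _ hx hy => rw [smul_add]; exact N.add_mem hx hy
      | smul a x _ hx => rw [smul_comm]; exact N.smul_mem a hx
    induction w using W.induction with
    | one => intro v hv; rwa [map_one, one_smul]
    | mul v w hv hw => intro x hx; rw [map_mul, mul_smul]; exact hv _ (hw _ hx)
    | zeta i l =>
      refine hgen _ fun T => ?_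
      rw [← spechtFill_coe, zeta_smul_spechtFill]
      exact N.smul_mem _ (hfill _)
    | swap i hi =>
      refine hgen _ fun T => ?_
      rw [← spechtFill_coe, adjSwap, swap_smul_spechtFill F rfl]
      exact N.add_mem (N.smul_mem _ (hfill _)) (N.smul_mem _ (hfill _))
  rw [eq_top_iff]
  rintro v -
  obtain ⟨f, rfl⟩ := Submodule.Quotient.mk_surjective _ v
  induction f using Finsupp.induction_linear with
  | zero => exact N.zero_mem
  | add f g hf hg => rw [Submodule.Quotient.mk_add]; exact N.add_mem hf hg
  | single T a =>
    rw [show Finsupp.single T a = a • Finsupp.single T (1 : GroupAlg F r n) by simp,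
      Submodule.Quotient.mk_smul]
    have hT : (Submodule.Quotient.mk (Finsupp.single T 1) : Specht F lam) = spechtVec F lam T := by
      rw [spechtVec, freeVec, dif_pos T.2]
    rw [hT]
    induction a using MonoidAlgebra.induction_linear with
    | zero => rw [zero_smul]; exact N.zero_mem
    | add f g hf hg => rw [add_smul]; exact N.add_mem hf hg
    | single w c =>
      rw [show MonoidAlgebra.single w c = c • MonoidAlgebra.of F (W r n) w by simp, smul_assoc]
      exact N.smul_mem c (hW w _ (Submodule.subset_span ⟨T, rfl⟩))

variable (lam) in
/-- The `F W`-linear map from the free module on the `v_T` to Young's orthonormal form. -/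
def freeSpechtToYoung : FreeSpecht F lam →ₗ[GroupAlg F r n] (youngRep F lam).asModule :=
  Finsupp.linearCombination _ fun T => (youngRep F lam).asModuleEquiv.symm (Finsupp.single T 1)

theorem freeSpechtToYoung_freeVec (Q : Fin n ≃ Box lam) :
    freeSpechtToYoung F lam (freeVec F lam Q) =
      (youngRep F lam).asModuleEquiv.symm (fillVec F Q) := by
  by_cases hQ : IsStandard Q
  · rw [freeVec, dif_pos hQ, fillVec, dif_pos hQ, freeSpechtToYoung,
      Finsupp.linearCombination_single, one_smul]
  · rw [freeVec, dif_neg hQ, fillVec, dif_neg hQ, map_zero, map_zero]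

theorem freeSpechtToYoung_smul (c : F) (Q : Fin n ≃ Box lam) :
    freeSpechtToYoung F lam (c • freeVec F lam Q) =
      (youngRep F lam).asModuleEquiv.symm (c • fillVec F Q) := by
  rw [← algebraMap_smul (GroupAlg F r n) c (freeVec F lam Q), map_smul, freeSpechtToYoung_freeVec,
    Representation.asModuleEquiv_symm_map_smul]

theorem freeSpechtToYoung_of_smul (w : W r n) (Q : Fin n ≃ Box lam) :
    freeSpechtToYoung F lam (MonoidAlgebra.of F (W r n) w • freeVec F lam Q) =
      (youngRep F lam).asModuleEquiv.symm (youngRep F lam w (fillVec F Q)) := by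
  rw [map_smul, freeSpechtToYoung_freeVec, ← Representation.asModuleEquiv_symm_map_rho]

theorem freeSpechtToYoung_of_spechtRel {p : FreeSpecht F lam} (hp : SpechtRel F lam p) :
    freeSpechtToYoung F lam p = 0 := by
  cases hp with
  | zeta T i =>
    rw [map_sub, freeSpechtToYoung_of_smul, freeSpechtToYoung_smul, sub_eq_zero, youngRep_zeta]
  | simple T i j hij =>
    rw [map_sub, map_add, freeSpechtToYoung_of_smul, freeSpechtToYoung_smul,
      freeSpechtToYoung_smul, sub_eq_zero, youngRep_swap F hij, map_add]
    rfl

/-- The relations could in principle collapse the quotient. They hold in the model `youngRep`, so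
there is a map to it, and this map takes the v_T to a basis. -/
theorem linearIndependent_spechtVec : LinearIndependent F (spechtVec F lam) := by
  rw [linearIndependent_iff']
  intro s c hc T hT
  have h1 : (Submodule.Quotient.mk (∑ T ∈ s, c T • freeVec F lam T.1) : Specht F lam) = 0 := by
    rw [← hc]
    exact map_sum (Submodule.mkQ _) _ _
  rw [Submodule.Quotient.mk_eq_zero] at h1
  have hker : Submodule.span (GroupAlg F r n) {p | SpechtRel F lam p} ≤
      LinearMap.ker (freeSpechtToYoung F lam) :=
    Submodule.span_le.2 fun p hp => freeSpechtToYoung_of_spechtRel F hp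
  have h2 := LinearMap.mem_ker.1 (hker h1)
  rw [map_sum, Finset.sum_congr rfl fun T _ => freeSpechtToYoung_smul F (c T) T.1, ← map_sum,
    LinearEquiv.map_eq_zero_iff] at h2
  simp only [fillVec_coe] at h2
  exact linearIndependent_iff'.1 (Finsupp.linearIndependent_single_one F (SYT lam)) s c h2 T hT

end SpechtModule

/-! ### Sums of reflections and Jucys–Murphy elements -/

theorem sum_zetaPow_mul (F : Type*) [Field F] [Algebra ℂ F] {r : ℕ} [NeZero r] (k : ZMod r) :
    ∑ l : ZMod r, zetaPow F (l * k) = if k = 0 then (r : F) else 0 := by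
  unfold zetaPow
  rw [← map_sum, AddChar.sum_mulShift k (ZMod.isPrimitive_stdAddChar r), ZMod.card]
  split_ifs <;> simp

section ReflSum

variable {r n : ℕ} [NeZero r] {A : Type*} [Ring A] (t : W r n →* A)

/-- The sum `∑_l t_{ζ_i ^ l s_{ij} ζ_i ^ (-l)}`. -/
def reflSum (i j : Fin n) : A := ∑ l : ZMod r, t (W.refl i j l)

theorem mul_reflSum (w : W r n) {i j : Fin n} (hij : i ≠ j) :
    t w * reflSum t i j = reflSum t (w.right i) (w.right j) * t w := by
  simp only [reflSum, Finset.mul_sum, Finset.sum_mul, ← map_mul, W.mul_refl w hij]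
  refine Fintype.sum_equiv (Equiv.addRight
    ((w.left (w.right i)).toAdd - (w.left (w.right j)).toAdd)) _ _ fun l => ?_
  rw [Equiv.coe_addRight, add_sub_assoc]

theorem reflSum_comm {i j : Fin n} (hij : i ≠ j) : reflSum t j i = reflSum t i j := by
  simp only [reflSum, W.refl_swap hij]
  exact Fintype.sum_equiv (Equiv.neg _) _ _ fun l => rfl

/-- The Jucys–Murphy element `∑_{j < i} ∑_l t_{ζ_i ^ l s_{ij} ζ_i ^ (-l)}`. -/
def jmSum (i : Fin n) : A := ∑ j ∈ Finset.univ.filter (fun j => j < i), reflSum t i j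

/-- Conjugation by s_i turns the reflections in (i k), k < i, into those in (j k), and only the pair
i, j is missing. This recursion drives the computation of the eigenvalues. -/
theorem jmSum_succ {i j : Fin n} (hij : (i : ℕ) + 1 = j) :
    jmSum t j = t (W.perm r (Equiv.swap i j)) * jmSum t i * t (W.perm r (Equiv.swap i j)) +
      reflSum t i j := by
  have hne : i ≠ j := Fin.ne_of_val_ne (by omega)
  have hf : Finset.univ.filter (fun k => k < j) =
      insert i (Finset.univ.filter (fun k => k < i)) := by
    ext k
    simp only [Finset.mem_filter, Finset.mem_univ, true_and, Finset.mem_insert, Fin.lt_def,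
      Fin.ext_iff]
    omega
  rw [jmSum, hf, Finset.sum_insert (by simp), add_comm, reflSum_comm t hne, jmSum, Finset.mul_sum,
    Finset.sum_mul]
  congr 1
  refine Finset.sum_congr rfl fun k hk => ?_
  have hk : (k : ℕ) < i := Fin.lt_def.1 (Finset.mem_filter.1 hk).2
  rw [mul_reflSum t _ (Fin.ne_of_val_ne (by omega)), W.perm_right, Equiv.swap_apply_left,
    Equiv.swap_apply_of_ne_of_ne (Fin.ne_of_val_ne (by omega)) (Fin.ne_of_val_ne (by omega)),
    mul_assoc, ← map_mul, ← W.perm_mul, Equiv.swap_mul_self]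
  rw [show W.perm r (1 : Equiv.Perm (Fin n)) = 1 from map_one _, map_one, mul_one]

/-- An element that fixes all indices `≥ i` and permutes the smaller ones commutes with the
Jucys–Murphy element of `i`. -/
theorem mul_jmSum {i : Fin n} (w : W r n) (hi : w.right i = i) (hw : ∀ j, j < i ↔ w.right j < i) :
    t w * jmSum t i = jmSum t i * t w := by
  rw [jmSum, Finset.mul_sum, Finset.sum_mul]
  refine Finset.sum_equiv w.right (fun j => ?_) fun j hj => ?_
  · simpa using hw j
  · have hne : i ≠ j := (Finset.mem_filter.1 hj).2.ne'
    rw [mul_reflSum t w hne, hi]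

theorem refl_mul_jmSum {i j k : Fin n} (hki : k < j) (hji : i < j) (l : ZMod r) :
    t (W.refl i k l) * jmSum t j = jmSum t j * t (W.refl i k l) := by
  refine mul_jmSum t _ ?_ fun m => ?_
  · rw [W.refl_right, Equiv.swap_apply_of_ne_of_ne hji.ne' hki.ne']
  · rw [W.refl_right, Equiv.swap_apply_def]
    split_ifs with h1 h2
    · subst h1; exact ⟨fun _ => hki, fun _ => hji⟩
    · subst h2; exact ⟨fun _ => hji, fun _ => hki⟩
    · rfl

theorem zeta_mul_jmSum (i j : Fin n) (l : ZMod r) :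
    t (W.zeta i l) * jmSum t j = jmSum t j * t (W.zeta i l) :=
  mul_jmSum t _ (by simp) fun m => by simp

theorem jmSum_mul_jmSum (i j : Fin n) : jmSum t i * jmSum t j = jmSum t j * jmSum t i := by
  have key : ∀ {i j : Fin n}, i < j → jmSum t i * jmSum t j = jmSum t j * jmSum t i := by
    intro i j hij
    rw [show jmSum t i = ∑ k ∈ Finset.univ.filter (fun k => k < i), ∑ l, t (W.refl i k l) from rfl]
    simp only [Finset.mul_sum, Finset.sum_mul]
    refine Finset.sum_congr rfl fun k hk => Finset.sum_congr rfl fun l _ => ?_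
    exact refl_mul_jmSum t ((Finset.mem_filter.1 hk).2.trans hij) hij l
  rcases lt_trichotomy i j with h | rfl | h
  · exact key h
  · rfl
  · exact (key h).symm

end ReflSum

/-! ### Contents as eigenvalues of the Jucys–Murphy elements -/

section SpechtContent

variable (F : Type*) [Field F] [Algebra ℂ F] {r n : ℕ} [NeZero r] {lam : RPartition r n}

/-- Moving both diagonal factors to the right of s_{ij} leaves the scalar ζ^{l(β_j - β_i)}; summing
over l gives r or 0 by orthogonality of characters. -/
theorem reflSum_smul_spechtFill (i j : Fin n) (Q : Fin n ≃ Box lam) :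
    reflSum (MonoidAlgebra.of F (W r n)) i j • spechtFill F lam Q =
      (if (Q i).beta = (Q j).beta then (r : F) else 0) •
        MonoidAlgebra.of F (W r n) (W.perm r (Equiv.swap i j)) • spechtFill F lam Q := by
  have h (l : ZMod r) : MonoidAlgebra.of F (W r n) (W.refl i j l) • spechtFill F lam Q =
      zetaPow F (l * ((Q j).beta - (Q i).beta)) •
        MonoidAlgebra.of F (W r n) (W.perm r (Equiv.swap i j)) • spechtFill F lam Q := by
    have hz : W.zeta i l * W.perm r (Equiv.swap i j) = W.perm r (Equiv.swap i j) * W.zeta j l := by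
      rw [W.mul_zeta, W.perm_right, Equiv.swap_apply_right]
    rw [W.refl, W.zeta_inv, hz, map_mul, map_mul, mul_smul, mul_smul, zeta_smul_spechtFill,
      smul_comm (MonoidAlgebra.of F (W r n) (W.zeta j l)), zeta_smul_spechtFill, smul_smul,
      ← zetaPow_add, smul_comm]
    congr 2
    ring
  rw [reflSum, Finset.sum_smul, Finset.sum_congr rfl fun l _ => h l, ← Finset.sum_smul,
    sum_zetaPow_mul]
  simp only [sub_eq_zero, eq_comm (a := (Q j).beta)]

/-- The Jucys–Murphy elements act on Young's basis through contents. -/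
theorem jmSum_smul_spechtVec (i : Fin n) (T : SYT lam) :
    jmSum (MonoidAlgebra.of F (W r n)) i • spechtVec F lam T =
      ((r : F) * (T.1 i).ct) • spechtVec F lam T := by
  -- The induction runs over all fillings, since exchanging two entries of a standard tableau may
  -- leave the standard ones.
  suffices ∀ (k : ℕ) (i : Fin n), (i : ℕ) = k → ∀ Q : Fin n ≃ Box lam,
      jmSum (MonoidAlgebra.of F (W r n)) i • spechtFill F lam Q =
        ((r : F) * (Q i).ct) • spechtFill F lam Q from this i i rfl T.1
  intro k
  induction k with
  | zero =>
    intro i hi Q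
    by_cases hQ : IsStandard Q
    · have hf : Finset.univ.filter (fun j => j < i) = ∅ :=
        Finset.filter_eq_empty_iff.2 fun j _ h => by
          rw [Fin.lt_def] at h
          omega
      rw [hQ.ct_zero hi, jmSum, hf]
      simp
    · rw [spechtFill_of_not_isStandard F hQ, smul_zero, smul_zero]
  | succ k ih =>
    intro j hj Q
    by_cases hQ : IsStandard Q
    swap
    · rw [spechtFill_of_not_isStandard F hQ, smul_zero, smul_zero]
    obtain ⟨i, hi⟩ : ∃ i : Fin n, (i : ℕ) = k := ⟨⟨k, by omega⟩, rfl⟩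
    have hij : (i : ℕ) + 1 = j := by omega
    have hss (Q : Fin n ≃ Box lam) : (Equiv.swap i j).trans ((Equiv.swap i j).trans Q) = Q := by
      ext x : 1; simp
    rw [jmSum_succ _ hij, add_smul, mul_smul, mul_smul, reflSum_smul_spechtFill F i j,
      swap_smul_spechtFill F hij, smul_add, smul_comm _ (coeffA F (Q i) (Q j)),
      smul_comm _ (coeffB F (Q i) (Q j)), ih i hi, ih i hi]
    simp only [smul_add, smul_comm (MonoidAlgebra.of F (W r n) (W.perm r (Equiv.swap i j))),
      swap_smul_spechtFill F hij, hss, Equiv.trans_apply, Equiv.swap_apply_left,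
      Equiv.swap_apply_right]
    rw [coeffA_comm F (Q j), coeffB_comm F (Q j)]
    have hB := coeffB_sq F (Q i) (Q j)
    -- In one component, a (ct(j) - ct(i)) = 1 and b² = 1 - a² turn the eigenvalue at i into the one
    -- at j; in different components a = 0 and b² = 1.
    split_ifs with hb
    · have hct : (Q i).ct ≠ (Q j).ct := fun h => by
        have := hQ.add_three_le (by rw [Fin.lt_def]; omega) hb h
        omega
      have hA := coeffA_mul_sub F hb hct
      match_scalars
      · linear_combination (r : F) * (Q j).ct * hB - (r : F) * coeffA F (Q i) (Q j) * hA
      · linear_combination -(r : F) * coeffB F (Q i) (Q j) * hA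
    · rw [coeffA_of_ne F hb] at hB ⊢
      match_scalars
      · linear_combination (r : F) * (Q j).ct * hB
      · ring

end SpechtContent

/-! ### The order on compositions -/

section Order

variable {n : ℕ}

/-- An initial segment maximizes the sum of a non-increasing function among sets of its size: the
indices of B outside it carry values at most f m, those it has beyond B values at least f m. -/
theorem sum_le_sum_prefix {f : Fin n → ℕ} (hf : Antitone f) (m : Fin n) {B : Finset (Fin n)}
    (hB : B.card = (Finset.univ.filter fun i => i ≤ m).card) :
    ∑ i ∈ B, f i ≤ ∑ i ∈ Finset.univ.filter (fun i => i ≤ m), f i := by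
  set P := Finset.univ.filter fun i => i ≤ m with hP
  have hc : (B \ P).card = (P \ B).card := by
    have h1 := Finset.card_sdiff_add_card_inter B P
    have h2 := Finset.card_sdiff_add_card_inter P B
    rw [Finset.inter_comm] at h2
    omega
  have h1 : ∑ i ∈ B \ P, f i ≤ (B \ P).card • f m := by
    refine Finset.sum_le_card_nsmul _ _ _ fun i hi => hf ?_
    have := (Finset.mem_sdiff.1 hi).2
    rw [hP, Finset.mem_filter] at this
    exact le_of_lt (not_le.1 fun h => this ⟨Finset.mem_univ _, h⟩)
  have h2 : (P \ B).card • f m ≤ ∑ i ∈ P \ B, f i := by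
    refine Finset.card_nsmul_le_sum _ _ _ fun i hi => hf ?_
    exact (Finset.mem_filter.1 (Finset.mem_sdiff.1 hi).1).2
  rw [← Finset.sum_inter_add_sum_sdiff B P, ← Finset.sum_inter_add_sum_sdiff P B,
    Finset.inter_comm P B]
  rw [hc] at h1
  omega

/-- The permutation that sorts `μ` into non-increasing order. -/
def descPerm (μ : Fin n → ℕ) : Equiv.Perm (Fin n) := Fin.revPerm.trans (Tuple.sort μ)

theorem sortDesc_eq (μ : Fin n → ℕ) : sortDesc μ = μ ∘ descPerm μ := rfl

theorem antitone_sortDesc (μ : Fin n → ℕ) : Antitone (sortDesc μ) := fun _ _ h =>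
  Tuple.monotone_sort μ (Fin.rev_le_rev.2 h)

theorem sum_sortDesc (μ : Fin n → ℕ) (g : ℕ → ℕ) : ∑ i, g (sortDesc μ i) = ∑ i, g (μ i) :=
  Equiv.sum_comp (descPerm μ) fun i => g (μ i)

theorem sortDesc_comp_perm (μ : Fin n → ℕ) (σ : Equiv.Perm (Fin n)) :
    sortDesc (μ ∘ σ) = sortDesc μ := by
  funext i
  exact congrFun (Tuple.comp_perm_comp_sort_eq_comp_sort (f := μ) (σ := σ)) (Fin.rev i)

/-- Moving the values at two positions strictly towards each other lowers `μ_+` in dominance. -/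
theorem domLT_sortDesc {μ ν : Fin n → ℕ} {p q : Fin n} (hpq : p ≠ q) (h1 : μ p < ν p)
    (h2 : ν p < μ q) (h3 : ν p + ν q = μ p + μ q) (h : ∀ k, k ≠ p → k ≠ q → ν k = μ k) :
    DomLT (sortDesc ν) (sortDesc μ) := by
  have hrest : ∀ g : ℕ → ℕ, ∑ i ∈ ({p, q} : Finset (Fin n))ᶜ, g (ν i) =
      ∑ i ∈ ({p, q} : Finset (Fin n))ᶜ, g (μ i) := fun g => by
    refine Finset.sum_congr rfl fun k hk => ?_
    simp only [Finset.mem_compl, Finset.mem_insert, Finset.mem_singleton, not_or] at hk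
    rw [h k hk.1 hk.2]
  have hsum : ∀ (g : ℕ → ℕ) (ξ : Fin n → ℕ), ∑ i, g (ξ i) =
      (g (ξ p) + g (ξ q)) + ∑ i ∈ ({p, q} : Finset (Fin n))ᶜ, g (ξ i) := fun g ξ => by
    rw [← Finset.sum_pair (f := fun i => g (ξ i)) hpq, Finset.sum_add_sum_compl]
  refine ⟨fun heq => ?_, ?_, fun m => ?_⟩
  -- The sum of squares strictly decreases when two values move towards each other with fixed sum,
  -- so the rearrangements differ.
  · have := sum_sortDesc ν fun x => x ^ 2
    rw [heq, sum_sortDesc μ fun x => x ^ 2] at this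
    have hμ := hsum (fun x => x ^ 2) μ
    have hν := hsum (fun x => x ^ 2) ν
    have hr := hrest fun x => x ^ 2
    have hsq : ν p ^ 2 + ν q ^ 2 = μ p ^ 2 + μ q ^ 2 := by omega
    zify at h1 h2 h3 hsq
    nlinarith [mul_pos (sub_pos.2 h1) (sub_pos.2 h2)]
  · rw [sum_sortDesc ν fun x => x, sum_sortDesc μ fun x => x, hsum fun x => x,
      hsum (fun x => x) μ, hrest fun x => x]
    omega
  · set P := Finset.univ.filter fun i => i ≤ m
    -- A prefix sum of μ_+ is the largest sum of μ over index sets of that size, so each prefix sum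
    -- of ν_+, being a sum of ν over some B, need only be compared with μ on a set of equal size.
    have key : ∀ B : Finset (Fin n), B.card = P.card → ∑ i ∈ B, μ i ≤ ∑ i ∈ P, sortDesc μ i := by
      intro B hB
      have := sum_le_sum_prefix (antitone_sortDesc μ) m (B := B.map (descPerm μ).symm.toEmbedding)
        (by rw [Finset.card_map, hB])
      rw [Finset.sum_map] at this
      simpa [sortDesc_eq] using this
    set B := P.map (descPerm ν).toEmbedding with hBdef
    have hB : B.card = P.card := Finset.card_map _
    have hν : ∑ i ∈ P, sortDesc ν i = ∑ i ∈ B, ν i := by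
      rw [hBdef, Finset.sum_map]; rfl
    rw [hν]
    have hsplit : ∀ ξ : Fin n → ℕ, ∀ C : Finset (Fin n), ∑ i ∈ C, ξ i =
        ∑ i ∈ C.filter (fun i => i = p ∨ i = q), ξ i +
          ∑ i ∈ C.filter (fun i => ¬ (i = p ∨ i = q)), ξ i := fun ξ C =>
      (Finset.sum_filter_add_sum_filter_not C _ ξ).symm
    have hout : ∀ C : Finset (Fin n), ∑ i ∈ C.filter (fun i => ¬ (i = p ∨ i = q)), ν i =
        ∑ i ∈ C.filter (fun i => ¬ (i = p ∨ i = q)), μ i := fun C => by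
      refine Finset.sum_congr rfl fun k hk => ?_
      have := (Finset.mem_filter.1 hk).2
      exact h k (fun h => this (Or.inl h)) fun h => this (Or.inr h)
    by_cases hp : p ∈ B <;> by_cases hq : q ∈ B
    · refine le_trans ?_ (key B hB)
      have hf : B.filter (fun i => i = p ∨ i = q) = {p, q} := by
        ext k
        simp only [Finset.mem_filter, Finset.mem_insert, Finset.mem_singleton]
        exact ⟨fun h => h.2, fun h => ⟨by rcases h with rfl | rfl <;> assumption, h⟩⟩
      rw [hsplit ν, hsplit μ, hout, hf, Finset.sum_pair hpq, Finset.sum_pair hpq, h3]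
    -- The only case where μ on B itself need not suffice: B contains the smaller entry p but not q,
    -- and p is traded for q.
    · refine le_trans ?_ (key (insert q (B.erase p)) ?_)
      · rw [Finset.sum_insert (by simp [hq]), ← Finset.add_sum_erase B ν hp]
        refine add_le_add h2.le (Finset.sum_le_sum fun k hk => ?_)
        have hk' := Finset.mem_erase.1 hk
        exact (h k hk'.1 (fun h => hq (h ▸ hk'.2))).le
      · rw [Finset.card_insert_of_notMem (by simp [hq]), Finset.card_erase_of_mem hp, ← hB]
        have := Finset.card_pos.2 ⟨p, hp⟩
        omega
    · refine le_trans ?_ (key B hB)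
      refine Finset.sum_le_sum fun k hk => ?_
      rcases eq_or_ne k q with rfl | hkq
      · omega
      · exact (h k (fun h => hp (h ▸ hk)) hkq).le
    · refine le_trans ?_ (key B hB)
      refine Finset.sum_le_sum fun k hk => ?_
      exact (h k (fun h => hp (h ▸ hk)) (fun h => hq (h ▸ hk))).le

theorem eq_of_prefix_sums {f g : Fin n → ℕ}
    (h : ∀ m : Fin n, ∑ i ∈ Finset.univ.filter (fun i => i ≤ m), f i =
      ∑ i ∈ Finset.univ.filter (fun i => i ≤ m), g i) : f = g := by
  have key : ∀ k (m : Fin n), (m : ℕ) < k → f m = g m := by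
    intro k
    induction k with
    | zero => intro m hm; omega
    | succ k ih =>
      intro m hm
      have hins : Finset.univ.filter (fun i => i ≤ m) =
          insert m (Finset.univ.filter fun i => i < m) := by
        ext i; simp [le_iff_eq_or_lt]
      have hm' := h m
      rw [hins, Finset.sum_insert (by simp), Finset.sum_insert (by simp)] at hm'
      have : ∑ i ∈ Finset.univ.filter (fun i => i < m), f i =
          ∑ i ∈ Finset.univ.filter (fun i => i < m), g i :=
        Finset.sum_congr rfl fun i hi => ih i (by
          have := Fin.lt_def.1 (Finset.mem_filter.1 hi).2
          omega)
      omega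
  exact funext fun m => key (m + 1) m (Nat.lt_succ_self _)

theorem DomLT.trans {f g h : Fin n → ℕ} (h1 : DomLT f g) (h2 : DomLT g h) : DomLT f h := by
  refine ⟨?_, h1.2.1.trans h2.2.1, fun m => (h1.2.2 m).trans (h2.2.2 m)⟩
  rintro rfl
  exact h1.1 (eq_of_prefix_sums fun m => le_antisymm (h1.2.2 m) (h2.2.2 m))

theorem BruhatLT.permLength_lt {u v : Equiv.Perm (Fin n)} (h : BruhatLT u v) :
    permLength u < permLength v := by
  induction h with
  | single h => obtain ⟨_, _, _, _, h⟩ := h; exact h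
  | tail _ h ih => obtain ⟨_, _, _, _, h⟩ := h; exact ih.trans h

theorem CompLT.trans {μ ν ξ : Fin n → ℕ} (h1 : CompLT μ ν) (h2 : CompLT ν ξ) : CompLT μ ξ := by
  rcases h1 with h1 | ⟨h1, h1'⟩ <;> rcases h2 with h2 | ⟨h2, h2'⟩
  · exact Or.inl (h1.trans h2)
  · exact Or.inl (h2 ▸ h1)
  · exact Or.inl (h1 ▸ h2)
  · exact Or.inr ⟨h1.trans h2, Relation.TransGen.trans h1' h2'⟩

theorem CompLT.irrefl (μ : Fin n → ℕ) : ¬ CompLT μ μ := by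
  rintro (h | ⟨_, h⟩)
  · exact h.1 rfl
  · exact absurd h.permLength_lt (lt_irrefl _)

theorem CompLT.sum_eq {μ ν : Fin n → ℕ} (h : CompLT μ ν) : ∑ i, μ i = ∑ i, ν i := by
  rw [← sum_sortDesc μ fun x => x, ← sum_sortDesc ν fun x => x]
  rcases h with h | ⟨h, _⟩
  · exact h.2.1
  · rw [h]

/-- Comparable compositions have equal sums, which bounds every entry. -/
theorem finite_setOf_compLT (μ : Fin n → ℕ) : {ν | CompLT ν μ}.Finite := by
  refine (Set.finite_Iic (fun _ : Fin n => ∑ i, μ i)).subset fun ν hν i => ?_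
  rw [← CompLT.sum_eq hν]
  exact Finset.single_le_sum (f := ν) (fun _ _ => Nat.zero_le _) (Finset.mem_univ i)

/-- Multiplication by a transposition that undoes an inversion shortens a permutation. -/
theorem permLength_mul_swap_lt {w : Equiv.Perm (Fin n)} {i j : Fin n} (hij : i < j)
    (hw : w j < w i) : permLength (w * Equiv.swap i j) < permLength w := by
  set s := Equiv.swap i j with hs
  -- The map f injects the inversions of w s into those of w other than (i, j): a pair is
  -- transported by s when s keeps its order, and is left in place otherwise.
  let f : Fin n × Fin n → Fin n × Fin n := fun p => if s p.1 < s p.2 then (s p.1, s p.2) else p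
  have hss : ∀ k, s (s k) = k := fun k => by rw [hs, Equiv.swap_apply_self]
  have hsi : s i = j := Equiv.swap_apply_left _ _
  have hsj : s j = i := Equiv.swap_apply_right _ _
  have hsk : ∀ k, k ≠ i → k ≠ j → s k = k := fun k => Equiv.swap_apply_of_ne_of_ne
  have hmaps : ∀ p : Fin n × Fin n, p.1 < p.2 → (w * s) p.2 < (w * s) p.1 →
      (f p).1 < (f p).2 ∧ w (f p).2 < w (f p).1 ∧ f p ≠ (i, j) := by
    rintro ⟨a, b⟩ hab hinv
    simp only [Equiv.Perm.mul_apply] at hinv hab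
    simp only [f]
    split_ifs with hlt
    · refine ⟨hlt, hinv, fun h => ?_⟩
      rw [Prod.mk.injEq] at h
      have h1 := hss a
      have h2 := hss b
      rw [h.1, hsi] at h1
      rw [h.2, hsj] at h2
      subst h1 h2
      exact absurd hab (not_lt.2 hij.le)
    · by_cases hai : a = i
      · subst hai
        by_cases hbj : b = j
        · subst hbj
          rw [hsi, hsj] at hinv
          exact absurd hinv (not_lt.2 hw.le)
        · rw [hsi, hsk b hab.ne' hbj] at hinv
          exact ⟨hab, hinv.trans hw, fun h => hbj (Prod.mk.inj h).2⟩
      · by_cases haj : a = j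
        · subst haj
          rw [hsj, hsk b (hij.trans hab).ne' hab.ne'] at hlt
          exact absurd (hij.trans hab) hlt
        · rw [hsk a hai haj] at hlt hinv
          by_cases hbj : b = j
          · subst hbj
            rw [hsj] at hinv
            exact ⟨hab, hw.trans hinv, fun h => hai (Prod.mk.inj h).1⟩
          · by_cases hbi : b = i
            · subst hbi
              rw [hsi] at hlt
              exact absurd (hab.trans hij) hlt
            · rw [hsk b hbi hbj] at hlt
              exact absurd hab hlt
  unfold permLength
  set I := Finset.univ.filter fun p : Fin n × Fin n => p.1 < p.2 ∧ w p.2 < w p.1 with hI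
  have hmem : (i, j) ∈ I := by simpa [hI] using ⟨hij, hw⟩
  refine lt_of_le_of_lt (Finset.card_le_card_of_injOn f (t := I.erase (i, j)) ?_ ?_)
    (Finset.card_erase_lt_of_mem hmem)
  · intro p hp
    obtain ⟨-, hp1, hp2⟩ := Finset.mem_filter.1 hp
    have := hmaps p hp1 hp2
    exact Finset.mem_coe.2 (Finset.mem_erase.2
      ⟨this.2.2, Finset.mem_filter.2 ⟨Finset.mem_univ _, this.1, this.2.1⟩⟩)
  · rintro ⟨a, b⟩ hab ⟨c, d⟩ hcd h
    have hab' : a < b := (Finset.mem_filter.1 hab).2.1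
    have hcd' : c < d := (Finset.mem_filter.1 hcd).2.1
    simp only [f] at h
    split_ifs at h with h1 h2 h2
    · simp only [Prod.mk.injEq] at h ⊢
      exact ⟨s.injective h.1, s.injective h.2⟩
    · simp only [Prod.mk.injEq] at h
      rw [← h.1, ← h.2, hss, hss] at h2
      exact absurd hab' h2
    · simp only [Prod.mk.injEq] at h
      rw [h.1, h.2, hss, hss] at h1
      exact absurd hcd' h1
    · exact h

theorem wPerm_val (μ : Fin n → ℕ) (i : Fin n) : (wPerm μ i : ℕ) = wCount μ i := rfl

/-- Ranking is by value, and among equal values the later position has the smaller rank; this is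
where w_μ being longest matters. -/
theorem wPerm_lt_wPerm_iff (μ : Fin n → ℕ) (i j : Fin n) :
    wPerm μ i < wPerm μ j ↔ μ i < μ j ∨ (μ i = μ j ∧ j < i) := by
  have key : ∀ i j, (μ i < μ j ∨ (μ i = μ j ∧ j < i)) → wPerm μ i < wPerm μ j :=
    fun i j h => wCount_lt_wCount μ h
  refine ⟨fun h => ?_, key i j⟩
  by_contra hcon
  rcases eq_or_ne i j with rfl | hne
  · exact lt_irrefl _ h
  · refine lt_asymm h (key j i ?_)
    have hne' := Fin.val_ne_of_ne hne
    simp only [Fin.lt_def] at hcon ⊢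
    omega

/-- If no value strictly between positions `i` and `j` equals `μ_i` or `μ_j`, the permutation
`w_μ` is compatible with the exchange of the values at `i` and `j`. -/
theorem wPerm_comp_swap {μ : Fin n → ℕ} {i j : Fin n} (hij : i < j) (hμ : μ j < μ i)
    (hb : ∀ k, i < k → k < j → μ k ≠ μ i ∧ μ k ≠ μ j) :
    wPerm (μ ∘ Equiv.swap i j) = wPerm μ * Equiv.swap i j := by
  ext k
  rw [Equiv.Perm.mul_apply, wPerm_val, wPerm_val]
  unfold wCount
  refine Finset.card_equiv (Equiv.swap i j) fun m => ?_
  simp only [Finset.mem_filter, Finset.mem_univ, true_and, Function.comp_apply]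
  have hbk := hb k
  have hbm := hb m
  rcases eq_or_ne k i with rfl | hki
  · rcases eq_or_ne m k with rfl | hmi
    · simp
    rcases eq_or_ne m j with rfl | hmj
    · simp only [Equiv.swap_apply_left, Equiv.swap_apply_right]
      omega
    · rw [Equiv.swap_apply_of_ne_of_ne hmi hmj, Equiv.swap_apply_left]
      omega
  rcases eq_or_ne k j with rfl | hkj
  · rcases eq_or_ne m i with rfl | hmi
    · simp only [Equiv.swap_apply_left, Equiv.swap_apply_right]
      omega
    rcases eq_or_ne m k with rfl | hmj
    · simp
    · rw [Equiv.swap_apply_of_ne_of_ne hmi hmj, Equiv.swap_apply_right]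
      omega
  rw [Equiv.swap_apply_of_ne_of_ne hki hkj]
  rcases eq_or_ne m i with rfl | hmi
  · rw [Equiv.swap_apply_left]
    omega
  rcases eq_or_ne m j with rfl | hmj
  · rw [Equiv.swap_apply_right]
    omega
  rw [Equiv.swap_apply_of_ne_of_ne hmi hmj]

/-- Exchanging the values at an inversion of `μ` lowers it. -/
theorem compLT_comp_swap : ∀ (N : ℕ) (μ : Fin n → ℕ) (i j : Fin n), (j : ℕ) - i ≤ N → i < j →
    μ j < μ i → CompLT (μ ∘ Equiv.swap i j) μ
  | 0, μ, i, j, hN, hij, _ => by rw [Fin.lt_def] at hij; omega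
  | N + 1, μ, i, j, hN, hij, hμ => by
    by_cases hb : ∀ k, i < k → k < j → μ k ≠ μ i ∧ μ k ≠ μ j
    -- With no obstruction in between, the exchange multiplies w_μ by a transposition that removes
    -- an inversion: a single step in Bruhat order.
    · refine Or.inr ⟨sortDesc_comp_perm _ _, Relation.TransGen.single ⟨i, j, hij.ne, ?_, ?_⟩⟩
      · rw [wPerm_comp_swap hij hμ hb, mul_assoc, Equiv.swap_mul_self, mul_one]
      · rw [wPerm_comp_swap hij hμ hb]
        exact permLength_mul_swap_lt hij ((wPerm_lt_wPerm_iff μ j i).2 (Or.inl hμ))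
    -- An intermediate position k carrying μ_i or μ_j splits the exchange into two exchanges over
    -- shorter distances; a third one would exchange equal values.
    · push Not at hb
      obtain ⟨k, hik, hkj, hk⟩ := hb
      have hik' := Fin.lt_def.1 hik
      have hkj' := Fin.lt_def.1 hkj
      have ski : Equiv.swap k j i = i := Equiv.swap_apply_of_ne_of_ne hik.ne hij.ne
      have sij : Equiv.swap i k j = j := Equiv.swap_apply_of_ne_of_ne hij.ne' hkj.ne'
      by_cases hki : μ k = μ i
      · have h1 := compLT_comp_swap N μ k j (by omega) hkj (hki ▸ hμ)
        have h2 := compLT_comp_swap N (μ ∘ Equiv.swap k j) i k (by omega) hik (by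
          simp only [Function.comp_apply, Equiv.swap_apply_left, ski]; exact hμ)
        refine (?_ : μ ∘ Equiv.swap i j = (μ ∘ Equiv.swap k j) ∘ Equiv.swap i k) ▸ h2.trans h1
        funext m
        simp only [Function.comp_apply]
        rcases eq_or_ne m i with rfl | hmi
        · simp
        rcases eq_or_ne m k with rfl | hmk
        · rw [Equiv.swap_apply_right, ski, Equiv.swap_apply_of_ne_of_ne hmi hkj.ne, hki]
        rcases eq_or_ne m j with rfl | hmj
        · rw [Equiv.swap_apply_right, sij, Equiv.swap_apply_right, hki]
        rw [Equiv.swap_apply_of_ne_of_ne hmi hmj, Equiv.swap_apply_of_ne_of_ne hmi hmk,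
          Equiv.swap_apply_of_ne_of_ne hmk hmj]
      · have hkj2 := hk hki
        have h1 := compLT_comp_swap N μ i k (by omega) hik (hkj2 ▸ hμ)
        have h2 := compLT_comp_swap N (μ ∘ Equiv.swap i k) k j (by omega) hkj (by
          simp only [Function.comp_apply, Equiv.swap_apply_right, sij]; exact hμ)
        refine (?_ : μ ∘ Equiv.swap i j = (μ ∘ Equiv.swap i k) ∘ Equiv.swap k j) ▸ h2.trans h1
        funext m
        simp only [Function.comp_apply]
        rcases eq_or_ne m i with rfl | hmi
        · rw [Equiv.swap_apply_left, ski, Equiv.swap_apply_left, hkj2]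
        rcases eq_or_ne m k with rfl | hmk
        · rw [Equiv.swap_apply_left, sij, Equiv.swap_apply_of_ne_of_ne hmi hkj.ne, hkj2]
        rcases eq_or_ne m j with rfl | hmj
        · simp
        rw [Equiv.swap_apply_of_ne_of_ne hmi hmj, Equiv.swap_apply_of_ne_of_ne hmk hmj,
          Equiv.swap_apply_of_ne_of_ne hmi hmk]

end Order

/-! ### Algebras with the relations of the rational Cherednik algebra -/

section Relations

variable {F : Type*} [Field F] [Algebra ℂ F] {r n : ℕ} [NeZero r] {A : Type*} [Ring A] [Algebra F A]
  (t : W r n →* A) (κ c₀ : F) (d : ZMod r → F)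

/-- The coefficient of `-t_{ζ_i ^ l}` in `y_i x_i - x_i y_i - κ`. -/
def diagCoeff (d : ZMod r → F) (l : ZMod r) : F :=
  ∑ j, (d j - d (j - 1)) * ((r : F)⁻¹ * zetaPow F (-(l * j)))

/-- The sum `∑_l ζ ^ (-l) t_{ζ_i ^ l s_{ij} ζ_i ^ (-l)}`. -/
def reflTwist (F : Type*) [Field F] [Algebra ℂ F] {A : Type*} [Ring A] [Algebra F A]
    (t : W r n →* A) (i j : Fin n) : A := ∑ l : ZMod r, zetaPow F (-l) • t (W.refl i j l)

/-- The commutator `y_i x_i - x_i y_i`. -/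
def bracketSelf (i : Fin n) : A :=
  algebraMap F A κ - ∑ l : ZMod r, diagCoeff d l • t (W.zeta i l) -
    c₀ • ∑ j ∈ Finset.univ.filter (fun j => j ≠ i), reflSum t i j

/-- The commutator `y_i x_j - x_j y_i`. -/
def bracket (i j : Fin n) : A :=
  if i = j then bracketSelf t κ c₀ d i else c₀ • reflTwist F t i j

theorem mul_bracketSelf (w : W r n) (i : Fin n) :
    t w * bracketSelf t κ c₀ d i = bracketSelf t κ c₀ d (w.right i) * t w := by
  simp only [bracketSelf, mul_sub, sub_mul, Algebra.commutes κ (t w), mul_smul_comm,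
    smul_mul_assoc, Finset.mul_sum, Finset.sum_mul, ← map_mul, W.mul_zeta]
  congr 2
  refine Finset.sum_equiv w.right (fun j => by simp) fun j hj => ?_
  rw [mul_reflSum t w (Finset.mem_filter.1 hj).2.symm]

/-- The translation of l that conjugation causes turns into the scalar, because of the weight ζ^{-l}
in the sum. -/
theorem mul_reflTwist (w : W r n) {i j : Fin n} (hij : i ≠ j) :
    t w * reflTwist F t i j =
      zetaPow F ((w.left (w.right i)).toAdd - (w.left (w.right j)).toAdd) •
        (reflTwist F t (w.right i) (w.right j) * t w) := by
  simp only [reflTwist, Finset.mul_sum, Finset.sum_mul, mul_smul_comm, smul_mul_assoc, ← map_mul,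
    W.mul_refl w hij, Finset.smul_sum, smul_smul, ← zetaPow_add]
  refine Fintype.sum_equiv (Equiv.addRight
    ((w.left (w.right i)).toAdd - (w.left (w.right j)).toAdd)) _ _ fun l => ?_
  rw [Equiv.coe_addRight, add_sub_assoc]
  congr 2
  ring

theorem mul_bracket (w : W r n) (i j : Fin n) :
    t w * bracket t κ c₀ d i j =
      zetaPow F ((w.left (w.right i)).toAdd - (w.left (w.right j)).toAdd) •
        (bracket t κ c₀ d (w.right i) (w.right j) * t w) := by
  unfold bracket
  by_cases hij : i = j
  · subst hij
    rw [if_pos rfl, if_pos rfl, mul_bracketSelf, sub_self, zetaPow_zero, one_smul]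
  · rw [if_neg hij, if_neg (fun h => hij (w.right.injective h)), mul_smul_comm,
      mul_reflTwist t w hij, smul_mul_assoc, smul_comm]

/-- The bracket terms cancel because t_w permutes the brackets with the same scalars as it does the
products. For Dunkl operators, which kill 1 ⊗ V, this intertwining forces the defect to be zero. -/
theorem mul_y_sub_mul_x {x y : Fin n → A}
    (t_x : ∀ w j, t w * x j = zetaPow F (-(w.left (w.right j)).toAdd) • (x (w.right j) * t w))
    (y_x : ∀ i j, y i * x j = x j * y i + bracket t κ c₀ d i j) (w : W r n) (j k : Fin n) :
    (t w * y j - zetaPow F (w.left (w.right j)).toAdd • (y (w.right j) * t w)) * x k =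
      (zetaPow F (-(w.left (w.right k)).toAdd) • x (w.right k)) *
        (t w * y j - zetaPow F (w.left (w.right j)).toAdd • (y (w.right j) * t w)) := by
  have h1 : t w * y j * x k = zetaPow F (-(w.left (w.right k)).toAdd) •
      (x (w.right k) * (t w * y j)) + zetaPow F ((w.left (w.right j)).toAdd -
        (w.left (w.right k)).toAdd) • (bracket t κ c₀ d (w.right j) (w.right k) * t w) := by
    rw [mul_assoc, y_x, mul_add, ← mul_assoc, t_x, mul_bracket, smul_mul_assoc, mul_assoc]
  have h2 : y (w.right j) * t w * x k = zetaPow F (-(w.left (w.right k)).toAdd) •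
      (x (w.right k) * (y (w.right j) * t w) + bracket t κ c₀ d (w.right j) (w.right k) * t w) := by
    rw [mul_assoc, t_x, mul_smul_comm, ← mul_assoc, y_x, add_mul, mul_assoc]
  rw [sub_mul, smul_mul_assoc, h1, h2, sub_eq_add_neg (w.left (w.right j)).toAdd, zetaPow_add,
    mul_sub, smul_mul_assoc, mul_smul_comm, smul_mul_assoc]
  module

/-- Elements `x_i`, `y_i`, `t_w` of an algebra that satisfy all the defining relations of the
rational Cherednik algebra, except possibly the commutativity of the `y_i`. -/
structure PreCherednik (x y : Fin n → A) : Prop where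
  x_comm : ∀ i j, x i * x j = x j * x i
  t_x : ∀ w j, t w * x j = zetaPow F (-(w.left (w.right j)).toAdd) • (x (w.right j) * t w)
  t_y : ∀ w j, t w * y j = zetaPow F (w.left (w.right j)).toAdd • (y (w.right j) * t w)
  y_x : ∀ i j, y i * x j = x j * y i + bracket t κ c₀ d i j

namespace PreCherednik

variable {t κ c₀ d} {x y : Fin n → A} (h : PreCherednik t κ c₀ d x y)
include h

theorem refl_mul_y_of_ne {i j k : Fin n} (hij : i ≠ j) (hki : k ≠ i) (hkj : k ≠ j) (l : ZMod r) :
    t (W.refl i j l) * y k = y k * t (W.refl i j l) := by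
  rw [h.t_y, W.refl_right, Equiv.swap_apply_of_ne_of_ne hki hkj, W.refl_left hij, if_neg hki,
    if_neg hkj, zetaPow_zero, one_smul]

theorem refl_mul_y_left {i j : Fin n} (hij : i ≠ j) (l : ZMod r) :
    t (W.refl i j l) * y i = zetaPow F (-l) • (y j * t (W.refl i j l)) := by
  rw [h.t_y, W.refl_right, Equiv.swap_apply_left, W.refl_left hij, if_neg hij.symm, if_pos rfl]

theorem refl_mul_y_right {i j : Fin n} (hij : i ≠ j) (l : ZMod r) :
    t (W.refl i j l) * y j = zetaPow F l • (y i * t (W.refl i j l)) := by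
  rw [h.t_y, W.refl_right, Equiv.swap_apply_right, W.refl_left hij, if_pos rfl]

theorem refl_mul_x_of_ne {i j k : Fin n} (hij : i ≠ j) (hki : k ≠ i) (hkj : k ≠ j) (l : ZMod r) :
    t (W.refl i j l) * x k = x k * t (W.refl i j l) := by
  rw [h.t_x, W.refl_right, Equiv.swap_apply_of_ne_of_ne hki hkj, W.refl_left hij, if_neg hki,
    if_neg hkj, neg_zero, zetaPow_zero, one_smul]

theorem refl_mul_x_left {i j : Fin n} (hij : i ≠ j) (l : ZMod r) :
    t (W.refl i j l) * x i = zetaPow F l • (x j * t (W.refl i j l)) := by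
  rw [h.t_x, W.refl_right, Equiv.swap_apply_left, W.refl_left hij, if_neg hij.symm, if_pos rfl,
    neg_neg]

theorem zeta_mul_y_of_ne {i k : Fin n} (hki : k ≠ i) (l : ZMod r) :
    t (W.zeta i l) * y k = y k * t (W.zeta i l) := by
  rw [h.t_y, W.zeta_right, Equiv.Perm.one_apply, W.zeta_left, if_neg hki, zetaPow_zero, one_smul]

theorem commutator_reflTwist_of_ne {i j k : Fin n} (hjk : j ≠ k) (hij : i ≠ j) (hik : i ≠ k) :
    y i * reflTwist F t j k = reflTwist F t j k * y i := by
  simp only [reflTwist, Finset.mul_sum, Finset.sum_mul, mul_smul_comm, smul_mul_assoc,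
    h.refl_mul_y_of_ne hjk hij hik]

theorem commutator_reflSum_of_ne {i j k : Fin n} (hjk : j ≠ k) (hij : i ≠ j) (hik : i ≠ k) :
    y i * reflSum t j k = reflSum t j k * y i := by
  simp only [reflSum, Finset.mul_sum, Finset.sum_mul, h.refl_mul_y_of_ne hjk hij hik]

/-- Every summand of the bracket commutes with y_j except the reflections in the pair i, j. -/
theorem commutator_bracketSelf {i j : Fin n} (hij : i ≠ j) :
    y j * bracketSelf t κ c₀ d i - bracketSelf t κ c₀ d i * y j =
      -(c₀ • (y j * reflSum t i j - reflSum t i j * y j)) := by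
  have hf : Finset.univ.filter (fun k => k ≠ i) =
      insert j (Finset.univ.filter fun k => k ≠ i ∧ k ≠ j) := by
    ext k
    simp only [Finset.mem_filter, Finset.mem_univ, true_and, Finset.mem_insert]
    rcases eq_or_ne k j with rfl | hk
    · simp [hij.symm]
    · simp [hk]
  have hrest : y j * ∑ k ∈ Finset.univ.filter (fun k => k ≠ i ∧ k ≠ j), reflSum t i k =
      (∑ k ∈ Finset.univ.filter (fun k => k ≠ i ∧ k ≠ j), reflSum t i k) * y j := by
    rw [Finset.mul_sum, Finset.sum_mul]
    refine Finset.sum_congr rfl fun k hk => ?_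
    have hk := (Finset.mem_filter.1 hk).2
    exact h.commutator_reflSum_of_ne hk.1.symm hij.symm hk.2.symm
  have hdiag : y j * ∑ l : ZMod r, diagCoeff d l • t (W.zeta i l) =
      (∑ l : ZMod r, diagCoeff d l • t (W.zeta i l)) * y j := by
    simp only [Finset.mul_sum, Finset.sum_mul, mul_smul_comm, smul_mul_assoc,
      h.zeta_mul_y_of_ne hij.symm]
  rw [bracketSelf, hf, Finset.sum_insert (by simp), mul_sub, mul_sub, sub_mul, sub_mul,
    mul_smul_comm, smul_mul_assoc, mul_add, add_mul, hrest, hdiag, Algebra.commutes κ (y j)]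
  simp only [smul_add, smul_sub]
  abel

/-- This is [y_i, [y_j, x_k]] = [y_j, [y_i, x_k]], which by the Jacobi identity says that [y_i, y_j]
commutes with x_k. If i, j, k are distinct both sides vanish; if k equals i or j, both sides are
sums over the reflections in i, j. -/
theorem commutator_bracket_comm (i j k : Fin n) :
    y i * bracket t κ c₀ d j k - bracket t κ c₀ d j k * y i =
      y j * bracket t κ c₀ d i k - bracket t κ c₀ d i k * y j := by
  have key : ∀ {i j : Fin n}, i ≠ j →
      y i * bracket t κ c₀ d j i - bracket t κ c₀ d j i * y i =
        y j * bracket t κ c₀ d i i - bracket t κ c₀ d i i * y j := by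
    intro i j hij
    rw [bracket, bracket, if_pos rfl, if_neg hij.symm, h.commutator_bracketSelf hij, mul_smul_comm,
      smul_mul_assoc, ← smul_sub, ← smul_neg, ← reflSum_comm t hij]
    congr 1
    simp only [reflTwist, reflSum, Finset.mul_sum, Finset.sum_mul, mul_smul_comm, smul_mul_assoc,
      h.refl_mul_y_right hij.symm, h.refl_mul_y_left hij.symm, smul_smul, zetaPow_neg_mul, one_smul,
      ← Finset.sum_sub_distrib, ← Finset.sum_neg_distrib, neg_sub]
  rcases eq_or_ne i j with rfl | hij
  · rfl
  rcases eq_or_ne k i with rfl | hki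
  · exact key hij
  rcases eq_or_ne k j with rfl | hkj
  · exact (key hij.symm).symm
  rw [bracket, bracket, if_neg hkj.symm, if_neg hki.symm, mul_smul_comm, smul_mul_assoc,
    mul_smul_comm, smul_mul_assoc, h.commutator_reflTwist_of_ne hkj.symm hij hki.symm,
    h.commutator_reflTwist_of_ne hki.symm hij.symm hkj.symm, sub_self, sub_self]

/-- The commutators of the `y_i` commute with the `x_k`. -/
theorem commutator_y_mul_x (i j k : Fin n) :
    (y i * y j - y j * y i) * x k = x k * (y i * y j - y j * y i) := by
  have h1 : ∀ i j, y i * y j * x k = x k * (y i * y j) + bracket t κ c₀ d i k * y j +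
      y i * bracket t κ c₀ d j k := fun i j => by
    rw [mul_assoc, h.y_x, mul_add, ← mul_assoc, h.y_x, add_mul, mul_assoc]
  have h2 := h.commutator_bracket_comm i j k
  rw [sub_eq_sub_iff_add_eq_add] at h2
  rw [sub_mul, mul_sub, h1, h1, sub_eq_sub_iff_add_eq_add]
  calc _ = (y i * bracket t κ c₀ d j k + bracket t κ c₀ d i k * y j) + x k * (y i * y j) +
        x k * (y j * y i) := by abel
    _ = _ := by rw [h2]; abel

end PreCherednik

/-- Elements `x_i`, `y_i`, `t_w` of an algebra that satisfy the defining relations of the rational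
Cherednik algebra. -/
structure IsCherednik (x y : Fin n → A) : Prop extends PreCherednik t κ c₀ d x y where
  y_comm : ∀ i j, y i * y j = y j * y i

namespace IsCherednik

variable {t κ c₀ d} {x y : Fin n → A} (h : IsCherednik t κ c₀ d x y)
include h

theorem refl_mul_yx_of_ne {i j k : Fin n} (hij : i ≠ j) (hki : k ≠ i) (hkj : k ≠ j) (l : ZMod r) :
    t (W.refl i j l) * (y k * x k) = y k * x k * t (W.refl i j l) := by
  rw [← mul_assoc, h.refl_mul_y_of_ne hij hki hkj, mul_assoc, h.refl_mul_x_of_ne hij hki hkj,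
    mul_assoc]

theorem reflSum_mul_yx_of_ne {i j k : Fin n} (hij : i ≠ j) (hki : k ≠ i) (hkj : k ≠ j) :
    reflSum t i j * (y k * x k) = y k * x k * reflSum t i j := by
  simp only [reflSum, Finset.mul_sum, Finset.sum_mul, h.refl_mul_yx_of_ne hij hki hkj]

theorem reflSum_mul_yx {i j : Fin n} (hij : i ≠ j) :
    reflSum t i j * (y i * x i) = y j * x j * reflSum t i j := by
  simp only [reflSum, Finset.mul_sum, Finset.sum_mul]
  refine Finset.sum_congr rfl fun l _ => ?_
  rw [← mul_assoc, h.refl_mul_y_left hij, smul_mul_assoc, mul_assoc, h.refl_mul_x_left hij,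
    mul_smul_comm, smul_smul, zetaPow_neg_mul, one_smul, mul_assoc]

/-- After y_j is moved past x_i the leading term is symmetric in i and j, so the commutator of y_i
x_i and y_j x_j consists of reflection terms only. -/
theorem yx_mul_yx {i j : Fin n} (hij : i ≠ j) :
    y i * x i * (y j * x j) = y i * y j * (x i * x j) - c₀ • (y i * x i * reflSum t i j) := by
  have h1 : x i * y j = y j * x i - c₀ • reflTwist F t j i := by
    rw [h.y_x j i, bracket, if_neg hij.symm, add_sub_cancel_right]
  have h2 : reflTwist F t j i * x j = x i * reflSum t i j := by
    rw [← reflSum_comm t hij]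
    simp only [reflTwist, reflSum, Finset.sum_mul, Finset.mul_sum, smul_mul_assoc,
      h.refl_mul_x_left hij.symm, smul_smul, zetaPow_neg_mul, one_smul]
  calc y i * x i * (y j * x j) = y i * (x i * y j) * x j := by simp only [mul_assoc]
    _ = y i * y j * (x i * x j) - c₀ • (y i * (reflTwist F t j i * x j)) := by
      rw [h1, mul_sub, sub_mul, mul_smul_comm, smul_mul_assoc]
      simp only [mul_assoc]
    _ = _ := by rw [h2, ← mul_assoc (y i) (x i) (reflSum t i j)]

/-- The Dunkl–Opdam elements commute. -/
theorem dunklOpdam_comm (i j : Fin n) :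
    (y i * x i + c₀ • jmSum t i) * (y j * x j + c₀ • jmSum t j) =
      (y j * x j + c₀ • jmSum t j) * (y i * x i + c₀ • jmSum t i) := by
  have key : ∀ {i j : Fin n}, i < j → (y i * x i + c₀ • jmSum t i) * (y j * x j + c₀ • jmSum t j) =
      (y j * x j + c₀ • jmSum t j) * (y i * x i + c₀ • jmSum t i) := by
    intro i j hij
    have hne := hij.ne
    have h1 : jmSum t i * (y j * x j) = y j * x j * jmSum t i := by
      rw [jmSum, Finset.sum_mul, Finset.mul_sum]
      refine Finset.sum_congr rfl fun k hk => ?_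
      have hk := (Finset.mem_filter.1 hk).2
      exact h.reflSum_mul_yx_of_ne hk.ne' hij.ne' (hk.trans hij).ne'
    -- Among the reflections in φ_j only those in the pair i, j fail to commute with y_i x_i; they
    -- interchange it with y_j x_j.
    have h2 : y i * x i * jmSum t j - jmSum t j * (y i * x i) =
        y i * x i * reflSum t i j - y j * x j * reflSum t i j := by
      have hf : Finset.univ.filter (fun k => k < j) =
          insert i ((Finset.univ.filter (fun k => k < j)).erase i) :=
        (Finset.insert_erase (by simpa using hij)).symm
      have hrest : (∑ k ∈ (Finset.univ.filter (fun k => k < j)).erase i, reflSum t j k) *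
          (y i * x i) = y i * x i *
            ∑ k ∈ (Finset.univ.filter (fun k => k < j)).erase i, reflSum t j k := by
        rw [Finset.sum_mul, Finset.mul_sum]
        refine Finset.sum_congr rfl fun k hk => ?_
        have hk := Finset.mem_erase.1 hk
        exact h.reflSum_mul_yx_of_ne (Finset.mem_filter.1 hk.2).2.ne' hne hk.1.symm
      rw [jmSum, hf, Finset.sum_insert (by simp), mul_add, add_mul, hrest, reflSum_comm t hne,
        h.reflSum_mul_yx hne]
      abel
    have h3 := h.yx_mul_yx hne
    have h4 := h.yx_mul_yx hne.symm
    rw [reflSum_comm t hne, h.y_comm j i, h.x_comm j i] at h4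
    -- The commutator of the y x parts is exactly compensated by the one with φ_j.
    have h5 : y i * x i * (y j * x j) - y j * x j * (y i * x i) =
        -(c₀ • (y i * x i * jmSum t j - jmSum t j * (y i * x i))) := by
      rw [h3, h4, h2, smul_sub]
      abel
    rw [← sub_eq_zero]
    calc _ = (y i * x i * (y j * x j) - y j * x j * (y i * x i)) +
          c₀ • (y i * x i * jmSum t j - jmSum t j * (y i * x i)) +
          c₀ • (jmSum t i * (y j * x j) - y j * x j * jmSum t i) +
          c₀ • c₀ • (jmSum t i * jmSum t j - jmSum t j * jmSum t i) := by
          simp only [mul_add, add_mul, smul_sub, mul_smul_comm, smul_mul_assoc, smul_add]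
          abel
      _ = 0 := by
        rw [h5, h1, jmSum_mul_jmSum t i j]
        simp
  rcases lt_trichotomy i j with hij | rfl | hij
  · exact key hij
  · rfl
  · exact (key hij).symm

theorem zeta_mul_dunklOpdam (i j : Fin n) (l : ZMod r) :
    t (W.zeta i l) * (y j * x j + c₀ • jmSum t j) =
      (y j * x j + c₀ • jmSum t j) * t (W.zeta i l) := by
  rw [mul_add, add_mul, mul_smul_comm, smul_mul_assoc, zeta_mul_jmSum, ← mul_assoc, h.t_y,
    smul_mul_assoc, mul_assoc, h.t_x, mul_smul_comm, smul_smul]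
  simp only [W.zeta_right, Equiv.Perm.one_apply]
  rw [← zetaPow_add, add_neg_cancel, zetaPow_zero, one_smul, mul_assoc]

end IsCherednik

end Relations

/-! ### The polynomial representation -/

section Polynomial

variable (F : Type*) [Field F] [Algebra ℂ F] {r n : ℕ} [NeZero r]

/-- The action of `w` on polynomials by algebra automorphisms. -/
def polyAct (w : W r n) : MvPolynomial (Fin n) F →ₐ[F] MvPolynomial (Fin n) F :=
  MvPolynomial.aeval fun j =>
    zetaPow F (-(w.left (w.right j)).toAdd) • MvPolynomial.X (w.right j)

theorem polyAct_X (w : W r n) (j : Fin n) : polyAct F w (MvPolynomial.X j) =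
    zetaPow F (-(w.left (w.right j)).toAdd) • MvPolynomial.X (w.right j) := by
  rw [polyAct, MvPolynomial.aeval_X]

theorem polyAct_one : polyAct F (1 : W r n) = AlgHom.id F _ := by
  refine MvPolynomial.algHom_ext fun j => ?_
  rw [polyAct_X]
  simp [zetaPow_zero]

theorem polyAct_mul (v w : W r n) : polyAct F (v * w) = (polyAct F v).comp (polyAct F w) := by
  refine MvPolynomial.algHom_ext fun j => ?_
  rw [AlgHom.comp_apply, polyAct_X, polyAct_X, map_smul, polyAct_X, smul_smul, ← zetaPow_add,
    SemidirectProduct.mul_right, Equiv.Perm.mul_apply, W.mul_left_apply,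
    Equiv.Perm.inv_eq_iff_eq.2 rfl]
  congr 2
  ring

/-- The `q`-derivative in the direction `i`, for `q = ζ ^ (-l)`. -/
def qDeriv (i : Fin n) (l : ZMod r) : MvPolynomial (Fin n) F →ₗ[F] MvPolynomial (Fin n) F :=
  (MvPolynomial.basisMonomials (Fin n) F).constr F fun m =>
    MvPolynomial.monomial (m - Finsupp.single i 1)
      (∑ k ∈ Finset.range (m i), zetaPow F (-(l * (k : ZMod r))))

theorem qDeriv_monomial (i : Fin n) (l : ZMod r) (m : Fin n →₀ ℕ) :
    qDeriv F i l (MvPolynomial.monomial m 1) = MvPolynomial.monomial (m - Finsupp.single i 1)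
      (∑ k ∈ Finset.range (m i), zetaPow F (-(l * (k : ZMod r)))) := by
  exact (MvPolynomial.basisMonomials (Fin n) F).constr_basis F _ m

theorem zetaPow_pow (l : ZMod r) (k : ℕ) : zetaPow F l ^ k = zetaPow F (l * (k : ZMod r)) := by
  induction k with
  | zero => simp [zetaPow_zero]
  | succ k ih => rw [pow_succ, ih, ← zetaPow_add, Nat.cast_succ, mul_add, mul_one]

theorem polyAct_zeta_monomial (i : Fin n) (l : ZMod r) (m : Fin n →₀ ℕ) :
    polyAct F (W.zeta i l) (MvPolynomial.monomial m 1) =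
      zetaPow F (-(l * (m i : ZMod r))) • MvPolynomial.monomial m 1 := by
  rw [polyAct, MvPolynomial.aeval_monomial, map_one, one_mul, Finsupp.prod_fintype _ _ (by simp)]
  simp only [smul_pow, W.zeta_right, Equiv.Perm.one_apply, W.zeta_left]
  rw [Finset.prod_smul, Finset.prod_eq_single i]
  · rw [if_pos rfl, zetaPow_pow, neg_mul, MvPolynomial.monomial_eq, map_one, one_mul,
      Finsupp.prod_fintype _ _ (by simp)]
  · intro j _ hj
    rw [if_neg hj, neg_zero, zetaPow_zero, one_pow]
  · simp

/-- A twisted Leibniz rule. Its correction term, the action of ζ_i^l, supplies the diagonal group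
elements in the commutator of y_i and x_i. -/
theorem qDeriv_X_mul (i j : Fin n) (l : ZMod r) (f : MvPolynomial (Fin n) F) :
    qDeriv F i l (MvPolynomial.X j * f) = MvPolynomial.X j * qDeriv F i l f +
      if i = j then polyAct F (W.zeta i l) f else 0 := by
  induction f using MvPolynomial.induction_on' with
  | add p q hp hq =>
    rw [mul_add, map_add, hp, hq, map_add, mul_add, map_add]
    split_ifs
    · ring
    · ring
  | monomial m c =>
    rw [show MvPolynomial.monomial m c = c • MvPolynomial.monomial m (1 : F) by
      rw [MvPolynomial.smul_monomial, smul_eq_mul, mul_one], mul_smul_comm, map_smul, map_smul,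
      map_smul, mul_smul_comm, ← smul_ite_zero, ← smul_add]
    congr 1
    have hX : ∀ (m : Fin n →₀ ℕ) (c : F), MvPolynomial.X j * MvPolynomial.monomial m c =
        MvPolynomial.monomial (m + Finsupp.single j 1) c := fun m c => by
      rw [MvPolynomial.monomial_add_single, pow_one, mul_comm]
    rw [hX, qDeriv_monomial, qDeriv_monomial, hX, Finsupp.add_apply]
    split_ifs with hij
    · subst hij
      rw [polyAct_zeta_monomial, add_tsub_cancel_right, Finsupp.single_eq_same,
        Finset.sum_range_succ, map_add, MvPolynomial.smul_monomial, smul_eq_mul, mul_one]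
      congr 1
      -- The truncated exponent m - 1 does no harm: if m i = 0 the coefficient is an empty sum.
      rcases Nat.eq_zero_or_pos (m i) with h0 | h0
      · simp [h0]
      · rw [tsub_add_cancel_of_le (Finsupp.single_le_iff.2 h0)]
    · rw [Finsupp.single_eq_of_ne hij, add_zero, add_zero]
      rcases Nat.eq_zero_or_pos (m i) with h0 | h0
      · simp [h0]
      · rw [tsub_add_eq_add_tsub (Finsupp.single_le_iff.2 h0)]

theorem qDeriv_one (i : Fin n) (l : ZMod r) : qDeriv F i l 1 = 0 := by
  rw [← MvPolynomial.C_1, ← MvPolynomial.monomial_zero', qDeriv_monomial]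
  simp

/-- The linear form `x_i - ζ ^ l x_j`. -/
def refForm (i j : Fin n) (l : ZMod r) : MvPolynomial (Fin n) F :=
  MvPolynomial.X i - zetaPow F l • MvPolynomial.X j

theorem refForm_ne_zero {i j : Fin n} (hij : i ≠ j) (l : ZMod r) : refForm F i j l ≠ 0 := by
  intro h
  have := congrArg (MvPolynomial.eval (Pi.single i (1 : F))) h
  simp [refForm, MvPolynomial.smul_eval, hij.symm] at this

theorem polyAct_refl_left {i j : Fin n} (hij : i ≠ j) (l : ZMod r) :
    polyAct F (W.refl i j l) (MvPolynomial.X i) = zetaPow F l • MvPolynomial.X j := by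
  rw [polyAct_X, W.refl_right, Equiv.swap_apply_left, W.refl_left hij, if_neg hij.symm, if_pos rfl,
    neg_neg]

theorem polyAct_refl_right {i j : Fin n} (hij : i ≠ j) (l : ZMod r) :
    polyAct F (W.refl i j l) (MvPolynomial.X j) = zetaPow F (-l) • MvPolynomial.X i := by
  rw [polyAct_X, W.refl_right, Equiv.swap_apply_right, W.refl_left hij, if_pos rfl]

theorem polyAct_refl_of_ne {i j k : Fin n} (hij : i ≠ j) (hki : k ≠ i) (hkj : k ≠ j) (l : ZMod r) :
    polyAct F (W.refl i j l) (MvPolynomial.X k) = MvPolynomial.X k := by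
  rw [polyAct_X, W.refl_right, Equiv.swap_apply_of_ne_of_ne hki hkj, W.refl_left hij, if_neg hki,
    if_neg hkj, neg_zero, zetaPow_zero, one_smul]

/-- The divided difference of `x_k` with respect to `ζ_i ^ l s_{ij} ζ_i ^ (-l)`. -/
def divDiffX (i j : Fin n) (l : ZMod r) (k : Fin n) : F :=
  if k = i then 1 else if k = j then -zetaPow F (-l) else 0

theorem X_sub_polyAct_refl {i j : Fin n} (hij : i ≠ j) (l : ZMod r) (k : Fin n) :
    MvPolynomial.X k - polyAct F (W.refl i j l) (MvPolynomial.X k) =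
      divDiffX F i j l k • refForm F i j l := by
  unfold divDiffX refForm
  split_ifs with h1 h2
  · rw [h1, polyAct_refl_left F hij, one_smul]
  · rw [h2, polyAct_refl_right F hij, smul_sub, smul_smul, neg_mul, zetaPow_neg_mul]
    module
  · rw [polyAct_refl_of_ne F hij h1 h2, sub_self, zero_smul]

/-- The map f ↦ f - s f satisfies a twisted Leibniz rule, so divisibility need only be checked on
the variables. -/
theorem refForm_dvd {i j : Fin n} (hij : i ≠ j) (l : ZMod r) (f : MvPolynomial (Fin n) F) :
    refForm F i j l ∣ f - polyAct F (W.refl i j l) f := by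
  induction f using MvPolynomial.induction_on with
  | C a => simp [← MvPolynomial.algebraMap_eq]
  | add p q hp hq =>
    rw [map_add, add_sub_add_comm]
    exact dvd_add hp hq
  | mul_X p k hp =>
    have : p * MvPolynomial.X k - polyAct F (W.refl i j l) (p * MvPolynomial.X k) =
        (p - polyAct F (W.refl i j l) p) * MvPolynomial.X k + polyAct F (W.refl i j l) p *
          (MvPolynomial.X k - polyAct F (W.refl i j l) (MvPolynomial.X k)) := by
      rw [map_mul]; ring
    rw [this, X_sub_polyAct_refl F hij]
    refine dvd_add (hp.mul_right _) (Dvd.dvd.mul_left ?_ _)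
    rw [MvPolynomial.smul_eq_C_mul]
    exact dvd_mul_left _ _

/-- The divided difference `f ↦ (f - s f) / (x_i - ζ ^ l x_j)` for `s = ζ_i ^ l s_{ij} ζ_i ^ (-l)`
(and `0` if `i = j`). -/
def divDiff (i j : Fin n) (l : ZMod r) : MvPolynomial (Fin n) F →ₗ[F] MvPolynomial (Fin n) F :=
  if hij : i = j then 0 else
    { toFun := fun f => (refForm_dvd F hij l f).choose
      map_add' := fun f g => by
        refine mul_left_cancel₀ (refForm_ne_zero F hij l) ?_
        rw [mul_add, ← (refForm_dvd F hij l f).choose_spec, ← (refForm_dvd F hij l g).choose_spec,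
          ← (refForm_dvd F hij l (f + g)).choose_spec, map_add]
        ring
      map_smul' := fun c f => by
        refine mul_left_cancel₀ (refForm_ne_zero F hij l) ?_
        rw [RingHom.id_apply, mul_smul_comm, ← (refForm_dvd F hij l f).choose_spec,
          ← (refForm_dvd F hij l (c • f)).choose_spec, map_smul, smul_sub] }

theorem refForm_mul_divDiff {i j : Fin n} (hij : i ≠ j) (l : ZMod r)
    (f : MvPolynomial (Fin n) F) :
    refForm F i j l * divDiff F i j l f = f - polyAct F (W.refl i j l) f := by
  rw [divDiff, dif_neg hij]
  exact (refForm_dvd F hij l f).choose_spec.symm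

theorem divDiff_eq {i j : Fin n} (hij : i ≠ j) (l : ZMod r) {f g : MvPolynomial (Fin n) F}
    (h : refForm F i j l * g = f - polyAct F (W.refl i j l) f) : divDiff F i j l f = g :=
  mul_left_cancel₀ (refForm_ne_zero F hij l) ((refForm_mul_divDiff F hij l f).trans h.symm)

theorem divDiff_one {i j : Fin n} (hij : i ≠ j) (l : ZMod r) : divDiff F i j l 1 = 0 :=
  divDiff_eq F hij l (by simp)

theorem divDiff_X_mul {i j : Fin n} (hij : i ≠ j) (l : ZMod r) (k : Fin n)
    (f : MvPolynomial (Fin n) F) : divDiff F i j l (MvPolynomial.X k * f) =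
      MvPolynomial.X k * divDiff F i j l f + divDiffX F i j l k • polyAct F (W.refl i j l) f := by
  refine divDiff_eq F hij l ?_
  have h1 := refForm_mul_divDiff F hij l f
  have h2 := X_sub_polyAct_refl F hij l k
  rw [mul_add, mul_left_comm, h1, mul_smul_comm, ← smul_mul_assoc, ← h2, map_mul]
  ring

end Polynomial

/-! ### Dunkl operators on F[x] ⊗ V -/

section Representation

/-- The space `F[x] ⊗ V`. -/
def PolyMod (F : Type*) [Field F] (n : ℕ) (V : Type*) [AddCommGroup V] [Module F V] : Type _ :=
  MvPolynomial (Fin n) F ⊗[F] V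

section PolyMod

variable {F : Type*} [Field F] {n : ℕ} {V : Type*} [AddCommGroup V] [Module F V]

instance : AddCommGroup (PolyMod F n V) :=
  inferInstanceAs (AddCommGroup (MvPolynomial (Fin n) F ⊗[F] V))

instance : Module F (PolyMod F n V) :=
  inferInstanceAs (Module F (MvPolynomial (Fin n) F ⊗[F] V))

/-- The pure tensors of `F[x] ⊗ V`, as a bilinear map. -/
def pureT : MvPolynomial (Fin n) F →ₗ[F] V →ₗ[F] PolyMod F n V := TensorProduct.mk F _ _

/-- The tensor product of two operators. -/
def opMap (f : Module.End F (MvPolynomial (Fin n) F)) (g : Module.End F V) :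
    Module.End F (PolyMod F n V) := TensorProduct.map f g

theorem opMap_pureT (f : Module.End F (MvPolynomial (Fin n) F)) (g : Module.End F V)
    (p : MvPolynomial (Fin n) F) (v : V) : opMap f g (pureT p v) = pureT (f p) (g v) := rfl

theorem PolyMod.ext {N : Type*} [AddCommGroup N] [Module F N] {f g : PolyMod F n V →ₗ[F] N}
    (h : ∀ p v, f (pureT p v) = g (pureT p v)) : f = g :=
  TensorProduct.ext' h

end PolyMod

variable {F : Type*} [Field F] [Algebra ℂ F] {r n : ℕ} [NeZero r] {V : Type*} [AddCommGroup V]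
  [Module F V] (ρ : Representation F (W r n) V) (κ c₀ : F) (d : ZMod r → F)

/-- Multiplication by `x_j` on `F[x] ⊗ V`. -/
def xOp (F : Type*) [Field F] {n : ℕ} (V : Type*) [AddCommGroup V] [Module F V] (j : Fin n) :
    Module.End F (PolyMod F n V) :=
  opMap (LinearMap.mulLeft F (MvPolynomial.X j)) 1

/-- The diagonal action of `G(r,1,n)` on `F[x] ⊗ V`. -/
def tOp : W r n →* Module.End F (PolyMod F n V) where
  toFun w := opMap (polyAct F w).toLinearMap (ρ w)
  map_one' := by
    refine PolyMod.ext fun p v => ?_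
    rw [opMap_pureT, polyAct_one, map_one]
    rfl
  map_mul' v w := by
    refine PolyMod.ext fun p u => ?_
    rw [opMap_pureT, polyAct_mul, map_mul]
    rfl

/-- The Dunkl operator attached to `y_i` on `F[x] ⊗ V`. -/
def yOp (i : Fin n) : Module.End F (PolyMod F n V) :=
  κ • opMap (qDeriv F i (0 : ZMod r)) 1 -
    ∑ l : ZMod r, diagCoeff d l • opMap (qDeriv F i l) (ρ (W.zeta i l)) -
    c₀ • ∑ j ∈ Finset.univ.filter (fun j => j ≠ i), ∑ l : ZMod r,
      opMap (divDiff F i j l) (ρ (W.refl i j l))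

omit [Algebra ℂ F] in
theorem xOp_pureT (j : Fin n) (p : MvPolynomial (Fin n) F) (v : V) :
    xOp F V j (pureT p v) = pureT (MvPolynomial.X j * p) v := rfl

theorem tOp_pureT (w : W r n) (p : MvPolynomial (Fin n) F) (v : V) :
    tOp ρ w (pureT p v) = pureT (polyAct F w p) (ρ w v) := rfl

theorem yOp_pureT (i : Fin n) (p : MvPolynomial (Fin n) F) (v : V) :
    yOp ρ κ c₀ d i (pureT p v) = κ • pureT (qDeriv F i (0 : ZMod r) p) v -
      ∑ l : ZMod r, diagCoeff d l • pureT (qDeriv F i l p) (ρ (W.zeta i l) v) -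
      c₀ • ∑ j ∈ Finset.univ.filter (fun j => j ≠ i), ∑ l : ZMod r,
        pureT (divDiff F i j l p) (ρ (W.refl i j l) v) := by
  simp only [yOp, LinearMap.sub_apply, LinearMap.smul_apply, LinearMap.sum_apply,
    opMap_pureT, Module.End.one_apply]

theorem yOp_pureT_one (i : Fin n) (v : V) : yOp ρ κ c₀ d i (pureT 1 v) = 0 := by
  rw [yOp_pureT]
  simp only [qDeriv_one, map_zero, LinearMap.zero_apply, smul_zero, Finset.sum_const_zero,
    sub_zero, zero_sub, neg_eq_zero]
  rw [Finset.sum_eq_zero, smul_zero]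
  intro j hj
  refine Finset.sum_eq_zero fun l _ => ?_
  rw [divDiff_one F (Finset.mem_filter.1 hj).2.symm, map_zero, LinearMap.zero_apply]

/-- The q-derivatives and the divided differences each satisfy a Leibniz rule with one correction
term in the action of W; these corrections add up to the bracket. -/
theorem yOp_mul_xOp (i k : Fin n) : yOp ρ κ c₀ d i * xOp F V k =
    xOp F V k * yOp ρ κ c₀ d i + bracket (tOp ρ) κ c₀ d i k := by
  refine PolyMod.ext fun p v => ?_
  rw [LinearMap.add_apply, Module.End.mul_apply, Module.End.mul_apply, xOp_pureT, yOp_pureT,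
    yOp_pureT]
  have hq (l : ZMod r) : pureT (qDeriv F i l (MvPolynomial.X k * p)) (ρ (W.zeta i l) v) =
      xOp F V k (pureT (qDeriv F i l p) (ρ (W.zeta i l) v)) +
        if i = k then tOp ρ (W.zeta i l) (pureT p v) else 0 := by
    rw [qDeriv_X_mul, map_add, LinearMap.add_apply, xOp_pureT, tOp_pureT]
    split_ifs
    · rfl
    · rw [map_zero, LinearMap.zero_apply]
  have hd (j : Fin n) (hj : j ∈ Finset.univ.filter (fun j => j ≠ i)) (l : ZMod r) :
      pureT (divDiff F i j l (MvPolynomial.X k * p)) (ρ (W.refl i j l) v) =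
        xOp F V k (pureT (divDiff F i j l p) (ρ (W.refl i j l) v)) +
          divDiffX F i j l k • tOp ρ (W.refl i j l) (pureT p v) := by
    rw [divDiff_X_mul F (Finset.mem_filter.1 hj).2.symm, map_add, LinearMap.add_apply, xOp_pureT,
      tOp_pureT, map_smul, LinearMap.smul_apply]
  have h0 := hq 0
  rw [W.zeta_zero, map_one, map_one, Module.End.one_apply, Module.End.one_apply] at h0
  rw [h0, Finset.sum_congr rfl fun l _ => congrArg (diagCoeff d l • ·) (hq l),
    Finset.sum_congr rfl fun j hj => Finset.sum_congr rfl fun l _ => hd j hj l]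
  simp only [map_sub, map_smul, map_sum, smul_add, Finset.sum_add_distrib]
  have hB : (bracket (A := Module.End F (PolyMod F n V)) (tOp ρ) κ c₀ d i k)
      (pureT p v) =
      (κ • (if i = k then pureT p v else 0) -
        ∑ l : ZMod r, diagCoeff d l • (if i = k then tOp ρ (W.zeta i l) (pureT p v) else 0)) -
      c₀ • ∑ j ∈ Finset.univ.filter (fun j => j ≠ i), ∑ l : ZMod r,
        divDiffX F i j l k • tOp ρ (W.refl i j l) (pureT p v) := by
    unfold bracket
    by_cases hik : i = k
    · subst hik
      simp only [if_true, bracketSelf, reflSum, divDiffX, one_smul, LinearMap.sub_apply,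
        LinearMap.smul_apply, LinearMap.sum_apply, Module.algebraMap_end_apply]
    -- For k ≠ i the form x_k is fixed by every reflection in i, j with j ≠ k, so only j = k
    -- contributes.
    · have hs : ∀ j ∈ Finset.univ.filter (fun j => j ≠ i), j ≠ k →
          ∑ l : ZMod r, divDiffX F i j l k • tOp ρ (W.refl i j l) (pureT p v) = 0 :=
        fun j _ hj => Finset.sum_eq_zero fun l _ => by
          rw [divDiffX, if_neg (Ne.symm hik), if_neg (Ne.symm hj), zero_smul]
      rw [Finset.sum_eq_single_of_mem k (by simpa using Ne.symm hik) hs]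
      simp only [if_neg hik, smul_zero, Finset.sum_const_zero, sub_zero, zero_sub, reflTwist,
        divDiffX, if_neg (Ne.symm hik), if_true, LinearMap.smul_apply, LinearMap.sum_apply,
        neg_smul, Finset.sum_neg_distrib, smul_neg, neg_neg]
  rw [hB]
  abel

omit [Algebra ℂ F] in
/-- An operator that kills `1 ⊗ V` and intertwines the multiplications by the `x_k` with some
operators is zero. -/
theorem eq_zero_of_intertwines (E : Module.End F (PolyMod F n V))
    (B : Fin n → Module.End F (PolyMod F n V)) (h1 : ∀ v : V, E (pureT 1 v) = 0)
    (h2 : ∀ k, E * xOp F V k = B k * E) : E = 0 := by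
  refine PolyMod.ext fun p v => ?_
  rw [LinearMap.zero_apply]
  induction p using MvPolynomial.induction_on with
  | C a =>
    rw [← MvPolynomial.algebraMap_eq, Algebra.algebraMap_eq_smul_one, map_smul, LinearMap.smul_apply, map_smul, h1, smul_zero]
  | add p q hp hq => rw [map_add, LinearMap.add_apply, map_add, hp, hq, add_zero]
  | mul_X p k hp =>
    rw [mul_comm, ← xOp_pureT, ← Module.End.mul_apply, h2, Module.End.mul_apply, hp, map_zero]

theorem tOp_mul_xOp (w : W r n) (j : Fin n) : tOp ρ w * xOp F V j =
    zetaPow F (-(w.left (w.right j)).toAdd) • (xOp F V (w.right j) * tOp ρ w) := by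
  refine PolyMod.ext fun p v => ?_
  rw [LinearMap.smul_apply, Module.End.mul_apply, Module.End.mul_apply, xOp_pureT, tOp_pureT,
    tOp_pureT, xOp_pureT, map_mul, polyAct_X, smul_mul_assoc, map_smul, LinearMap.smul_apply]

theorem tOp_mul_yOp (w : W r n) (j : Fin n) : tOp ρ w * yOp ρ κ c₀ d j =
    zetaPow F (w.left (w.right j)).toAdd • (yOp ρ κ c₀ d (w.right j) * tOp ρ w) := by
  rw [← sub_eq_zero]
  refine eq_zero_of_intertwines _
    (fun k => zetaPow F (-(w.left (w.right k)).toAdd) • xOp F V (w.right k)) (fun v => ?_)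
    fun k => ?_
  · rw [LinearMap.sub_apply, LinearMap.smul_apply, Module.End.mul_apply, Module.End.mul_apply,
      yOp_pureT_one, map_zero, tOp_pureT, map_one, yOp_pureT_one, smul_zero, sub_zero]
  · exact mul_y_sub_mul_x (A := Module.End F (PolyMod F n V)) (tOp ρ) κ c₀ d
      (tOp_mul_xOp ρ) (yOp_mul_xOp ρ κ c₀ d) w j k

theorem preCherednik_ops : PreCherednik (tOp ρ) κ c₀ d (xOp F V) (yOp ρ κ c₀ d) where
  x_comm i j := by
    refine PolyMod.ext fun p v => ?_
    rw [Module.End.mul_apply, Module.End.mul_apply, xOp_pureT, xOp_pureT, xOp_pureT, xOp_pureT,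
      mul_left_comm]
  t_x := tOp_mul_xOp ρ
  t_y := tOp_mul_yOp ρ κ c₀ d
  y_x := yOp_mul_xOp ρ κ c₀ d

/-- The operators on `F[x] ⊗ V` satisfy the relations of the rational Cherednik algebra. -/
theorem isCherednik_ops : IsCherednik (tOp ρ) κ c₀ d (xOp F V) (yOp ρ κ c₀ d) where
  toPreCherednik := preCherednik_ops ρ κ c₀ d
  y_comm i j := by
    rw [← sub_eq_zero]
    -- The commutator of two Dunkl operators commutes with all x_k and kills 1 ⊗ V.
    refine eq_zero_of_intertwines _ (xOp F V) (fun v => ?_)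
      ((preCherednik_ops ρ κ c₀ d).commutator_y_mul_x i j)
    rw [LinearMap.sub_apply, Module.End.mul_apply, Module.End.mul_apply, yOp_pureT_one,
      yOp_pureT_one, map_zero, map_zero, sub_zero]

end Representation

/-! ### The universal property of the rational Cherednik algebra -/

section Universal

variable {F : Type*} [Field F] [Algebra ℂ F] {r n : ℕ} [NeZero r] {A : Type*} [Ring A] [Algebra F A]
  {t : W r n →* A} {κ c₀ : F} {d : ZMod r → F}

/-- Interchanging the sums over j and l rewrites the idempotents e_{ij} in terms of the t_{ζ_i^l},
with coefficients `diagCoeff`. -/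
theorem map_bracketSelf_word (Φ : FreeAlgebra F (Gen r n) →ₐ[F] A)
    (hΦ : ∀ w, Φ (G F w) = t w) (i : Fin n) :
    Φ (algebraMap F _ κ - ∑ j : ZMod r, (d j - d (j - 1)) • idem F i j -
      c₀ • ∑ j ∈ Finset.univ.filter (fun j => j ≠ i), ∑ l : ZMod r, G F (W.refl i j l)) =
      bracketSelf t κ c₀ d i := by
  have hidem : ∑ j : ZMod r, (d j - d (j - 1)) • Φ (idem F i j) =
      ∑ l : ZMod r, diagCoeff d l • t (W.zeta i l) := by
    simp only [idem, map_smul, map_sum, hΦ, Finset.smul_sum, smul_smul, diagCoeff, Finset.sum_smul]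
    exact Finset.sum_comm
  simp only [map_sub, map_sum, map_smul, AlgHom.commutes, hidem, hΦ, bracketSelf, reflSum]

/-- The homomorphism from the rational Cherednik algebra given by elements that satisfy its
relations. -/
def IsCherednik.lift {x y : Fin n → A} (h : IsCherednik t κ c₀ d x y) :
    Cherednik n κ c₀ d →ₐ[F] A :=
  RingQuot.liftAlgHom F ⟨FreeAlgebra.lift F fun g => match g with
    | Gen.x i => x i
    | Gen.y i => y i
    | Gen.t w => t w, by
    intro a b hab
    cases hab with
    | x_comm i j => simpa using h.x_comm i j
    | y_comm i j => simpa using h.y_comm i j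
    | t_one => simp
    | t_mul v w => simp
    | t_x w j => simpa using h.t_x w j
    | t_y w j => simpa using h.t_y w j
    | y_x_ne i j hij =>
      have := h.y_x i j
      rw [bracket, if_neg hij] at this
      simpa [reflTwist] using this
    | y_x_self i =>
      have := h.y_x i i
      rw [bracket, if_pos rfl, ← map_bracketSelf_word (t := t) (FreeAlgebra.lift F fun g =>
        match g with
        | Gen.x i => x i
        | Gen.y i => y i
        | Gen.t w => t w) (fun w => FreeAlgebra.lift_ι_apply _ _) i] at this
      rw [add_sub_assoc, add_sub_assoc, map_add, map_mul, map_mul, FreeAlgebra.lift_ι_apply, FreeAlgebra.lift_ι_apply]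
      exact this⟩

theorem IsCherednik.lift_hmk {x y : Fin n → A} (h : IsCherednik t κ c₀ d x y)
    (a : FreeAlgebra F (Gen r n)) : h.lift (hmk κ c₀ d a) = FreeAlgebra.lift F (fun g =>
      match g with
      | Gen.x i => x i
      | Gen.y i => y i
      | Gen.t w => t w) a :=
  RingQuot.liftAlgHom_mkAlgHom_apply F _ _ a

theorem IsCherednik.lift_hx {x y : Fin n → A} (h : IsCherednik t κ c₀ d x y) (i : Fin n) :
    h.lift (hx κ c₀ d i) = x i :=
  (h.lift_hmk _).trans (FreeAlgebra.lift_ι_apply _ _)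

theorem IsCherednik.lift_hy {x y : Fin n → A} (h : IsCherednik t κ c₀ d x y) (i : Fin n) :
    h.lift (hy κ c₀ d i) = y i :=
  (h.lift_hmk _).trans (FreeAlgebra.lift_ι_apply _ _)

theorem IsCherednik.lift_ht {x y : Fin n → A} (h : IsCherednik t κ c₀ d x y) (w : W r n) :
    h.lift (ht κ c₀ d w) = t w :=
  (h.lift_hmk _).trans (FreeAlgebra.lift_ι_apply _ _)

variable (κ c₀ d)

theorem hmk_eq_of_rel {a b : FreeAlgebra F (Gen r n)} (h : CherednikRel κ c₀ d a b) :
    hmk κ c₀ d a = hmk κ c₀ d b :=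
  RingQuot.mkAlgHom_rel F h

theorem hmk_surjective : Function.Surjective (hmk (n := n) κ c₀ d) :=
  RingQuot.mkAlgHom_surjective F _

/-- The elements `t_w` of the rational Cherednik algebra, as a homomorphism. -/
def htHom : W r n →* Cherednik n κ c₀ d where
  toFun := ht κ c₀ d
  map_one' := (hmk_eq_of_rel κ c₀ d CherednikRel.t_one).trans (map_one _)
  map_mul' v w := (hmk_eq_of_rel κ c₀ d (CherednikRel.t_mul v w)).trans (map_mul _ _ _)

theorem htHom_apply (w : W r n) : htHom κ c₀ d w = ht κ c₀ d w := rfl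

theorem isCherednik_gens :
    IsCherednik (htHom (n := n) κ c₀ d) κ c₀ d (hx κ c₀ d) (hy κ c₀ d) where
  x_comm i j := by
    have := hmk_eq_of_rel κ c₀ d (CherednikRel.x_comm i j)
    rw [map_mul, map_mul] at this
    exact this
  y_comm i j := by
    have := hmk_eq_of_rel κ c₀ d (CherednikRel.y_comm i j)
    rw [map_mul, map_mul] at this
    exact this
  t_x w j := by
    have := hmk_eq_of_rel κ c₀ d (CherednikRel.t_x w j)
    rw [map_mul, map_smul, map_mul] at this
    exact this
  t_y w j := by
    have := hmk_eq_of_rel κ c₀ d (CherednikRel.t_y w j)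
    rw [map_mul, map_smul, map_mul] at this
    exact this
  y_x i j := by
    by_cases hij : i = j
    · subst hij
      have := hmk_eq_of_rel κ c₀ d (CherednikRel.y_x_self i)
      rw [add_sub_assoc, add_sub_assoc, map_add, map_mul, map_mul, map_bracketSelf_word (t := htHom κ c₀ d) _ (fun _ => rfl)] at this
      rw [bracket, if_pos rfl]
      exact this
    · have := hmk_eq_of_rel κ c₀ d (CherednikRel.y_x_ne i j hij)
      rw [bracket, if_neg hij]
      simp only [map_mul, map_add, map_smul, map_sum] at this
      exact this

open scoped IsMulCommutative in
-- Evaluation of polynomials needs a commutative target, so it passes through the subalgebra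
-- generated by the x_i.
theorem exists_polyHom : ∃ φ : MvPolynomial (Fin n) F →ₐ[F] Cherednik n κ c₀ d,
    ∀ i, φ (MvPolynomial.X i) = hx κ c₀ d i := by
  have hcomm : ∀ a ∈ Set.range (hx (n := n) κ c₀ d), ∀ b ∈ Set.range (hx (n := n) κ c₀ d),
      a * b = b * a := by
    rintro _ ⟨i, rfl⟩ _ ⟨j, rfl⟩
    exact (isCherednik_gens κ c₀ d).x_comm i j
  have := Algebra.isMulCommutative_adjoin F hcomm
  let f : MvPolynomial (Fin n) F →ₐ[F] Algebra.adjoin F (Set.range (hx (n := n) κ c₀ d)) :=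
    MvPolynomial.aeval (S₁ := Algebra.adjoin F (Set.range (hx (n := n) κ c₀ d))) fun i => ⟨hx κ c₀ d i, Algebra.subset_adjoin ⟨i, rfl⟩⟩
  refine ⟨(Subalgebra.val _).comp f, fun i => ?_⟩
  rw [AlgHom.comp_apply, MvPolynomial.aeval_X]
  rfl

/-- The homomorphism `F[x_1, …, x_n] → ℍ`. -/
def polyHom : MvPolynomial (Fin n) F →ₐ[F] Cherednik n κ c₀ d :=
  (exists_polyHom κ c₀ d).choose

theorem polyHom_X (i : Fin n) : polyHom κ c₀ d (MvPolynomial.X i) = hx κ c₀ d i :=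
  (exists_polyHom κ c₀ d).choose_spec i

/-- The exponent vector of a monomial. -/
def expo (μ : Fin n → ℕ) : Fin n →₀ ℕ := Finsupp.equivFunOnFinite.symm μ

theorem xMonomial_eq (μ : Fin n → ℕ) :
    xMonomial κ c₀ d μ = polyHom κ c₀ d (MvPolynomial.monomial (expo μ) 1) := by
  rw [MvPolynomial.monomial_eq, map_one, one_mul, Finsupp.prod_fintype _ _ (by simp),
    ← List.prod_ofFn, map_list_prod, List.map_ofFn, xMonomial]
  congr 2
  funext i
  simp [polyHom_X, expo]

theorem ht_mul_polyHom (w : W r n) (p : MvPolynomial (Fin n) F) :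
    ht κ c₀ d w * polyHom κ c₀ d p = polyHom κ c₀ d (polyAct F w p) * ht κ c₀ d w := by
  induction p using MvPolynomial.induction_on with
  | C a =>
    rw [← MvPolynomial.algebraMap_eq, AlgHom.commutes, AlgHom.commutes, AlgHom.commutes,
      Algebra.commutes]
  | add p q hp hq => rw [map_add, mul_add, hp, hq, map_add, map_add, add_mul]
  | mul_X p k hp =>
    have := (isCherednik_gens (n := n) κ c₀ d).t_x w k
    rw [htHom_apply] at this
    rw [map_mul, ← mul_assoc, hp, mul_assoc, polyHom_X, this, map_mul, map_mul, polyAct_X,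
      map_smul, polyHom_X, mul_smul_comm, mul_smul_comm, smul_mul_assoc, mul_assoc]

end Universal

/-! ### The standard module -/

section Verma

variable {F : Type*} [Field F] [Algebra ℂ F] {r n : ℕ} [NeZero r]
  (κ c₀ : F) (d : ZMod r → F) (lam : RPartition r n)

/-- The representation of `G(r,1,n)` on `S^λ`. -/
def spechtRep (F : Type*) [Field F] [Algebra ℂ F] (lam : RPartition r n) :
    Representation F (W r n) (Specht F lam) where
  toFun w :=
    { toFun := fun v => MonoidAlgebra.of F (W r n) w • v
      map_add' := fun _ _ => smul_add _ _ _
      map_smul' := fun c v => smul_comm _ c v }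
  map_one' := LinearMap.ext fun v => by
    change MonoidAlgebra.of F (W r n) 1 • v = v
    rw [map_one, one_smul]
  map_mul' v w := LinearMap.ext fun u => by
    change MonoidAlgebra.of F (W r n) (v * w) • u =
      MonoidAlgebra.of F (W r n) v • MonoidAlgebra.of F (W r n) w • u
    rw [map_mul, mul_smul]

theorem spechtRep_apply (w : W r n) (v : Specht F lam) :
    spechtRep F lam w v = MonoidAlgebra.of F (W r n) w • v := rfl

/-- The element of `M(λ)` represented by `h ⊗ v`. -/
def vermaMk : Cherednik n κ c₀ d →ₗ[F] Specht F lam →ₗ[F] Verma κ c₀ d lam :=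
  LinearMap.mk₂ F (fun h v => Submodule.Quotient.mk (h ⊗ₜ v))
    (fun h h' v => by rw [TensorProduct.add_tmul, Submodule.Quotient.mk_add])
    (fun c h v => by rw [← TensorProduct.smul_tmul', Submodule.Quotient.mk_smul])
    (fun h v v' => by rw [TensorProduct.tmul_add, Submodule.Quotient.mk_add])
    (fun c h v => by rw [TensorProduct.tmul_smul, Submodule.Quotient.mk_smul])

variable {lam}

theorem smul_vermaMk (g h : Cherednik n κ c₀ d) (v : Specht F lam) :
    g • vermaMk κ c₀ d lam h v = vermaMk κ c₀ d lam (g * h) v := rfl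

theorem vermaMk_mul_ht (h : Cherednik n κ c₀ d) (w : W r n) (v : Specht F lam) :
    vermaMk κ c₀ d lam (h * ht κ c₀ d w) v = vermaMk κ c₀ d lam h (spechtRep F lam w v) := by
  have : (h * ht κ c₀ d w) ⊗ₜ[F] v - h ⊗ₜ[F] (MonoidAlgebra.of F (W r n) w • v) ∈
      Submodule.span (Cherednik n κ c₀ d) {p | VermaRel κ c₀ d lam p} :=
    Submodule.subset_span (VermaRel.t h w v)
  rw [← Submodule.Quotient.mk_eq_zero, Submodule.Quotient.mk_sub, sub_eq_zero] at this
  exact this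

theorem vermaMk_mul_hy (h : Cherednik n κ c₀ d) (i : Fin n) (v : Specht F lam) :
    vermaMk κ c₀ d lam (h * hy κ c₀ d i) v = 0 := by
  have : (h * hy κ c₀ d i) ⊗ₜ[F] v ∈
      Submodule.span (Cherednik n κ c₀ d) {p | VermaRel κ c₀ d lam p} :=
    Submodule.subset_span (VermaRel.y h i v)
  rwa [← Submodule.Quotient.mk_eq_zero] at this

variable (lam) in
/-- The element `p v` of `M(λ)`, for a polynomial `p` and `v ∈ S^λ`. -/
def polyVec : MvPolynomial (Fin n) F →ₗ[F] Specht F lam →ₗ[F] Verma κ c₀ d lam :=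
  vermaMk κ c₀ d lam ∘ₗ (polyHom κ c₀ d).toLinearMap

theorem polyVec_apply (p : MvPolynomial (Fin n) F) (v : Specht F lam) :
    polyVec κ c₀ d lam p v = vermaMk κ c₀ d lam (polyHom κ c₀ d p) v := rfl

theorem vermaVec_eq (μ : Fin n → ℕ) (T : SYT lam) :
    vermaVec κ c₀ d lam μ T = polyVec κ c₀ d lam (MvPolynomial.monomial (expo μ) 1)
      (spechtRep F lam (W.perm r (wPerm μ)⁻¹) (spechtVec F lam T)) := by
  rw [polyVec_apply, ← xMonomial_eq]
  rfl

theorem hx_smul_polyVec (i : Fin n) (p : MvPolynomial (Fin n) F) (v : Specht F lam) :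
    hx κ c₀ d i • polyVec κ c₀ d lam p v = polyVec κ c₀ d lam (MvPolynomial.X i * p) v := by
  rw [polyVec_apply, smul_vermaMk, polyVec_apply, map_mul (polyHom κ c₀ d), polyHom_X]

theorem ht_smul_polyVec (w : W r n) (p : MvPolynomial (Fin n) F) (v : Specht F lam) :
    ht κ c₀ d w • polyVec κ c₀ d lam p v =
      polyVec κ c₀ d lam (polyAct F w p) (spechtRep F lam w v) := by
  rw [polyVec_apply, smul_vermaMk, ht_mul_polyHom, vermaMk_mul_ht, polyVec_apply]

variable (lam) in
/-- The span of the elements `p v`. -/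
def polySpan : Submodule F (Verma κ c₀ d lam) :=
  Submodule.span F {m | ∃ p v, m = polyVec κ c₀ d lam p v}

theorem polyVec_mem_polySpan (p : MvPolynomial (Fin n) F) (v : Specht F lam) :
    polyVec κ c₀ d lam p v ∈ polySpan κ c₀ d lam := Submodule.subset_span ⟨p, v, rfl⟩

theorem bracket_smul_mem (N : Submodule F (Verma κ c₀ d lam)) {m : Verma κ c₀ d lam}
    (hm : m ∈ N) (hN : ∀ w : W r n, ht κ c₀ d w • m ∈ N) (i j : Fin n) :
    bracket (htHom (n := n) κ c₀ d) κ c₀ d i j • m ∈ N := by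
  unfold bracket
  split_ifs
  · rw [bracketSelf, sub_smul, sub_smul, algebraMap_smul, smul_assoc, Finset.sum_smul,
      Finset.sum_smul]
    refine N.sub_mem (N.sub_mem (N.smul_mem _ hm) (N.sum_mem fun l _ => ?_))
      (N.smul_mem _ (N.sum_mem fun k _ => ?_))
    · rw [smul_assoc]
      exact N.smul_mem _ (hN _)
    · rw [reflSum, Finset.sum_smul]
      exact N.sum_mem fun l _ => hN _
  · rw [reflTwist, smul_assoc, Finset.sum_smul]
    refine N.smul_mem _ (N.sum_mem fun l _ => ?_)
    rw [smul_assoc]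
    exact N.smul_mem _ (hN _)

theorem ht_smul_mem_polySpan (w : W r n) (p : MvPolynomial (Fin n) F) (v : Specht F lam) :
    ht κ c₀ d w • polyVec κ c₀ d lam p v ∈ polySpan κ c₀ d lam := by
  rw [ht_smul_polyVec]
  exact polyVec_mem_polySpan κ c₀ d _ _

/-- Moving y_i to the right past each x_k costs a bracket, which lies in the span of the t_w; at the
end y_i kills S^λ. -/
theorem hy_smul_polyVec_mem (i : Fin n) (p : MvPolynomial (Fin n) F) (v : Specht F lam) :
    hy κ c₀ d i • polyVec κ c₀ d lam p v ∈ polySpan κ c₀ d lam := by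
  induction p using MvPolynomial.induction_on with
  | C a =>
    rw [polyVec_apply, smul_vermaMk, ← MvPolynomial.algebraMap_eq, AlgHom.commutes,
      ← Algebra.commutes, vermaMk_mul_hy]
    exact Submodule.zero_mem _
  | add p q hp hq =>
    rw [map_add, LinearMap.add_apply, smul_add]
    exact Submodule.add_mem _ hp hq
  | mul_X p k hp =>
    rw [mul_comm, ← hx_smul_polyVec, ← mul_smul, (isCherednik_gens κ c₀ d).y_x, add_smul, mul_smul]
    refine Submodule.add_mem _ ?_ (bracket_smul_mem κ c₀ d _ (polyVec_mem_polySpan κ c₀ d p v)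
      (fun w => ht_smul_mem_polySpan κ c₀ d w p v) _ _)
    generalize hy κ c₀ d i • polyVec κ c₀ d lam p v = m at hp
    induction hp using Submodule.span_induction with
    | mem m hm =>
      obtain ⟨q, u, rfl⟩ := hm
      rw [hx_smul_polyVec]
      exact polyVec_mem_polySpan κ c₀ d _ _
    | zero => rw [smul_zero]; exact Submodule.zero_mem _
    | add a b _ _ ha hb => rw [smul_add]; exact Submodule.add_mem _ ha hb
    | smul c a _ ha => rw [smul_comm]; exact Submodule.smul_mem _ c ha

/-- The span is stable under all generators of ℍ and contains 1 ⊗ S^λ, which generates M(λ). This is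
the spanning half of the PBW theorem. -/
theorem polySpan_eq_top : polySpan κ c₀ d lam = ⊤ := by
  have hgen (a : FreeAlgebra F (Gen r n)) : ∀ m ∈ polySpan κ c₀ d lam,
      hmk κ c₀ d a • m ∈ polySpan κ c₀ d lam := by
    induction a using FreeAlgebra.induction with
    | grade0 c =>
      intro m hm
      rw [AlgHom.commutes, algebraMap_smul]
      exact Submodule.smul_mem _ c hm
    | grade1 g =>
      intro m hm
      induction hm using Submodule.span_induction with
      | mem m hm =>
        obtain ⟨q, u, rfl⟩ := hm
        cases g with
        | x i =>
          exact (hx_smul_polyVec κ c₀ d i q u).symm ▸ polyVec_mem_polySpan κ c₀ d _ _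
        | y i => exact hy_smul_polyVec_mem κ c₀ d i q u
        | t w => exact ht_smul_mem_polySpan κ c₀ d w q u
      | zero => rw [smul_zero]; exact Submodule.zero_mem _
      | add a b _ _ ha hb => rw [smul_add]; exact Submodule.add_mem _ ha hb
      | smul c a _ ha => rw [smul_comm]; exact Submodule.smul_mem _ c ha
    | mul a b ha hb =>
      intro m hm
      rw [map_mul, mul_smul]
      exact ha _ (hb _ hm)
    | add a b ha hb =>
      intro m hm
      rw [map_add, add_smul]
      exact Submodule.add_mem _ (ha _ hm) (hb _ hm)
  rw [eq_top_iff]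
  rintro m -
  obtain ⟨u, rfl⟩ := Submodule.Quotient.mk_surjective _ m
  induction u using TensorProduct.induction_on with
  | zero => exact Submodule.zero_mem _
  | add a b ha hb => rw [Submodule.Quotient.mk_add]; exact Submodule.add_mem _ ha hb
  | tmul h v =>
    obtain ⟨a, rfl⟩ := hmk_surjective κ c₀ d h
    have := hgen a _ (polyVec_mem_polySpan κ c₀ d (1 : MvPolynomial (Fin n) F) v)
    rw [polyVec_apply, smul_vermaMk, map_one, mul_one] at this
    exact this

end Verma

/-! ### The identification of M(λ) with F[x] ⊗ S^λ, and its basis -/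

section VermaBasis

variable {F : Type*} [Field F] [Algebra ℂ F] {r n : ℕ} [NeZero r]
  (κ c₀ : F) (d : ZMod r → F) (lam : RPartition r n)

/-- The action of the rational Cherednik algebra on `F[x] ⊗ S^λ` by Dunkl operators. -/
def dunklRep : Cherednik n κ c₀ d →ₐ[F] Module.End F (PolyMod F n (Specht F lam)) :=
  (isCherednik_ops (spechtRep F lam) κ c₀ d).lift

/-- The map `ℍ ⊗ S^λ → F[x] ⊗ S^λ`, `h ⊗ v ↦ h.(1 ⊗ v)`. -/
def tensorToPoly : Cherednik n κ c₀ d ⊗[F] Specht F lam →ₗ[F] PolyMod F n (Specht F lam) :=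
  TensorProduct.lift (LinearMap.mk₂ F (fun h v => dunklRep κ c₀ d lam h (pureT 1 v))
    (fun h h' v => by rw [map_add, LinearMap.add_apply])
    (fun c h v => by rw [map_smul, LinearMap.smul_apply])
    (fun h v v' => by rw [map_add, map_add])
    (fun c h v => by rw [map_smul, map_smul]))

variable {lam}

theorem tensorToPoly_tmul (h : Cherednik n κ c₀ d) (v : Specht F lam) :
    tensorToPoly κ c₀ d lam (h ⊗ₜ v) = dunklRep κ c₀ d lam h (pureT 1 v) := rfl

theorem tensorToPoly_smul (h : Cherednik n κ c₀ d) (u : Cherednik n κ c₀ d ⊗[F] Specht F lam) :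
    tensorToPoly κ c₀ d lam (h • u) = dunklRep κ c₀ d lam h (tensorToPoly κ c₀ d lam u) := by
  induction u using TensorProduct.induction_on with
  | zero => rw [smul_zero, map_zero, map_zero]
  | add a b ha hb => rw [smul_add, map_add, map_add, ha, hb, map_add]
  | tmul g v =>
    rw [TensorProduct.smul_tmul', tensorToPoly_tmul, smul_eq_mul, map_mul, tensorToPoly_tmul]
    rfl

theorem tensorToPoly_of_vermaRel {p : Cherednik n κ c₀ d ⊗[F] Specht F lam}
    (hp : VermaRel κ c₀ d lam p) : tensorToPoly κ c₀ d lam p = 0 := by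
  cases hp with
  | t h w v =>
    rw [map_sub, tensorToPoly_tmul, tensorToPoly_tmul, map_mul, Module.End.mul_apply, dunklRep,
      IsCherednik.lift_ht, tOp_pureT, map_one, spechtRep_apply, sub_self]
  | y h i v =>
    rw [tensorToPoly_tmul, map_mul, Module.End.mul_apply, dunklRep, IsCherednik.lift_hy,
      yOp_pureT_one, map_zero]

theorem span_vermaRel_le : (Submodule.span (Cherednik n κ c₀ d)
    {p | VermaRel κ c₀ d lam p}).restrictScalars F ≤ LinearMap.ker (tensorToPoly κ c₀ d lam) := by
  intro u hu
  rw [Submodule.restrictScalars_mem] at hu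
  rw [LinearMap.mem_ker]
  induction hu using Submodule.span_induction with
  | mem p hp => exact tensorToPoly_of_vermaRel κ c₀ d hp
  | zero => rw [map_zero]
  | add a b _ _ ha hb => rw [map_add, ha, hb, add_zero]
  | smul h a _ ha => rw [tensorToPoly_smul, ha, map_zero]

variable (lam) in
/-- The comparison map `M(λ) → F[x] ⊗ S^λ`. -/
def vermaToPoly : Verma κ c₀ d lam →ₗ[F] PolyMod F n (Specht F lam) :=
  (Submodule.liftQ _ (tensorToPoly κ c₀ d lam) (span_vermaRel_le κ c₀ d)) ∘ₗ
    (Submodule.Quotient.restrictScalarsEquiv F (Submodule.span (Cherednik n κ c₀ d)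
      {p | VermaRel κ c₀ d lam p})).symm.toLinearMap

theorem vermaToPoly_mk (u : Cherednik n κ c₀ d ⊗[F] Specht F lam) :
    vermaToPoly κ c₀ d lam (Submodule.Quotient.mk u) = tensorToPoly κ c₀ d lam u := rfl

theorem vermaToPoly_smul (h : Cherednik n κ c₀ d) (m : Verma κ c₀ d lam) :
    vermaToPoly κ c₀ d lam (h • m) = dunklRep κ c₀ d lam h (vermaToPoly κ c₀ d lam m) := by
  obtain ⟨u, rfl⟩ := Submodule.Quotient.mk_surjective _ m
  rw [← Submodule.Quotient.mk_smul, vermaToPoly_mk, vermaToPoly_mk, tensorToPoly_smul]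

/-- The independence half of PBW: relations among the elements p v can be tested in F[x] ⊗ S^λ. -/
theorem vermaToPoly_polyVec (p : MvPolynomial (Fin n) F) (v : Specht F lam) :
    vermaToPoly κ c₀ d lam (polyVec κ c₀ d lam p v) = pureT p v := by
  induction p using MvPolynomial.induction_on with
  | C a =>
    rw [← MvPolynomial.algebraMap_eq, Algebra.algebraMap_eq_smul_one, map_smul, map_smul,
      LinearMap.smul_apply, LinearMap.smul_apply, map_smul, polyVec_apply, map_one]
    congr 1
    refine (vermaToPoly_mk κ c₀ d _).trans ?_
    rw [tensorToPoly_tmul, map_one, Module.End.one_apply]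
  | add p q hp hq =>
    rw [map_add, map_add, LinearMap.add_apply, LinearMap.add_apply, map_add, hp, hq]
  | mul_X p k hp =>
    rw [mul_comm, ← hx_smul_polyVec, vermaToPoly_smul, hp, dunklRep, IsCherednik.lift_hx,
      xOp_pureT]

variable (lam) in
/-- The comparison map `F[x] ⊗ S^λ → M(λ)`. -/
def polyToVerma : PolyMod F n (Specht F lam) →ₗ[F] Verma κ c₀ d lam :=
  TensorProduct.lift (polyVec κ c₀ d lam)

theorem polyToVerma_pureT (p : MvPolynomial (Fin n) F) (v : Specht F lam) :
    polyToVerma κ c₀ d lam (pureT p v) = polyVec κ c₀ d lam p v := rfl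

theorem polyToVerma_vermaToPoly (m : Verma κ c₀ d lam) :
    polyToVerma κ c₀ d lam (vermaToPoly κ c₀ d lam m) = m := by
  have hm : m ∈ polySpan κ c₀ d lam := polySpan_eq_top κ c₀ d ▸ Submodule.mem_top
  induction hm using Submodule.span_induction with
  | mem m hm =>
    obtain ⟨p, v, rfl⟩ := hm
    rw [vermaToPoly_polyVec, polyToVerma_pureT]
  | zero => rw [map_zero, map_zero]
  | add a b _ _ ha hb => rw [map_add, map_add, ha, hb]
  | smul c a _ ha => rw [map_smul, map_smul, ha]

/-- The action of `y_i` on `M(λ)` is given by Dunkl operators. -/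
theorem hy_smul_polyVec (i : Fin n) (p : MvPolynomial (Fin n) F) (v : Specht F lam) :
    hy κ c₀ d i • polyVec κ c₀ d lam p v =
      κ • polyVec κ c₀ d lam (qDeriv F i (0 : ZMod r) p) v -
      ∑ l : ZMod r, diagCoeff d l •
        polyVec κ c₀ d lam (qDeriv F i l p) (spechtRep F lam (W.zeta i l) v) -
      c₀ • ∑ j ∈ Finset.univ.filter (fun j => j ≠ i), ∑ l : ZMod r,
        polyVec κ c₀ d lam (divDiff F i j l p) (spechtRep F lam (W.refl i j l) v) := by
  rw [← polyToVerma_vermaToPoly κ c₀ d (hy κ c₀ d i • _), vermaToPoly_smul, vermaToPoly_polyVec,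
    dunklRep, IsCherednik.lift_hy, yOp_pureT]
  simp only [map_sub, map_smul, map_sum, polyToVerma_pureT]

/-- The coefficient of the monomial with exponent `m`. -/
def polyCoeff (F : Type*) [Field F] {n : ℕ} (V : Type*) [AddCommGroup V] [Module F V]
    (m : Fin n →₀ ℕ) : PolyMod F n V →ₗ[F] V :=
  TensorProduct.lift (LinearMap.lsmul F V ∘ₗ MvPolynomial.lcoeff F m)

theorem polyCoeff_pureT {F : Type*} [Field F] {n : ℕ} {V : Type*} [AddCommGroup V] [Module F V]
    (m : Fin n →₀ ℕ) (p : MvPolynomial (Fin n) F) (v : V) :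
    polyCoeff F V m (pureT p v) = p.coeff m • v := rfl

theorem expo_injective : Function.Injective (expo (n := n)) :=
  Finsupp.equivFunOnFinite.symm.injective

theorem polyVec_mem_span_vermaVec (μ : Fin n → ℕ) (v : Specht F lam) :
    polyVec κ c₀ d lam (MvPolynomial.monomial (expo μ) 1) v ∈
      Submodule.span F (Set.range (vermaVec κ c₀ d lam μ)) := by
  have h : ∀ u : Specht F lam, polyVec κ c₀ d lam (MvPolynomial.monomial (expo μ) 1)
      (spechtRep F lam (W.perm r (wPerm μ)⁻¹) u) ∈
      Submodule.span F (Set.range (vermaVec κ c₀ d lam μ)) := by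
    intro u
    have hu : u ∈ Submodule.span F (Set.range (spechtVec F lam)) :=
      span_spechtVec F (lam := lam) ▸ Submodule.mem_top
    induction hu using Submodule.span_induction with
    | mem u hu =>
      obtain ⟨T, rfl⟩ := hu
      exact Submodule.subset_span ⟨T, vermaVec_eq κ c₀ d μ T⟩
    | zero => rw [map_zero, map_zero]; exact Submodule.zero_mem _
    | add a b _ _ ha hb => rw [map_add, map_add]; exact Submodule.add_mem _ ha hb
    | smul c a _ ha => rw [map_smul, map_smul]; exact Submodule.smul_mem _ c ha
  have := h (spechtRep F lam (W.perm r (wPerm μ)) v)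
  rwa [← Module.End.mul_apply, ← map_mul, ← W.perm_mul, inv_mul_cancel,
    show W.perm r (1 : Equiv.Perm (Fin n)) = 1 from map_one _, map_one (spechtRep F lam),
    Module.End.one_apply] at this

theorem span_vermaVec : Submodule.span F
    (Set.range fun p : (Fin n → ℕ) × SYT lam => vermaVec κ c₀ d lam p.1 p.2) = ⊤ := by
  rw [eq_top_iff, ← polySpan_eq_top, polySpan, Submodule.span_le]
  rintro _ ⟨p, v, rfl⟩
  rw [SetLike.mem_coe]
  induction p using MvPolynomial.induction_on' with
  | monomial m c =>
    rw [show MvPolynomial.monomial m c = c • MvPolynomial.monomial m (1 : F) by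
      rw [MvPolynomial.smul_monomial, smul_eq_mul, mul_one], map_smul, LinearMap.smul_apply]
    refine Submodule.smul_mem _ _ ?_
    obtain ⟨μ, rfl⟩ : ∃ μ, m = expo μ := ⟨m, (Finsupp.equivFunOnFinite.symm_apply_apply m).symm⟩
    refine Submodule.span_mono ?_ (polyVec_mem_span_vermaVec κ c₀ d μ v)
    rintro _ ⟨T, rfl⟩
    exact ⟨(μ, T), rfl⟩
  | add p q hp hq =>
    rw [map_add, LinearMap.add_apply]
    exact Submodule.add_mem _ hp hq

/-- The coefficient of x^ν in a relation, multiplied by t_{w_ν} to undo the twist, is a relation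
among the v_T. -/
theorem linearIndependent_vermaVec : LinearIndependent F
    (fun p : (Fin n → ℕ) × SYT lam => vermaVec κ c₀ d lam p.1 p.2) := by
  classical
  rw [linearIndependent_iff']
  rintro s c hc ⟨ν, T⟩ hT
  have h1 := congrArg (fun m => spechtRep F lam (W.perm r (wPerm ν))
    (polyCoeff F (Specht F lam) (expo ν) (vermaToPoly κ c₀ d lam m))) hc
  simp only [map_sum, map_smul, map_zero, vermaVec_eq, vermaToPoly_polyVec, polyCoeff_pureT,
    MvPolynomial.coeff_monomial, expo_injective.eq_iff] at h1
  have h2 : ∀ p ∈ s, (c p • (if p.1 = ν then (1 : F) else 0) •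
      spechtRep F lam (W.perm r (wPerm ν)) (spechtRep F lam (W.perm r (wPerm p.1)⁻¹)
        (spechtVec F lam p.2))) = if p.1 = ν then c p • spechtVec F lam p.2 else 0 := by
    intro p _
    split_ifs with hp
    · rw [hp, one_smul, ← Module.End.mul_apply, ← map_mul, ← W.perm_mul, mul_inv_cancel,
        show W.perm r (1 : Equiv.Perm (Fin n)) = 1 from map_one _, map_one, Module.End.one_apply]
    · rw [zero_smul, smul_zero]
  rw [Finset.sum_congr rfl h2, ← Finset.sum_filter] at h1
  have h3 : ∑ S ∈ (s.filter fun p => p.1 = ν).image Prod.snd, c (ν, S) • spechtVec F lam S = 0 := by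
    rw [Finset.sum_image, ← h1]
    · refine Finset.sum_congr rfl fun p hp => ?_
      rw [← (Finset.mem_filter.1 hp).2]
    · rintro ⟨a, S⟩ ha ⟨b, S'⟩ hb h
      have ha' := (Finset.mem_filter.1 ha).2
      have hb' := (Finset.mem_filter.1 hb).2
      simp only at ha' hb' h
      rw [ha', hb', h]
  exact linearIndependent_iff'.1 (linearIndependent_spechtVec F) _ (fun S => c (ν, S)) h3 T
    (Finset.mem_image.2 ⟨(ν, T), Finset.mem_filter.2 ⟨hT, rfl⟩, rfl⟩)

end VermaBasis

/-! ### Divided differences of monomials -/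

section Monomials

variable (F : Type*) [Field F] [Algebra ℂ F] {r n : ℕ} [NeZero r]

/-- The span of the monomials `x ^ ν` with `ν < μ`. -/
def lowerPoly (F : Type*) [Field F] {n : ℕ} (μ : Fin n → ℕ) : Submodule F (MvPolynomial (Fin n) F) :=
  Submodule.span F {p | ∃ ν, CompLT ν μ ∧ p = MvPolynomial.monomial (expo ν) 1}

/-- The part of the monomial `x ^ μ` that does not involve `x_i` and `x_j`. -/
def restMono (F : Type*) [Field F] {n : ℕ} (μ : Fin n → ℕ) (i j : Fin n) :
    MvPolynomial (Fin n) F :=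
  ∏ k ∈ ({i, j} : Finset (Fin n))ᶜ, MvPolynomial.X k ^ μ k

omit [Algebra ℂ F] in
theorem monomial_expo {i j : Fin n} (hij : i ≠ j) (μ ν : Fin n → ℕ)
    (h : ∀ k, k ≠ i → k ≠ j → ν k = μ k) :
    MvPolynomial.monomial (expo ν) (1 : F) =
      MvPolynomial.X i ^ ν i * MvPolynomial.X j ^ ν j * restMono F μ i j := by
  rw [MvPolynomial.monomial_eq, map_one, one_mul, Finsupp.prod_fintype _ _ (by simp),
    ← Finset.prod_mul_prod_compl {i, j}, Finset.prod_pair hij]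
  congr 1
  refine Finset.prod_congr rfl fun k hk => ?_
  simp only [Finset.mem_compl, Finset.mem_insert, Finset.mem_singleton, not_or] at hk
  rw [← h k hk.1 hk.2]
  rfl

theorem polyAct_refl_pair {i j : Fin n} (hij : i ≠ j) (l : ZMod r) (μ : Fin n → ℕ) (a b : ℕ) :
    polyAct F (W.refl i j l)
        (MvPolynomial.X i ^ a * MvPolynomial.X j ^ b * restMono F μ i j) =
      (zetaPow F l ^ a * zetaPow F (-l) ^ b) •
        (MvPolynomial.X i ^ b * MvPolynomial.X j ^ a * restMono F μ i j) := by
  have hR : polyAct F (W.refl i j l) (restMono F μ i j) = restMono F μ i j := by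
    rw [restMono, map_prod]
    refine Finset.prod_congr rfl fun k hk => ?_
    simp only [Finset.mem_compl, Finset.mem_insert, Finset.mem_singleton, not_or] at hk
    rw [map_pow, polyAct_refl_of_ne F hij hk.1 hk.2]
  rw [map_mul, map_mul, map_pow, map_pow, polyAct_refl_left F hij, polyAct_refl_right F hij, hR,
    smul_pow, smul_pow, smul_mul_smul_comm, smul_mul_assoc, mul_comm (MvPolynomial.X j ^ a)]

/-- The sum `∑_{k < N} x_i ^ k (ζ ^ l x_j) ^ (N - 1 - k)`. -/
def geomPair (i j : Fin n) (l : ZMod r) (N : ℕ) : MvPolynomial (Fin n) F :=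
  ∑ k ∈ Finset.range N, MvPolynomial.X i ^ k * (zetaPow F l • MvPolynomial.X j) ^ (N - 1 - k)

theorem refForm_mul_geomPair (i j : Fin n) (l : ZMod r) (N : ℕ) :
    refForm F i j l * geomPair F i j l N =
      MvPolynomial.X i ^ N - (zetaPow F l • MvPolynomial.X j) ^ N := by
  rw [mul_comm, geomPair, refForm]
  exact (Commute.all _ _).geom_sum₂_mul N

/-- Apart from the factor x_i^b x_j^b and the other variables, all fixed by the reflection, this is
the geometric-sum formula for x_i^N - (ζ^l x_j)^N. -/
theorem divDiff_pair_of_le {i j : Fin n} (hij : i ≠ j) (l : ZMod r) (μ : Fin n → ℕ) (b N : ℕ) :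
    divDiff F i j l (MvPolynomial.X i ^ (b + N) * MvPolynomial.X j ^ b * restMono F μ i j) =
      MvPolynomial.X i ^ b * MvPolynomial.X j ^ b * restMono F μ i j * geomPair F i j l N := by
  refine divDiff_eq F hij l ?_
  have hz : zetaPow F l ^ (b + N) * zetaPow F (-l) ^ b = zetaPow F l ^ N := by
    rw [pow_add, mul_right_comm, ← mul_pow, mul_comm (zetaPow F l), zetaPow_neg_mul, one_pow,
      one_mul]
  rw [polyAct_refl_pair F hij, hz, mul_left_comm, refForm_mul_geomPair, smul_pow]
  simp only [MvPolynomial.smul_eq_C_mul]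
  ring

theorem divDiff_pair_of_ge {i j : Fin n} (hij : i ≠ j) (l : ZMod r) (μ : Fin n → ℕ) (a N : ℕ) :
    divDiff F i j l (MvPolynomial.X i ^ a * MvPolynomial.X j ^ (a + N) * restMono F μ i j) =
      -(zetaPow F (-l) ^ N) •
        (MvPolynomial.X i ^ a * MvPolynomial.X j ^ a * restMono F μ i j * geomPair F i j l N) := by
  refine divDiff_eq F hij l ?_
  have hz : zetaPow F l ^ a * zetaPow F (-l) ^ (a + N) = zetaPow F (-l) ^ N := by
    rw [pow_add, ← mul_assoc, ← mul_pow, mul_comm (zetaPow F l), zetaPow_neg_mul, one_pow, one_mul]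
  have hz' : zetaPow F (-l) ^ N * zetaPow F l ^ N = 1 := by
    rw [← mul_pow, zetaPow_neg_mul, one_pow]
  rw [polyAct_refl_pair F hij, hz, mul_smul_comm, mul_left_comm, refForm_mul_geomPair, smul_pow,
    mul_sub, smul_sub, mul_smul_comm, smul_smul, neg_mul, hz']
  simp only [MvPolynomial.smul_eq_C_mul, map_neg, map_one]
  ring

-- Exponents strictly inside the interval between μ_i and μ_j give terms lower in dominance order.
omit [Algebra ℂ F] in
theorem pair_mem_lowerPoly {i j : Fin n} (hij : i ≠ j) {μ : Fin n → ℕ} {p q : ℕ}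
    (hsum : p + q = μ i + μ j) (h : (μ i < p ∧ p < μ j) ∨ (μ j < p ∧ p < μ i)) :
    MvPolynomial.X i ^ p * MvPolynomial.X j ^ q * restMono F μ i j ∈ lowerPoly F μ := by
  let ν := Function.update (Function.update μ i p) j q
  have hνi : ν i = p := by simp [ν, hij]
  have hνj : ν j = q := by simp [ν]
  have hν : ∀ k, k ≠ i → k ≠ j → ν k = μ k := fun k hi hj => by simp [ν, hi, hj]
  refine Submodule.subset_span ⟨ν, Or.inl ?_, ?_⟩
  · rcases h with h | h
    · exact domLT_sortDesc hij (by omega) (by omega) (by omega) hν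
    · exact domLT_sortDesc hij.symm (by omega) (by omega) (by omega) fun k hj hi => hν k hi hj
  · rw [monomial_expo F hij μ ν hν, hνi, hνj]

-- Here μ_+ is unchanged, and moving the larger entry to the right lowers w_μ in Bruhat order.
omit [Algebra ℂ F] in
theorem swap_mem_lowerPoly {i j : Fin n} (hij : i ≠ j) {μ : Fin n → ℕ}
    (h : (i < j ∧ μ j < μ i) ∨ (j < i ∧ μ i < μ j)) :
    MvPolynomial.X i ^ μ j * MvPolynomial.X j ^ μ i * restMono F μ i j ∈ lowerPoly F μ := by
  refine Submodule.subset_span ⟨μ ∘ Equiv.swap i j, ?_, ?_⟩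
  · rcases h with h | h
    · exact compLT_comp_swap _ μ i j le_rfl h.1 h.2
    · rw [Equiv.swap_comm]
      exact compLT_comp_swap _ μ j i le_rfl h.1 h.2
  · rw [monomial_expo F hij μ (μ ∘ Equiv.swap i j) fun k hi hj => by
      rw [Function.comp_apply, Equiv.swap_apply_of_ne_of_ne hi hj]]
    simp

/-- The divided difference of `x_i x ^ μ`, modulo lower terms. -/
theorem divDiff_monomial_mem {i j : Fin n} (hij : i ≠ j) (l : ZMod r) (μ : Fin n → ℕ) :
    divDiff F i j l (MvPolynomial.X i * MvPolynomial.monomial (expo μ) 1) -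
      (if j < i then polyAct F (W.refl i j l) (MvPolynomial.monomial (expo μ) 1) else 0) -
      (if wPerm μ j < wPerm μ i then MvPolynomial.monomial (expo μ) 1 else 0) ∈
        lowerPoly F μ := by
  rw [monomial_expo F hij μ μ (fun _ _ _ => rfl), polyAct_refl_pair F hij, ← mul_assoc, ← mul_assoc,
    ← pow_succ']
  simp only [wPerm_lt_wPerm_iff]
  have hne : i < j ∨ j < i := lt_or_gt_of_ne hij
  set R := restMono F μ i j with hR
  rcases lt_trichotomy (μ i) (μ j) with hlt | heq | hgt
  -- All exponents of x_i in the divided difference lie strictly between μ_i and μ_j. The reflected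
  -- monomial, present when j < i, is lower as well.
  · obtain ⟨N, hN⟩ : ∃ N, μ j = μ i + 1 + N := ⟨μ j - μ i - 1, by omega⟩
    rw [if_neg (show ¬ (μ j < μ i ∨ (μ j = μ i ∧ i < j)) by omega), sub_zero]
    refine Submodule.sub_mem _ ?_ ?_
    · rw [show MvPolynomial.X (R := F) j ^ μ j = MvPolynomial.X j ^ (μ i + 1 + N) by rw [hN],
        divDiff_pair_of_ge F hij, geomPair, Finset.mul_sum]
      refine Submodule.smul_mem _ _ (Submodule.sum_mem _ fun k hk => ?_)
      have hk := Finset.mem_range.1 hk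
      have := pair_mem_lowerPoly F hij (μ := μ) (p := μ i + 1 + k) (q := μ i + 1 + (N - 1 - k))
        (by omega) (Or.inl (by omega))
      convert Submodule.smul_mem _ (zetaPow F l ^ (N - 1 - k)) this using 1
      rw [smul_pow]
      simp only [MvPolynomial.smul_eq_C_mul]
      ring
    · split_ifs with hji
      · exact Submodule.smul_mem _ _ (swap_mem_lowerPoly F hij (Or.inr ⟨hji, hlt⟩))
      · exact Submodule.zero_mem _
  -- For μ_i = μ_j the divided difference is x^μ. If j < i the reflected monomial accounts for it,
  -- and if i < j the tie-breaking rule of w_μ does.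
  · have hd := divDiff_pair_of_le F hij l μ (μ j) 1
    rw [← hR, geomPair, Finset.sum_range_one] at hd
    simp only [pow_zero, mul_one, Nat.sub_self] at hd
    have hz : zetaPow F l ^ μ j * zetaPow F (-l) ^ μ j = 1 := by
      rw [mul_comm, ← mul_pow, zetaPow_neg_mul, one_pow]
    rw [heq, hd, hz, one_smul]
    rcases hne with h | h
    · rw [if_neg (not_lt.2 h.le), if_pos (Or.inr ⟨rfl, h⟩), sub_zero, sub_self]
      exact Submodule.zero_mem _
    · rw [if_pos h, if_neg (fun h' => h'.elim (lt_irrefl _) fun h'' => lt_asymm h h''.2), sub_zero,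
        sub_self]
      exact Submodule.zero_mem _
  -- The geometric sum has N + 2 terms: the one with the lowest power of x_i is the reflected
  -- monomial, the one with the highest is x^μ, and those between are lower in dominance.
  · obtain ⟨N, hN⟩ : ∃ N, μ i = μ j + (N + 1) := ⟨μ i - μ j - 1, by omega⟩
    have hd := divDiff_pair_of_le F hij l μ (μ j) (N + 2)
    rw [← hR, geomPair, Finset.sum_range_succ, Finset.sum_range_succ', mul_add, mul_add,
      Finset.mul_sum] at hd
    have hs : zetaPow F l ^ μ i * zetaPow F (-l) ^ μ j = zetaPow F l ^ (N + 1) := by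
      rw [hN, pow_add, mul_right_comm, ← mul_pow, mul_comm (zetaPow F l), zetaPow_neg_mul, one_pow,
        one_mul]
    have hfirst : MvPolynomial.X i ^ μ j * MvPolynomial.X j ^ μ j * R *
        (MvPolynomial.X i ^ 0 * (zetaPow F l • MvPolynomial.X j) ^ (N + 2 - 1 - 0)) =
        (zetaPow F l ^ μ i * zetaPow F (-l) ^ μ j) •
          (MvPolynomial.X i ^ μ j * MvPolynomial.X j ^ μ i * R) := by
      rw [hs, hN, smul_pow, show N + 2 - 1 - 0 = N + 1 by omega]
      simp only [MvPolynomial.smul_eq_C_mul]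
      ring
    have hlast : MvPolynomial.X i ^ μ j * MvPolynomial.X j ^ μ j * R *
        (MvPolynomial.X i ^ (N + 1) * (zetaPow F l • MvPolynomial.X j) ^ (N + 2 - 1 - (N + 1))) =
        MvPolynomial.X i ^ μ i * MvPolynomial.X j ^ μ j * R := by
      rw [hN, show N + 2 - 1 - (N + 1) = 0 by omega]
      ring
    rw [if_pos (Or.inl hgt), show μ i + 1 = μ j + (N + 2) by omega, hd, hfirst, hlast]
    have hmid : ∑ k ∈ Finset.range N, MvPolynomial.X i ^ μ j * MvPolynomial.X j ^ μ j * R *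
        (MvPolynomial.X i ^ (k + 1) *
          (zetaPow F l • MvPolynomial.X j) ^ (N + 2 - 1 - (k + 1))) ∈ lowerPoly F μ := by
      refine Submodule.sum_mem _ fun k hk => ?_
      have hk := Finset.mem_range.1 hk
      have := pair_mem_lowerPoly F hij (μ := μ) (p := μ j + (k + 1))
        (q := μ j + (N + 2 - 1 - (k + 1))) (by omega) (Or.inr (by omega))
      convert Submodule.smul_mem _ (zetaPow F l ^ (N + 2 - 1 - (k + 1))) this using 1
      rw [smul_pow]
      simp only [MvPolynomial.smul_eq_C_mul, hR]
      ring
    -- The reflected monomial is lower if i < j and is subtracted if j < i.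
    rcases hne with h | h
    · rw [if_neg (not_lt.2 h.le), sub_zero, add_sub_cancel_right]
      exact Submodule.add_mem _ hmid
        (Submodule.smul_mem _ _ (swap_mem_lowerPoly F hij (Or.inl ⟨h, hgt⟩)))
    · rw [if_pos h]
      convert hmid using 1
      abel

end Monomials

/-! ### Triangularity of the Dunkl–Opdam elements -/

section Triangularity

variable {F : Type*} [Field F] [Algebra ℂ F] {r n : ℕ} [NeZero r]

theorem inv_perm_apply_self (σ : Equiv.Perm (Fin n)) (i : Fin n) : σ⁻¹ (σ i) = i :=
  Equiv.symm_apply_apply σ i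

/-- Fourier inversion on ℤ/r: equivalently, e_{ij} is the projector to one eigenspace of ζ_i. -/
theorem sum_diagCoeff_mul_zetaPow (d : ZMod r → F) (c : ZMod r) :
    ∑ l, diagCoeff d l * zetaPow F (l * c) = d c - d (c - 1) := by
  have hr : (r : F) ≠ 0 := by
    have : CharZero F := charZero_of_injective_algebraMap (algebraMap ℂ F).injective
    exact Nat.cast_ne_zero.2 (NeZero.ne r)
  have h (j : ZMod r) : ∑ l : ZMod r, (d j - d (j - 1)) * ((r : F)⁻¹ * zetaPow F (-(l * j))) *
      zetaPow F (l * c) = if j = c then d c - d (c - 1) else 0 := by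
    have h' (l : ZMod r) : (d j - d (j - 1)) * ((r : F)⁻¹ * zetaPow F (-(l * j))) *
        zetaPow F (l * c) = (d j - d (j - 1)) * (r : F)⁻¹ * zetaPow F (l * (c - j)) := by
      rw [mul_sub, sub_eq_add_neg (l * c), zetaPow_add]
      ring
    rw [Finset.sum_congr rfl fun l _ => h' l, ← Finset.mul_sum, sum_zetaPow_mul]
    by_cases hj : j = c
    · rw [if_pos hj, if_pos (by rw [hj, sub_self]), hj, inv_mul_cancel_right₀ hr]
    · rw [if_neg hj, if_neg (sub_ne_zero.2 (Ne.symm hj)), mul_zero]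
  simp only [diagCoeff, Finset.sum_mul]
  rw [Finset.sum_comm, Finset.sum_congr rfl fun j _ => h j, Finset.sum_ite_eq',
    if_pos (Finset.mem_univ _)]

/-- The k-th term of the q-integer contributes d_{b-k} - d_{b-k-1}, and the sum over k telescopes.
-/
theorem sum_diagCoeff_mul_sum_zetaPow (d : ZMod r → F) (b : ZMod r) (N : ℕ) :
    ∑ l, diagCoeff d l *
      ((∑ k ∈ Finset.range (N + 1), zetaPow F (-(l * (k : ZMod r)))) * zetaPow F (l * b)) =
        d b - d (b - N - 1) := by
  have h (k : ℕ) : ∑ l, diagCoeff d l * (zetaPow F (-(l * (k : ZMod r))) * zetaPow F (l * b)) =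
      d (b - k) - d (b - ((k + 1 : ℕ) : ZMod r)) := by
    rw [Nat.cast_succ, ← sub_sub, ← sum_diagCoeff_mul_zetaPow]
    refine Finset.sum_congr rfl fun l _ => ?_
    rw [← zetaPow_add]
    congr 2
    ring
  simp only [Finset.sum_mul, Finset.mul_sum]
  rw [Finset.sum_comm, Finset.sum_congr rfl fun k _ => h k,
    Finset.sum_range_sub' (fun k : ℕ => d (b - (k : ZMod r))), Nat.cast_zero, sub_zero,
    Nat.cast_succ, sub_sub]

variable {lam : RPartition r n}

theorem spechtRep_zeta (i : Fin n) (l : ZMod r) (T : SYT lam) :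
    spechtRep F lam (W.zeta i l) (spechtVec F lam T) =
      zetaPow F (l * (T.1 i).beta) • spechtVec F lam T :=
  zeta_smul_spechtFill F i l T.1

theorem jmSum_spechtRep (i : Fin n) (T : SYT lam) :
    jmSum (spechtRep F lam) i (spechtVec F lam T) = ((r : F) * (T.1 i).ct) • spechtVec F lam T := by
  rw [← jmSum_smul_spechtVec]
  simp only [jmSum, reflSum, LinearMap.sum_apply, Finset.sum_smul, spechtRep_apply]

variable (F) in
/-- The vector `v_T^μ = t_{w_μ}⁻¹ v_T` of `S^λ`. -/
def twistVec (μ : Fin n → ℕ) (T : SYT lam) : Specht F lam :=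
  spechtRep F lam (W.perm r (wPerm μ)⁻¹) (spechtVec F lam T)

theorem spechtRep_zeta_twistVec (μ : Fin n → ℕ) (T : SYT lam) (i : Fin n) (l : ZMod r) :
    spechtRep F lam (W.zeta i l) (twistVec F μ T) =
      zetaPow F (l * (T.1 (wPerm μ i)).beta) • twistVec F μ T := by
  have h : W.zeta i l * W.perm r (wPerm μ)⁻¹ = W.perm r (wPerm μ)⁻¹ * W.zeta (wPerm μ i) l := by
    rw [W.mul_zeta, W.perm_right, inv_perm_apply_self]
  rw [twistVec, ← Module.End.mul_apply, ← map_mul, h, map_mul, Module.End.mul_apply,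
    spechtRep_zeta, map_smul]

/-- Conjugation by t_{w_μ} carries the reflections with w_μ(j) < w_μ(i) to those making up the
Jucys–Murphy element of w_μ(i). This is the reason for twisting v_T by t_{w_μ}⁻¹. -/
theorem sum_spechtRep_refl_twistVec (μ : Fin n → ℕ) (T : SYT lam) (i : Fin n) :
    ∑ j ∈ Finset.univ.filter (fun j => j ≠ i), ∑ l : ZMod r,
      (if wPerm μ j < wPerm μ i then spechtRep F lam (W.refl i j l) (twistVec F μ T) else 0) =
        ((r : F) * (T.1 (wPerm μ i)).ct) • twistVec F μ T := by
  have h (j : Fin n) (hj : j ≠ i) :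
      reflSum (spechtRep F lam) i j (twistVec F μ T) =
        spechtRep F lam (W.perm r (wPerm μ)⁻¹)
          (reflSum (spechtRep F lam) (wPerm μ i) (wPerm μ j) (spechtVec F lam T)) := by
    rw [twistVec, ← Module.End.mul_apply, ← Module.End.mul_apply,
      mul_reflSum _ _ (fun h => hj ((wPerm μ).injective h).symm), W.perm_right,
      inv_perm_apply_self, inv_perm_apply_self]
  have h2 : ∀ j ∈ Finset.univ.filter (fun j => j ≠ i), ∑ l : ZMod r,
      (if wPerm μ j < wPerm μ i then spechtRep F lam (W.refl i j l) (twistVec F μ T) else 0) =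
      if wPerm μ j < wPerm μ i then spechtRep F lam (W.perm r (wPerm μ)⁻¹)
          (reflSum (spechtRep F lam) (wPerm μ i) (wPerm μ j) (spechtVec F lam T)) else 0 := by
    intro j hj
    split_ifs with hlt
    · rw [← h j (Finset.mem_filter.1 hj).2, reflSum, LinearMap.sum_apply]
    · exact Finset.sum_const_zero
  rw [Finset.sum_congr rfl h2, ← Finset.sum_filter, Finset.filter_filter, twistVec, ← map_smul,
    ← jmSum_spechtRep, jmSum, LinearMap.sum_apply, map_sum]
  refine Finset.sum_equiv (wPerm μ) (fun j => ?_) fun j _ => rfl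
  simp only [Finset.mem_filter, Finset.mem_univ, true_and]
  exact ⟨fun h => h.2, fun h => ⟨fun hji => lt_irrefl _ (hji ▸ h), h⟩⟩

variable (κ c₀ : F) (d : ZMod r → F)

theorem ht_zeta_smul_vermaVec (μ : Fin n → ℕ) (T : SYT lam) (i : Fin n) :
    ht κ c₀ d (W.zeta i 1) • vermaVec κ c₀ d lam μ T =
      zetaEigenvalue F μ T i • vermaVec κ c₀ d lam μ T := by
  have h := spechtRep_zeta_twistVec (F := F) μ T i 1
  rw [twistVec] at h
  rw [vermaVec_eq, ht_smul_polyVec, polyAct_zeta_monomial, h, map_smul, map_smul,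
    LinearMap.smul_apply, smul_smul, ← zetaPow_add, zetaEigenvalue, one_mul, one_mul,
    sub_eq_add_neg]
  rfl

theorem polyVec_mem_lowerSpan {μ : Fin n → ℕ} {p : MvPolynomial (Fin n) F}
    (hp : p ∈ lowerPoly F μ) (v : Specht F lam) :
    polyVec κ c₀ d lam p v ∈ lowerSpan κ c₀ d lam μ := by
  induction hp using Submodule.span_induction with
  | mem p hp =>
    obtain ⟨ν, hν, rfl⟩ := hp
    refine Submodule.span_mono ?_ (polyVec_mem_span_vermaVec κ c₀ d ν v)
    rintro _ ⟨S, rfl⟩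
    exact ⟨ν, S, hν, rfl⟩
  | zero => rw [map_zero, LinearMap.zero_apply]; exact Submodule.zero_mem _
  | add p q _ _ hp hq =>
    rw [map_add, LinearMap.add_apply]
    exact Submodule.add_mem _ hp hq
  | smul c p _ hp =>
    rw [map_smul, LinearMap.smul_apply]
    exact Submodule.smul_mem _ _ hp

theorem jucysMurphy_smul_polyVec (i : Fin n) (p : MvPolynomial (Fin n) F) (v : Specht F lam) :
    jucysMurphy κ c₀ d i • polyVec κ c₀ d lam p v =
      ∑ j ∈ Finset.univ.filter (fun j => j ≠ i), ∑ l : ZMod r,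
        polyVec κ c₀ d lam (if j < i then polyAct F (W.refl i j l) p else 0)
          (spechtRep F lam (W.refl i j l) v) := by
  simp only [jucysMurphy, Finset.sum_smul, ht_smul_polyVec]
  refine (Finset.sum_subset_zero_on_sdiff (fun j hj => ?_) (fun j hj => ?_) fun j hj => ?_)
  · rw [Finset.mem_filter] at hj ⊢
    exact ⟨Finset.mem_univ _, hj.2.ne⟩
  · have hj : ¬ j < i := fun h =>
      (Finset.mem_sdiff.1 hj).2 (Finset.mem_filter.2 ⟨Finset.mem_univ _, h⟩)
    refine Finset.sum_eq_zero fun l _ => ?_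
    rw [if_neg hj, map_zero, LinearMap.zero_apply]
  · simp only [if_pos (Finset.mem_filter.1 hj).2]

theorem qDeriv_X_mul_monomial (i : Fin n) (l : ZMod r) (μ : Fin n → ℕ) :
    qDeriv F i l (MvPolynomial.X i * MvPolynomial.monomial (expo μ) 1) =
      (∑ k ∈ Finset.range (μ i + 1), zetaPow F (-(l * (k : ZMod r)))) •
        MvPolynomial.monomial (expo μ) 1 := by
  rw [MvPolynomial.X, MvPolynomial.monomial_mul, one_mul, qDeriv_monomial, add_tsub_cancel_left,
    MvPolynomial.smul_monomial, smul_eq_mul, mul_one, Finsupp.add_apply, Finsupp.single_eq_same,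
    add_comm 1]
  rfl

theorem dunklOpdam_smul_vermaVec_sub_mem (μ : Fin n → ℕ) (T : SYT lam) (i : Fin n) :
    dunklOpdam κ c₀ d i • vermaVec κ c₀ d lam μ T -
      zEigenvalue κ c₀ d μ T i • vermaVec κ c₀ d lam μ T ∈ lowerSpan κ c₀ d lam μ := by
  set m : MvPolynomial (Fin n) F := MvPolynomial.monomial (expo μ) 1 with hm
  set b := T.1 (wPerm μ i) with hb
  have hvec : vermaVec κ c₀ d lam μ T = polyVec κ c₀ d lam m (twistVec F μ T) :=
    vermaVec_eq κ c₀ d μ T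
  set E := polyVec κ c₀ d lam m (twistVec F μ T) with hE
  have h1 : polyVec κ c₀ d lam (qDeriv F i (0 : ZMod r) (MvPolynomial.X i * m)) (twistVec F μ T) =
      ((μ i : F) + 1) • E := by
    rw [hm, qDeriv_X_mul_monomial, map_smul, LinearMap.smul_apply]
    simp [zetaPow_zero, hE, hm]
  have h2 : ∑ l : ZMod r, diagCoeff d l • polyVec κ c₀ d lam (qDeriv F i l (MvPolynomial.X i * m))
      (spechtRep F lam (W.zeta i l) (twistVec F μ T)) =
      (d b.beta - d (b.beta - (μ i : ZMod r) - 1)) • E := by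
    rw [← sum_diagCoeff_mul_sum_zetaPow, Finset.sum_smul]
    refine Finset.sum_congr rfl fun l _ => ?_
    rw [hm, qDeriv_X_mul_monomial, map_smul, LinearMap.smul_apply, spechtRep_zeta_twistVec,
      map_smul, smul_smul, smul_smul, mul_assoc]
  have h3 : ∑ j ∈ Finset.univ.filter (fun j => j ≠ i), ∑ l : ZMod r,
      polyVec κ c₀ d lam (if wPerm μ j < wPerm μ i then m else 0)
        (spechtRep F lam (W.refl i j l) (twistVec F μ T)) = ((r : F) * b.ct) • E := by
    rw [hE, ← map_smul, ← sum_spechtRep_refl_twistVec, map_sum]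
    refine Finset.sum_congr rfl fun j _ => ?_
    rw [map_sum]
    refine Finset.sum_congr rfl fun l _ => ?_
    split_ifs
    · rfl
    · rw [map_zero, map_zero, LinearMap.zero_apply]
  -- Summed over all reflections, the divided differences are the Jucys–Murphy part plus the content
  -- term, modulo lower terms.
  have h4 : ∑ j ∈ Finset.univ.filter (fun j => j ≠ i), ∑ l : ZMod r,
      polyVec κ c₀ d lam (divDiff F i j l (MvPolynomial.X i * m) -
        (if j < i then polyAct F (W.refl i j l) m else 0) -
        (if wPerm μ j < wPerm μ i then m else 0))
        (spechtRep F lam (W.refl i j l) (twistVec F μ T)) ∈ lowerSpan κ c₀ d lam μ :=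
    Submodule.sum_mem _ fun j hj => Submodule.sum_mem _ fun l _ =>
      polyVec_mem_lowerSpan κ c₀ d
        (divDiff_monomial_mem F (Finset.mem_filter.1 hj).2.symm l μ) _
  simp only [map_sub, LinearMap.sub_apply, Finset.sum_sub_distrib, h3] at h4
  rw [← jucysMurphy_smul_polyVec] at h4
  have h5 : dunklOpdam κ c₀ d i • E = κ • ((μ i : F) + 1) • E -
      (d b.beta - d (b.beta - (μ i : ZMod r) - 1)) • E -
      c₀ • ∑ j ∈ Finset.univ.filter (fun j => j ≠ i), ∑ l : ZMod r,
        polyVec κ c₀ d lam (divDiff F i j l (MvPolynomial.X i * m))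
          (spechtRep F lam (W.refl i j l) (twistVec F μ T)) +
      c₀ • jucysMurphy κ c₀ d i • E := by
    rw [← h1, ← h2, ← hy_smul_polyVec, ← hx_smul_polyVec, dunklOpdam, add_smul, mul_smul,
      smul_assoc c₀]
  have h6 : zEigenvalue κ c₀ d μ T i • E = κ • ((μ i : F) + 1) • E -
      (d b.beta - d (b.beta - (μ i : ZMod r) - 1)) • E - c₀ • ((r : F) * b.ct) • E := by
    rw [smul_smul, smul_smul, ← sub_smul, ← sub_smul, ← mul_assoc c₀]
    rfl
  rw [hvec, h5, h6]
  have h7 := Submodule.smul_mem _ (-c₀) h4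
  rw [neg_smul, smul_sub, smul_sub] at h7
  convert h7 using 1
  abel

end Triangularity

/-! ### Simultaneous eigenvectors of commuting triangular operators -/

section TriangularFamilies

variable {F V ι K : Type*} [Field F] [AddCommGroup V] [Module F V]

/-- P is the product over q in s of the factors A_k - b_q(k), with k chosen so that a and b_q differ
at k, and c is the product of the numbers a(k) - b_q(k). Working modulo an arbitrary invariant
subspace lets the one operator serve for triangular families. -/
theorem exists_separating_operator {A : K → Module.End F V} (hA : ∀ j k, Commute (A j) (A k))
    (a : K → F) (b : ι → K → F) (s : Finset ι) (hs : ∀ q ∈ s, ∃ k, a k ≠ b q k) :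
    ∃ (P : Module.End F V) (c : F), c ≠ 0 ∧ (∀ j, Commute P (A j)) ∧
      ∀ N : Submodule F V, (∀ j, ∀ v ∈ N, A j v ∈ N) → (∀ v ∈ N, P v ∈ N) ∧
        (∀ q ∈ s, ∀ v, (∀ j, A j v - b q j • v ∈ N) → P v ∈ N) ∧
        ∀ v, (∀ j, A j v - a j • v ∈ N) → P v - c • v ∈ N := by
  classical
  induction s using Finset.induction_on with
  | empty =>
    exact ⟨1, 1, one_ne_zero, fun j => Commute.one_left _, by simp⟩
  | insert q s hq ih =>
    obtain ⟨P, c, hc, hcomm, hN⟩ := ih fun q' hq' => hs q' (Finset.mem_insert_of_mem hq')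
    obtain ⟨k, hk⟩ := hs q (Finset.mem_insert_self _ _)
    have hB (b : F) (k j : K) : Commute (A k - algebraMap F _ b) (A j) :=
      (hA _ _).sub_left (Algebra.commutes _ _)
    refine ⟨P * (A k - algebraMap F _ (b q k)), c * (a k - b q k),
      mul_ne_zero hc (sub_ne_zero.2 hk), fun j => (hcomm j).mul_left (hB _ k j),
      fun N hinv => ?_⟩
    have hinvB : ∀ v ∈ N, (A k - algebraMap F _ (b q k)) v ∈ N := fun v hv => by
      rw [LinearMap.sub_apply, Module.algebraMap_end_apply]
      exact N.sub_mem (hinv _ _ hv) (N.smul_mem _ hv)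
    refine ⟨fun v hv => (hN N hinv).1 _ (hinvB v hv), fun q' hq' v hv => ?_, fun v hv => ?_⟩
    · rw [Module.End.mul_apply]
      rcases Finset.mem_insert.1 hq' with rfl | hq'
      · exact (hN N hinv).1 _ (hv k)
      · refine (hN N hinv).2.1 q' hq' _ fun j => ?_
        rw [← Module.End.mul_apply, ← (hB (b q k) k j).eq, Module.End.mul_apply, ← map_smul,
          ← map_sub]
        exact hinvB _ (hv j)
    · have h1 := (hN N hinv).1 _ (hv k)
      have h2 := N.smul_mem (a k - b q k) ((hN N hinv).2.2 v hv)
      convert N.add_mem h1 h2 using 1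
      rw [Module.End.mul_apply, LinearMap.sub_apply, Module.algebraMap_end_apply]
      simp only [map_sub, map_smul]
      module

/-- Commuting operators that are triangular with respect to a linearly independent family, with
joint eigenvalues that are separated along the order, have unique joint eigenvectors with
prescribed leading terms. -/
theorem exists_unique_eigenvector {e : ι → V} (he : LinearIndependent F e) {lt : ι → ι → Prop}
    (htrans : ∀ {p q s}, lt p q → lt q s → lt p s) (hirrefl : ∀ p, ¬ lt p p)
    (hfin : ∀ p, {q | lt q p}.Finite) {A : K → Module.End F V}
    (hA : ∀ j k, Commute (A j) (A k)) (a : ι → K → F)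
    (htri : ∀ p j, A j (e p) - a p j • e p ∈ Submodule.span F (e '' {q | lt q p}))
    (hsep : ∀ p q, lt q p → ∃ j, a p j ≠ a q j) (p : ι) :
    ∃ f, f - e p ∈ Submodule.span F (e '' {q | lt q p}) ∧ (∀ j, A j f = a p j • f) ∧
      ∀ g, g - e p ∈ Submodule.span F (e '' {q | lt q p}) → (∀ j, ∃ c : F, A j g = c • g) →
        g = f := by
  classical
  set L : ι → Submodule F V := fun p => Submodule.span F (e '' {q | lt q p}) with hL
  have hmono {p q : ι} (h : lt q p) : L q ≤ L p :=
    Submodule.span_mono (Set.image_mono fun _ h' => htrans h' h)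
  have hinv (p : ι) (j : K) (v : V) (hv : v ∈ L p) : A j v ∈ L p := by
    induction hv using Submodule.span_induction with
    | mem v hv =>
      obtain ⟨q, hq, rfl⟩ := hv
      have h2 : e q ∈ L p := Submodule.subset_span ⟨q, hq, rfl⟩
      rw [← sub_add_cancel (A j (e q)) (a q j • e q)]
      exact (L p).add_mem (hmono hq (htri q j)) ((L p).smul_mem _ h2)
    | zero => rw [map_zero]; exact (L p).zero_mem
    | add u v _ _ hu hv => rw [map_add]; exact (L p).add_mem hu hv
    | smul c v _ hv => rw [map_smul]; exact (L p).smul_mem _ hv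
  obtain ⟨P₀, c₀, hc₀, hcomm₀, hN₀⟩ := exists_separating_operator hA (a p) a (hfin p).toFinset
    fun q hq => hsep p q ((hfin p).mem_toFinset.1 hq)
  -- P₀ sends e_q to the span of what is below q, so its powers kill e_q, by induction on the number
  -- of elements below q.
  have hPe (N : ℕ) : ∀ q, lt q p → {s | lt s q}.ncard < N → (P₀ ^ N) (e q) = 0 := by
    induction N with
    | zero => exact fun q _ h => absurd h (Nat.not_lt_zero _)
    | succ N ih =>
      intro q hq hcard
      have hker : L q ≤ LinearMap.ker (P₀ ^ N) := by
        refine Submodule.span_le.2 ?_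
        rintro _ ⟨s, hs, rfl⟩
        refine ih s (htrans hs hq) (lt_of_lt_of_le (Set.ncard_lt_ncard ?_ (hfin q))
          (Nat.lt_succ_iff.1 hcard))
        exact ⟨fun u hu => htrans hu hs, fun h => hirrefl s (h hs)⟩
      rw [pow_succ, Module.End.mul_apply]
      exact hker ((hN₀ (L q) (hinv q)).2.1 q ((hfin p).mem_toFinset.2 hq) _ (htri q))
  have hNpow (N : Submodule F V) (hNinv : ∀ j, ∀ v ∈ N, A j v ∈ N) (v : V)
      (hv : ∀ j, A j v - a p j • v ∈ N) (m : ℕ) : (P₀ ^ m) v - c₀ ^ m • v ∈ N := by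
    induction m with
    | zero => simp
    | succ m ih =>
      convert N.add_mem ((hN₀ N hNinv).1 _ ih)
        (N.smul_mem (c₀ ^ m) ((hN₀ N hNinv).2.2 v hv)) using 1
      rw [pow_succ', Module.End.mul_apply, map_sub, map_smul]
      module
  -- A high power of P₀ kills all of L p and still acts by a nonzero scalar on joint eigenvectors
  -- with the eigenvalues of p.
  obtain ⟨P, c, hc, hcomm, hP0, hN⟩ : ∃ (P : Module.End F V) (c : F), c ≠ 0 ∧
      (∀ j, Commute P (A j)) ∧ (∀ v ∈ L p, P v = 0) ∧
      ∀ N : Submodule F V, (∀ j, ∀ v ∈ N, A j v ∈ N) →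
        ∀ v, (∀ j, A j v - a p j • v ∈ N) → P v - c • v ∈ N := by
    refine ⟨P₀ ^ ({s | lt s p}.ncard + 1), _, pow_ne_zero _ hc₀, fun j => (hcomm₀ j).pow_left _,
      fun v hv => ?_, fun N hNinv v hv => hNpow N hNinv v hv _⟩
    have hker : L p ≤ LinearMap.ker (P₀ ^ ({s | lt s p}.ncard + 1)) := by
      refine Submodule.span_le.2 ?_
      rintro _ ⟨s, hs, rfl⟩
      refine hPe _ s hs (Nat.lt_succ_of_le (Set.ncard_le_ncard ?_ (hfin p)))
      exact fun u hu => htrans hu hs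
    exact hker hv
  have hnot : e p ∉ L p := he.notMem_span_image (hirrefl p)
  have hPp : P (e p) - c • e p ∈ L p := hN (L p) (hinv p) _ (htri p)
  have hf : c⁻¹ • P (e p) - e p ∈ L p := by
    have := (L p).smul_mem c⁻¹ hPp
    rwa [smul_sub, inv_smul_smul₀ hc] at this
  have hfA (j : K) : A j (c⁻¹ • P (e p)) = a p j • c⁻¹ • P (e p) := by
    have h1 := hP0 _ (htri p j)
    rw [map_sub, map_smul, sub_eq_zero, ← Module.End.mul_apply, (hcomm j).eq,
      Module.End.mul_apply] at h1
    rw [map_smul, h1, smul_comm]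
  refine ⟨c⁻¹ • P (e p), hf, hfA, fun g hg hgA => ?_⟩
  -- The eigenvalue is forced by the leading term: otherwise g, and hence e p, would lie in L p.
  have hgA' (j : K) : A j g = a p j • g := by
    obtain ⟨b, hb⟩ := hgA j
    have h1 : (b - a p j) • g ∈ L p := by
      have h2 := (L p).sub_mem (hinv p j _ hg) ((L p).smul_mem (a p j) hg)
      convert (L p).add_mem h2 (htri p j) using 1
      rw [map_sub, hb]
      module
    by_cases hba : b = a p j
    · rw [hb, hba]
    · have h2 := (L p).smul_mem (b - a p j)⁻¹ h1
      rw [inv_smul_smul₀ (sub_ne_zero.2 hba)] at h2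
      exact absurd ((Submodule.sub_mem_iff_right _ h2).1 hg) hnot
  have hd : g - c⁻¹ • P (e p) ∈ L p := by
    convert (L p).sub_mem hg hf using 1
    abel
  have h0 := (hN ⊥ (fun j v hv => by
    rw [Submodule.mem_bot] at hv ⊢; rw [hv, map_zero])) (g - c⁻¹ • P (e p)) fun j => by
      rw [Submodule.mem_bot, map_sub, hgA', hfA, ← smul_sub, sub_self]
  rw [Submodule.mem_bot, hP0 _ hd, zero_sub, neg_eq_zero, smul_eq_zero_iff_right hc,
    sub_eq_zero] at h0
  exact h0

end TriangularFamilies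

/-! ### Separation of eigenvalues and the main theorem -/

section Main

variable {F : Type*} [Field F] [Algebra ℂ F] {r n : ℕ} [NeZero r]
  {κ c₀ : F} {d : ZMod r → F} {lam : RPartition r n}

/-- An equality would express (μ_i - ν_i) κ as a ℂ-combination of c₀ and the d_j. Linear
independence over ℂ is all that is used of genericity, after d_0 is eliminated by the sum relation.
-/
theorem zEigenvalue_ne_of_isGeneric (hgen : IsGeneric κ c₀ d) (hd : ∑ j, d j = 0)
    {μ ν : Fin n → ℕ} (T S : SYT lam) {i : Fin n} (hi : μ i ≠ ν i) :
    zEigenvalue κ c₀ d μ T i ≠ zEigenvalue κ c₀ d ν S i := by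
  intro h
  set v : Fin 2 ⊕ {j : ZMod r // j ≠ 0} → F :=
    Sum.elim ![κ, c₀] (fun j : {j : ZMod r // j ≠ 0} => d j) with hv
  have hlin : LinearIndependent ℂ v := AlgebraicIndependent.linearIndependent hgen
  set D := Submodule.span ℂ (v '' {Sum.inl 0}ᶜ) with hD
  have hκ : κ ∉ D := hlin.notMem_span_image (x := Sum.inl 0) (by simp)
  have hc : c₀ ∈ D := Submodule.subset_span ⟨Sum.inl 1, by simp, rfl⟩
  have hd' (j : ZMod r) : d j ∈ D := by
    have hne (j : ZMod r) (hj : j ≠ 0) : d j ∈ D :=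
      Submodule.subset_span ⟨Sum.inr ⟨j, hj⟩, by simp, rfl⟩
    rcases eq_or_ne j 0 with rfl | hj
    · rw [← Finset.add_sum_erase _ _ (Finset.mem_univ (0 : ZMod r))] at hd
      rw [eq_neg_of_add_eq_zero_left hd]
      exact D.neg_mem (D.sum_mem fun j hj => hne j (Finset.mem_erase.1 hj).1)
    · exact hne j hj
  refine hκ ?_
  have hcoef : ((μ i : ℂ) - ν i) ≠ 0 := sub_ne_zero.2 (Nat.cast_injective.ne hi)
  rw [← inv_smul_smul₀ hcoef κ]
  refine D.smul_mem _ ?_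
  have key : ((μ i : ℂ) - ν i) • κ =
      (d (T.1 (wPerm μ i)).beta - d ((T.1 (wPerm μ i)).beta - (μ i : ZMod r) - 1)) -
      (d (S.1 (wPerm ν i)).beta - d ((S.1 (wPerm ν i)).beta - (ν i : ZMod r) - 1)) +
      ((r : ℂ) * (((T.1 (wPerm μ i)).ct : ℂ) - (S.1 (wPerm ν i)).ct)) • c₀ := by
    simp only [zEigenvalue] at h
    simp only [Algebra.smul_def, map_sub, map_mul, map_natCast, map_intCast]
    linear_combination h
  rw [key]
  exact D.add_mem (D.sub_mem (D.sub_mem (hd' _) (hd' _)) (D.sub_mem (hd' _) (hd' _)))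
    (D.smul_mem _ hc)

theorem finite_SYT : Finite (SYT lam) := by
  rcases isEmpty_or_nonempty (SYT lam) with h | ⟨⟨T⟩⟩
  · exact inferInstance
  · have : Finite (Box lam) := Finite.of_equiv _ T.1
    infer_instance

variable (κ c₀ d) in
/-- The operators `z_i` and `t_{ζ_i}` on `M(λ)`. -/
def tOperator (lam : RPartition r n) : Fin n ⊕ Fin n → Module.End F (Verma κ c₀ d lam) :=
  fun k => Algebra.lsmul F F _
    (Sum.elim (dunklOpdam κ c₀ d) (fun i => ht κ c₀ d (W.zeta i 1)) k)

theorem tOperator_commute (j k : Fin n ⊕ Fin n) :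
    Commute (tOperator κ c₀ d lam j) (tOperator κ c₀ d lam k) := by
  have hH := isCherednik_gens (n := n) κ c₀ d
  refine Commute.map (f := Algebra.lsmul F F (Verma κ c₀ d lam)) ?_
  rcases j with i | i <;> rcases k with j | j
  · exact hH.dunklOpdam_comm i j
  · exact (hH.zeta_mul_dunklOpdam j i 1).symm
  · exact hH.zeta_mul_dunklOpdam i j 1
  · change htHom κ c₀ d _ * htHom κ c₀ d _ = htHom κ c₀ d _ * htHom κ c₀ d _
    rw [← map_mul, ← map_mul, W.mul_zeta]
    rfl

theorem lowerSpan_eq (μ : Fin n → ℕ) (T : SYT lam) :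
    lowerSpan κ c₀ d lam μ = Submodule.span F
      ((fun p : (Fin n → ℕ) × SYT lam => vermaVec κ c₀ d lam p.1 p.2) ''
        {q | CompLT q.1 (μ, T).1}) := by
  rw [lowerSpan]
  congr 1
  ext m
  constructor
  · rintro ⟨ν, S, h, rfl⟩
    exact ⟨(ν, S), h, rfl⟩
  · rintro ⟨⟨ν, S⟩, h, rfl⟩
    exact ⟨ν, S, h, rfl⟩

theorem exists_smul_eq_of_mem_tSubalgebra {f : Verma κ c₀ d lam}
    (hf : ∀ k, ∃ c : F, tOperator κ c₀ d lam k f = c • f) {a : Cherednik n κ c₀ d}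
    (ha : a ∈ tSubalgebra n κ c₀ d) : ∃ c : F, a • f = c • f := by
  induction ha using Algebra.adjoin_induction with
  | mem a ha =>
    rcases ha with ⟨i, rfl⟩ | ⟨i, rfl⟩
    · exact hf (Sum.inl i)
    · exact hf (Sum.inr i)
  | algebraMap c => exact ⟨c, algebraMap_smul _ _ _⟩
  | add a b _ _ ha hb =>
    obtain ⟨c, hc⟩ := ha
    obtain ⟨c', hc'⟩ := hb
    exact ⟨c + c', by rw [add_smul, hc, hc', add_smul]⟩
  | mul a b _ _ ha hb =>
    obtain ⟨c, hc⟩ := ha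
    obtain ⟨c', hc'⟩ := hb
    exact ⟨c' * c, by rw [mul_smul, hc', smul_comm, hc, smul_smul]⟩

end Main

end Dunkl

end

/-! ### Assembly of the theorem -/

open Dunkl in
theorem theorem5 {F : Type*} [Field F] [Algebra ℂ F] {r n : ℕ} [NeZero r]
    (κ c₀ : F) (d : ZMod r → F) (hd : ∑ j, d j = 0) (lam : RPartition r n) :
    -- the elements `x^μ v_T^μ` form a basis of `M(λ)`
    (LinearIndependent F (fun p : (Fin n → ℕ) × SYT lam => vermaVec κ c₀ d lam p.1 p.2) ∧
      Submodule.span F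
        (Set.range fun p : (Fin n → ℕ) × SYT lam => vermaVec κ c₀ d lam p.1 p.2) = ⊤) ∧
    -- (a) the action of `t_{ζ_i}` and `z_i`
    (∀ (μ : Fin n → ℕ) (T : SYT lam) (i : Fin n),
      ht κ c₀ d (W.zeta i 1) • vermaVec κ c₀ d lam μ T =
          zetaEigenvalue F μ T i • vermaVec κ c₀ d lam μ T ∧
        dunklOpdam κ c₀ d i • vermaVec κ c₀ d lam μ T -
            zEigenvalue κ c₀ d μ T i • vermaVec κ c₀ d lam μ T ∈ lowerSpan κ c₀ d lam μ) ∧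
    -- (b) for generic parameters, the eigenvectors `f_{μ,T}` and their eigenvalues
    (IsGeneric κ c₀ d → ∀ (μ : Fin n → ℕ) (T : SYT lam),
      ∃ f : Verma κ c₀ d lam,
        (IsTEigenvector κ c₀ d lam f ∧
          f - vermaVec κ c₀ d lam μ T ∈ lowerSpan κ c₀ d lam μ) ∧
        (∀ g : Verma κ c₀ d lam, IsTEigenvector κ c₀ d lam g →
          g - vermaVec κ c₀ d lam μ T ∈ lowerSpan κ c₀ d lam μ → g = f) ∧
        (∀ i : Fin n, dunklOpdam κ c₀ d i • f = zEigenvalue κ c₀ d μ T i • f ∧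
          ht κ c₀ d (W.zeta i 1) • f = zetaEigenvalue F μ T i • f)) := by
  have hli := linearIndependent_vermaVec κ c₀ d (lam := lam)
  refine ⟨⟨hli, span_vermaVec κ c₀ d⟩, fun μ T i => ⟨ht_zeta_smul_vermaVec κ c₀ d μ T i,
    dunklOpdam_smul_vermaVec_sub_mem κ c₀ d μ T i⟩, fun hgen μ T => ?_⟩
  have : Finite (SYT lam) := finite_SYT
  obtain ⟨f, hf, hfA, huniq⟩ := exists_unique_eigenvector hli
    (lt := fun q p : (Fin n → ℕ) × SYT lam => CompLT q.1 p.1)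
    (fun h h' => CompLT.trans h h') (fun p => CompLT.irrefl p.1)
    (fun p => (((finite_setOf_compLT p.1).prod (Set.finite_univ (α := SYT lam))).subset
      fun q hq => ⟨hq, Set.mem_univ _⟩))
    (A := tOperator κ c₀ d lam) tOperator_commute
    (fun p => Sum.elim (zEigenvalue κ c₀ d p.1 p.2) (zetaEigenvalue F p.1 p.2))
    (fun p k => by
      rw [← lowerSpan_eq p.1 p.2]
      rcases k with i | i
      · exact dunklOpdam_smul_vermaVec_sub_mem κ c₀ d p.1 p.2 i
      · exact (sub_eq_zero.2 (ht_zeta_smul_vermaVec κ c₀ d p.1 p.2 i)).symm ▸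
          Submodule.zero_mem _)
    (fun p q hq => by
      -- Comparable labels have different compositions, so some z_i separates them; the t_{ζ_i} are
      -- not needed for this.
      obtain ⟨i, hi⟩ := Function.ne_iff.1 fun h : p.1 = q.1 => CompLT.irrefl q.1 (h ▸ hq)
      exact ⟨Sum.inl i, zEigenvalue_ne_of_isGeneric hgen hd p.2 q.2 hi⟩) (μ, T)
  rw [← lowerSpan_eq] at hf
  -- If f were zero, its leading term would lie in the span of the strictly lower basis vectors.
  have hne : f ≠ 0 := by
    rintro rfl
    rw [zero_sub, Submodule.neg_mem_iff, lowerSpan_eq μ T] at hf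
    exact hli.notMem_span_image (x := (μ, T)) (CompLT.irrefl μ) hf
  refine ⟨f, ⟨⟨hne, fun a ha => exists_smul_eq_of_mem_tSubalgebra (fun k => ⟨_, hfA k⟩) ha⟩, hf⟩,
    fun g hg hgl => huniq g ?_ fun k => ?_, fun i => ⟨hfA (Sum.inl i), hfA (Sum.inr i)⟩⟩
  · rwa [← lowerSpan_eq]
  · refine hg.2 _ (Algebra.subset_adjoin ?_)
    rcases k with i | i
    · exact Or.inl ⟨i, rfl⟩
    · exact Or.inr ⟨i, rfl⟩
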